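/- Let $\mathbb T^2=\mathbb R^2/2\pi\mathbb Z^2$, with Lebesgue measure $dx$, and let $x_1,x_2\in\mathbb T^2$ with $x_2-x_1\equiv(\alpha_1,\alpha_2)\pmod{2\pi\mathbb Z^2}$. Assume that $(\alpha_1,\alpha_2)/\pi$ is Diophantine: there are $\kappa\in\mathbb R$ and $C>0$ with $\max_{j=1,2}\left|\frac{\alpha_j}{\pi}-\frac{p_j}{q}\right|>\frac{C}{q^\kappa}$ for all $p_1,p_2,q\in\mathbb Z$, $q>0$. Let $-\Delta$ be the standard Laplacian on $L^2(\mathbb T^2)$ with domain $H^2(\mathbb T^2)$; "Laplace eigenvalue" and "Laplace eigenfunction" refer to it. For $z=\pm i$ let $G_z(x,y)=-\frac1{4\pi^2}\sum_{\xi\in\mathbb Z^2}\frac{e^{i\langle\xi,x-y\rangle}}{|\xi|^2-z}$ (in $L^2$) be the kernel of $(\Delta+z)^{-1}$, and $\mathbb G_z=(G_z(\cdot,x_1),G_z(\cdot,x_2))$. Let $c_1=\|G_i(\cdot,x_1)\|_2^2$, $c_2=\int G_i(x,x_1)\overline{G_i(x,x_2)}\,dx\in\mathbb R$ and $$T=\begin{pmatrix}\frac1{\sqrt{c_1}}&0\\-\frac{c_2}{\sqrt{c_1(c_1^2-c_2^2)}}&\sqrt{\frac{c_1}{c_1^2-c_2^2}}\end{pmatrix}.$$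 Write $\langle v,w\rangle=\overline{v_1}w_1+\overline{v_2}w_2$. For a unitary $2\times2$ matrix $U$, let $-\Delta_U$ be the self-adjoint extension of $-\Delta_0=-\Delta|_{C_c^\infty(\mathbb T^2\setminus\{x_1,x_2\})}$ whose domain consists of the functions $$g=f+\langle v,T\mathbb G_i\rangle+\langle v,UT\mathbb G_{-i}\rangle,\qquad f\in H^2(\mathbb T^2),\ f(x_1)=f(x_2)=0,\ v\in\mathbb C^2,$$ that is, the restriction of $(-\Delta_0)^*$ to this domain. (1) Let $\lambda\ne0$ be an eigenvalue of $-\Delta$. Its eigenspace has finite dimension $d$; every eigenfunction of $-\Delta_U$ with eigenvalue $\lambda$ is an eigenfunction of $-\Delta$ with eigenvalue $\lambda$; and the $\lambda$-eigenspace of $-\Delta_U$ has dimension $d-\operatorname{rank}(I+U)$. (2) If $U\ne-I$, the set $\Lambda$ of new eigenvalues (the eigenvalues of $-\Delta_U$ that are not eigenvalues of $-\Delta$) weakly interlaces with the set $\mathcal N$ of eigenvalues of $-\Delta$: $\Lambda\cap\mathcal N=\emptyset$, and there is a constant $C$ such that every bounded open interval containing no element of $\Lambda$ contains at most $C$ elements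 of $\mathcal N$, and every bounded open interval containing no element of $\mathcal N$ contains at most $C$ elements of $\Lambda$. In particular, between two neighbouring elements of either set there are at most $C$ elements of the other. -/

import Mathlib

namespace TwoScatterers

open MeasureTheory
open scoped ContDiff Real Matrix

noncomputable section

instance factTwoPiPos : Fact (0 < 2 * π) := ⟨Real.two_pi_pos⟩

/-- The torus `ℝ² / 2πℤ²`; its measure `volume` is the Lebesgue measure, of total mass `4π²`. -/
abbrev Torus : Type := Fin 2 → AddCircle (2 * π)

/-- The complex Hilbert space `L²` of the torus. Mathlib's inner product `inner ℂ f g` is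
`∫ conj f * g`. -/
abbrev L2 : Type := Lp ℂ 2 (volume : Measure Torus)

/-- The `L²` class of a continuous function on the torus. -/
def toL2 : C(Torus, ℂ) →L[ℂ] L2 := ContinuousMap.toLp 2 volume ℂ

theorem toL2_injective : Function.Injective toL2 :=
  ContinuousMap.toLp_injective (E := ℂ) (p := 2) (𝕜 := ℂ) (volume : Measure Torus)

/-! ### Smooth functions and their Laplacian -/

/-- The quotient map `ℝ² → ℝ² / 2πℤ²`. -/
def proj (y : EuclideanSpace ℝ (Fin 2)) : Torus := fun j => ((y j : ℝ) : AddCircle (2 * π))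

theorem proj_add (y z : EuclideanSpace ℝ (Fin 2)) : proj (y + z) = proj y + proj z := by
  funext j; simp [proj]

theorem proj_zero : proj 0 = 0 := by
  funext j; simp [proj]

theorem proj_isQuotientMap : Topology.IsQuotientMap proj := by
  have h : IsOpenQuotientMap (fun y : Fin 2 → ℝ => (fun j => ((y j : ℝ) : AddCircle (2 * π)))) :=
    IsOpenQuotientMap.piMap (fun _ => QuotientAddGroup.isOpenQuotientMap_mk)
  exact h.isQuotientMap.comp
    (EuclideanSpace.equiv (Fin 2) ℝ).toHomeomorph.isQuotientMap

/-- A function on the torus is smooth when its lift to `ℝ²` is. -/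
def IsSmooth (φ : Torus → ℂ) : Prop := ContDiff ℝ ∞ (fun y => φ (proj y))

/-- The Laplacian of a function `φ` on the torus: at `x` it is the Euclidean Laplacian at `0` of
`y ↦ φ (x + y)`. -/
def lapl (φ : Torus → ℂ) (x : Torus) : ℂ :=
  Laplacian.laplacian (fun y : EuclideanSpace ℝ (Fin 2) => φ (x + proj y)) 0

theorem two_le_smooth : (2 : WithTop ℕ∞) ≤ ∞ := by
  exact WithTop.coe_le_coe.2 (le_top : (2 : ℕ∞) ≤ ⊤)

theorem lapl_proj (φ : Torus → ℂ) (z : EuclideanSpace ℝ (Fin 2)) :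
    lapl φ (proj z) = Laplacian.laplacian (fun y => φ (proj y)) z := by
  unfold lapl
  simp only [InnerProductSpace.laplacian_eq_iteratedFDeriv_stdOrthonormalBasis]
  have h : (fun y : EuclideanSpace ℝ (Fin 2) => φ (proj z + proj y))
      = fun y => (fun w => φ (proj w)) (z + y) := by
    funext y; simp only [proj_add]
  rw [h]
  have h2 := iteratedFDeriv_comp_add_left (𝕜 := ℝ) (f := fun w => φ (proj w)) 2 z 0
  rw [add_zero] at h2
  simp only [h2]

theorem lapl_continuous {φ : Torus → ℂ} (h : IsSmooth φ) : Continuous (lapl φ) := by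
  rw [proj_isQuotientMap.continuous_iff]
  have e : lapl φ ∘ proj = Laplacian.laplacian (fun y => φ (proj y)) := by
    funext z; exact lapl_proj φ z
  rw [e, InnerProductSpace.laplacian_eq_iteratedFDeriv_stdOrthonormalBasis]
  refine continuous_finsetSum _ fun i _ => ?_
  have hc : Continuous (iteratedFDeriv ℝ 2 fun y => φ (proj y)) :=
    ContDiff.continuous_iteratedFDeriv (n := ∞) two_le_smooth h
  let e : Fin 2 → EuclideanSpace ℝ (Fin 2) :=
    ![stdOrthonormalBasis ℝ _ i, stdOrthonormalBasis ℝ _ i]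
  exact (ContinuousMultilinearMap.apply ℝ (fun _ : Fin 2 => EuclideanSpace ℝ (Fin 2)) ℂ
    e).continuous.comp hc

theorem lapl_add {φ ψ : Torus → ℂ} (h₁ : IsSmooth φ) (h₂ : IsSmooth ψ) :
    lapl (φ + ψ) = lapl φ + lapl ψ := by
  funext x
  obtain ⟨z, rfl⟩ := proj_isQuotientMap.surjective x
  simp only [Pi.add_apply, lapl_proj]
  exact ContDiffAt.laplacian_add (h₁.contDiffAt.of_le two_le_smooth)
    (h₂.contDiffAt.of_le two_le_smooth)

theorem lapl_smul (c : ℂ) {φ : Torus → ℂ} (h : IsSmooth φ) : lapl (c • φ) = c • lapl φ := by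
  funext x
  obtain ⟨z, rfl⟩ := proj_isQuotientMap.surjective x
  simp only [Pi.smul_apply, lapl_proj]
  simp only [InnerProductSpace.laplacian_eq_iteratedFDeriv_stdOrthonormalBasis]
  have h2 : ContDiffAt ℝ 2 (fun y => φ (proj y)) z :=
    h.contDiffAt.of_le two_le_smooth
  have := iteratedFDeriv_const_smul_apply (i := 2) (a := c) h2
  simp only [Pi.smul_def] at this
  rw [this, Finset.smul_sum]
  rfl

/-- The smooth functions on the torus whose (compact) support is disjoint from `S`, that is,
`C_c^∞` of the complement of `S`. -/
def testFunctions (S : Set Torus) : Submodule ℂ C(Torus, ℂ) where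
  carrier := {φ | IsSmooth φ ∧ Disjoint (tsupport φ) S}
  zero_mem' := by
    refine ⟨?_, ?_⟩
    · exact (contDiff_const : ContDiff ℝ ∞ fun _ : EuclideanSpace ℝ (Fin 2) => (0 : ℂ))
    · simp [tsupport]
  add_mem' := by
    rintro φ ψ ⟨h₁, h₂⟩ ⟨h₃, h₄⟩
    exact ⟨ContDiff.add h₁ h₃, (h₂.union_left h₄).mono_left (tsupport_add φ ψ)⟩
  smul_mem' := by
    rintro c φ ⟨h₁, h₂⟩
    exact ⟨ContDiff.const_smul c h₁,
      h₂.mono_left (tsupport_smul_subset_right (fun _ => c) φ)⟩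

/-- The operator `φ ↦ -Δφ` on test functions, with values in `L²`. -/
def negLaplTest (S : Set Torus) : testFunctions S →ₗ[ℂ] L2 where
  toFun φ := -toL2 ⟨lapl φ.1, lapl_continuous φ.2.1⟩
  map_add' φ ψ := by
    rw [← neg_add, ← map_add]
    congr 2
    ext x
    exact congrFun (lapl_add φ.2.1 ψ.2.1) x
  map_smul' c φ := by
    rw [RingHom.id_apply, smul_neg, ← map_smul]
    congr 2
    ext x
    exact congrFun (lapl_smul c φ.2.1) x

/-- A test function is determined by its `L²` class. -/
def testEquiv (S : Set Torus) :
    testFunctions S ≃ₗ[ℂ] LinearMap.range (toL2.toLinearMap.comp (testFunctions S).subtype) :=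
  LinearEquiv.ofInjective _ (toL2_injective.comp Subtype.val_injective)

/-- The symmetric operator `-Δ` in `L²` with domain `C_c^∞` of the complement of `S`. -/
def negLaplaceMin (S : Set Torus) : L2 →ₗ.[ℂ] L2 where
  domain := LinearMap.range (toL2.toLinearMap.comp (testFunctions S).subtype)
  toFun := negLaplTest S ∘ₗ (testEquiv S).symm.toLinearMap

/-! ### Fourier analysis and the Sobolev space `H²` -/

/-- The character `x ↦ exp (i ⟨ξ, x⟩)`. -/
def character (ξ : Fin 2 → ℤ) : C(Torus, ℂ) where
  toFun x := ∏ j, fourier (ξ j) (x j)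
  continuous_toFun := by fun_prop

/-- `|ξ|²` for `ξ ∈ ℤ²`. -/
def normSq (ξ : Fin 2 → ℤ) : ℝ := ∑ j, (ξ j : ℝ) ^ 2

/-- The Fourier coefficient `(1 / 4π²) ∫ f(x) exp (-i ⟨ξ, x⟩) dx`. -/
def fourierCoefficient (f : L2) (ξ : Fin 2 → ℤ) : ℂ :=
  1 / (4 * (π : ℂ) ^ 2) * inner ℂ (toL2 (character ξ)) f

theorem fourierCoefficient_add (f g : L2) (ξ : Fin 2 → ℤ) :
    fourierCoefficient (f + g) ξ = fourierCoefficient f ξ + fourierCoefficient g ξ := by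
  simp only [fourierCoefficient, inner_add_right]; ring

theorem fourierCoefficient_smul (c : ℂ) (f : L2) (ξ : Fin 2 → ℤ) :
    fourierCoefficient (c • f) ξ = c * fourierCoefficient f ξ := by
  simp only [fourierCoefficient, inner_smul_right]; ring

/-- The Sobolev space `H²` of the torus. -/
def sobolevH2 : Submodule ℂ L2 where
  carrier := {f | Summable fun ξ => (1 + normSq ξ) ^ 2 * ‖fourierCoefficient f ξ‖ ^ 2}
  zero_mem' := by simp [fourierCoefficient, summable_zero]
  add_mem' := by
    intro f g hf hg
    refine Summable.of_nonneg_of_le (fun ξ => by positivity) (fun ξ => ?_)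
      ((hf.add hg).mul_left 2)
    have h1 : ‖fourierCoefficient (f + g) ξ‖ ^ 2
        ≤ 2 * (‖fourierCoefficient f ξ‖ ^ 2 + ‖fourierCoefficient g ξ‖ ^ 2) := by
      rw [fourierCoefficient_add]
      have := norm_add_le (fourierCoefficient f ξ) (fourierCoefficient g ξ)
      have h0 := norm_nonneg (fourierCoefficient f ξ + fourierCoefficient g ξ)
      nlinarith [sq_nonneg (‖fourierCoefficient f ξ‖ - ‖fourierCoefficient g ξ‖)]
    have h2 := mul_le_mul_of_nonneg_left h1 (sq_nonneg (1 + normSq ξ))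
    linarith
  smul_mem' := by
    intro c f hf
    refine (Summable.mul_left (‖c‖ ^ 2) hf).congr fun ξ => ?_
    rw [fourierCoefficient_smul, norm_mul]; ring

/-- The functions `f ∈ H²` with `f(x₁) = f(x₂) = 0`, where point values are those of the continuous
representative. -/
def sobolevH2Vanishing (x₁ x₂ : Torus) : Submodule ℂ L2 where
  carrier := {f | f ∈ sobolevH2 ∧ ∃ F : C(Torus, ℂ), toL2 F = f ∧ F x₁ = 0 ∧ F x₂ = 0}
  zero_mem' := ⟨sobolevH2.zero_mem, 0, map_zero _, rfl, rfl⟩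
  add_mem' := by
    rintro f g ⟨hf, F, hF, h1, h2⟩ ⟨hg, G, hG, h3, h4⟩
    exact ⟨sobolevH2.add_mem hf hg, F + G, by rw [map_add, hF, hG],
      by simp [h1, h3], by simp [h2, h4]⟩
  smul_mem' := by
    rintro c f ⟨hf, F, hF, h1, h2⟩
    exact ⟨sobolevH2.smul_mem c hf, c • F, by rw [map_smul, hF], by simp [h1], by simp [h2]⟩

/-- The standard Laplacian `-Δ` with domain `H²` of the torus; it acts in the sense of
distributions, i.e. as the adjoint of `-Δ` on `C^∞` of the torus. -/
def negLaplace : L2 →ₗ.[ℂ] L2 := (negLaplaceMin ∅).adjoint.domRestrict sobolevH2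

/-! ### Green's functions and the self-adjoint extensions -/

/-- The Green's function `G_z(·, y) = (Δ + z)⁻¹ δ_y`, given by its expansion in `L²`
`-(1 / 4π²) ∑ exp (i ⟨ξ, x - y⟩) / (|ξ|² - z)`, for `z` not a Laplace eigenvalue. -/
def green (z : ℂ) (y : Torus) : L2 :=
  ∑' ξ : Fin 2 → ℤ,
    (-(1 / (4 * (π : ℂ) ^ 2)) * (star (character ξ y) / ((normSq ξ : ℂ) - z))) •
      toL2 (character ξ)

/-- The pair `(G_z(·, x₁), G_z(·, x₂))`. -/
def greenPair (x₁ x₂ : Torus) (z : ℂ) : Fin 2 → L2 := ![green z x₁, green z x₂]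

/-- `c₁ = ‖G_i(·, x_j)‖²`, which does not depend on `j`. -/
def c₁ (x₁ : Torus) : ℝ := ‖green Complex.I x₁‖ ^ 2

/-- `c₂ = ∫ G_i(x, x₁) conj (G_i(x, x₂)) dx`, which is a real number. -/
def c₂ (x₁ x₂ : Torus) : ℝ := (inner ℂ (green Complex.I x₂) (green Complex.I x₁)).re

/-- The Gram-Schmidt matrix, for which `T 𝔾_i` and `T 𝔾_{-i}` are orthonormal bases of the
deficiency spaces. -/
def gramT (x₁ x₂ : Torus) : Matrix (Fin 2) (Fin 2) ℂ :=
  !![((1 / √(c₁ x₁) : ℝ) : ℂ), 0;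
     ((-(c₂ x₁ x₂) / √(c₁ x₁ * (c₁ x₁ ^ 2 - c₂ x₁ x₂ ^ 2)) : ℝ) : ℂ),
     ((√(c₁ x₁ / (c₁ x₁ ^ 2 - c₂ x₁ x₂ ^ 2)) : ℝ) : ℂ)]

/-- `⟨v, M 𝔾⟩ = ∑ⱼ conj(vⱼ) (M 𝔾)ⱼ` for `v ∈ ℂ²`, a matrix `M` and a pair `𝔾` of functions. -/
def pairing (v : Fin 2 → ℂ) (M : Matrix (Fin 2) (Fin 2) ℂ) (𝔾 : Fin 2 → L2) : L2 :=
  ∑ j, star (v j) • ∑ k, M j k • 𝔾 k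

theorem pairing_add (v w : Fin 2 → ℂ) (M : Matrix (Fin 2) (Fin 2) ℂ) (𝔾 : Fin 2 → L2) :
    pairing (v + w) M 𝔾 = pairing v M 𝔾 + pairing w M 𝔾 := by
  simp only [pairing, Pi.add_apply, star_add, add_smul, Finset.sum_add_distrib]

theorem pairing_smul (c : ℂ) (v : Fin 2 → ℂ) (M : Matrix (Fin 2) (Fin 2) ℂ) (𝔾 : Fin 2 → L2) :
    pairing (star c • v) M 𝔾 = c • pairing v M 𝔾 := by
  simp [pairing, mul_smul]

/-- The domain of `-Δ_U`: the functions `f + ⟨v, T 𝔾_i⟩ + ⟨v, U T 𝔾_{-i}⟩` with `f ∈ H²`,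
`f(x₁) = f(x₂) = 0` and `v ∈ ℂ²`. -/
def extensionDomain (x₁ x₂ : Torus) (U : Matrix.unitaryGroup (Fin 2) ℂ) : Submodule ℂ L2 where
  carrier := {g | ∃ f ∈ sobolevH2Vanishing x₁ x₂, ∃ v : Fin 2 → ℂ,
    g = f + pairing v (gramT x₁ x₂) (greenPair x₁ x₂ Complex.I)
      + pairing v ((U : Matrix (Fin 2) (Fin 2) ℂ) * gramT x₁ x₂)
          (greenPair x₁ x₂ (-Complex.I))}
  zero_mem' := ⟨0, Submodule.zero_mem _, 0, by simp [pairing]⟩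
  add_mem' := by
    rintro _ _ ⟨f, hf, v, rfl⟩ ⟨g, hg, w, rfl⟩
    refine ⟨f + g, Submodule.add_mem _ hf hg, v + w, ?_⟩
    rw [pairing_add, pairing_add]; abel
  smul_mem' := by
    rintro c _ ⟨f, hf, v, rfl⟩
    refine ⟨c • f, Submodule.smul_mem _ c hf, star c • v, ?_⟩
    rw [pairing_smul, pairing_smul, smul_add, smul_add]

/-- The self-adjoint extension `-Δ_U` of `-Δ` on `C_c^∞` of the torus without `x₁, x₂`: the
restriction of the adjoint of that operator to the domain above. -/
def negLaplaceExt (x₁ x₂ : Torus) (U : Matrix.unitaryGroup (Fin 2) ℂ) : L2 →ₗ.[ℂ] L2 :=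
  (negLaplaceMin {x₁, x₂}).adjoint.domRestrict (extensionDomain x₁ x₂ U)

/-! ### Eigenvalues -/

/-- The eigenspace `{g ∈ Dom A : A g = μ g}` of an unbounded operator. -/
def eigenspace (A : L2 →ₗ.[ℂ] L2) (μ : ℝ) : Submodule ℂ L2 where
  carrier := {g | ∃ h : g ∈ A.domain, A ⟨g, h⟩ = (μ : ℂ) • g}
  zero_mem' := ⟨A.domain.zero_mem, by
    rw [smul_zero]; exact A.map_zero⟩
  add_mem' := by
    rintro f g ⟨hf, h1⟩ ⟨hg, h2⟩
    refine ⟨A.domain.add_mem hf hg, ?_⟩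
    rw [smul_add, ← h1, ← h2, ← A.map_add]; rfl
  smul_mem' := by
    rintro c f ⟨hf, h1⟩
    refine ⟨A.domain.smul_mem c hf, ?_⟩
    rw [smul_comm, ← h1, ← A.map_smul]; rfl

/-- The set of (real) eigenvalues. -/
def eigenvalues (A : L2 →ₗ.[ℂ] L2) : Set ℝ := {μ | eigenspace A μ ≠ ⊥}

/-- The new eigenvalues of `-Δ_U`: those which are not eigenvalues of the standard Laplacian. -/
def newEigenvalues (x₁ x₂ : Torus) (U : Matrix.unitaryGroup (Fin 2) ℂ) : Set ℝ :=
  eigenvalues (negLaplaceExt x₁ x₂ U) \ eigenvalues negLaplace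

/-- `A` and `B` are disjoint and there is a constant `C` such that an open interval without
elements of `A` (such as the one between two neighbouring elements of `A`) contains at most `C`
elements of `B`, and vice versa. -/
def WeaklyInterlaces (A B : Set ℝ) : Prop :=
  Disjoint A B ∧ ∃ C : ℕ, ∀ s t : ℝ,
    (Disjoint (Set.Ioo s t) A → (Set.Ioo s t ∩ B).encard ≤ C) ∧
    (Disjoint (Set.Ioo s t) B → (Set.Ioo s t ∩ A).encard ≤ C)

/-- A vector in `ℝ²` is Diophantine if it is Diophantine of some type `κ`. -/
def IsDiophantine (a : Fin 2 → ℝ) : Prop :=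
  ∃ κ C : ℝ, 0 < C ∧ ∀ p₁ p₂ q : ℤ, 0 < q →
    C / (q : ℝ) ^ κ < max |a 0 - p₁ / q| |a 1 - p₂ / q|

end

end TwoScatterers

open TwoScatterers

namespace TwoScatterers

open MeasureTheory Filter Topology
open scoped ContDiff Real Matrix ComplexConjugate

noncomputable section

/-! ### Characters and Fourier series on the torus -/

theorem character_apply (ξ : Fin 2 → ℤ) (x : Torus) :
    character ξ x = ∏ j, fourier (ξ j) (x j) := rfl

theorem character_neg_left (ξ : Fin 2 → ℤ) (x : Torus) :
    character (-ξ) x = conj (character ξ x) := by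
  simp only [character_apply, Pi.neg_apply, fourier_neg, map_prod]

theorem character_add_left (ξ η : Fin 2 → ℤ) (x : Torus) :
    character (ξ + η) x = character ξ x * character η x := by
  simp only [character_apply, Pi.add_apply, fourier_add, ← Finset.prod_mul_distrib]

theorem character_zero_left : character 0 = 1 := by
  ext x; simp only [character_apply, Pi.zero_apply, fourier_zero, Finset.prod_const_one,
    ContinuousMap.one_apply]

theorem character_add_right (ξ : Fin 2 → ℤ) (x y : Torus) :
    character ξ (x + y) = character ξ x * character ξ y := by
  simp only [character_apply, Pi.add_apply, ← Finset.prod_mul_distrib]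
  refine Finset.prod_congr rfl fun j _ => ?_
  rw [fourier_apply, fourier_apply, fourier_apply, smul_add, AddCircle.toCircle_add, Circle.coe_mul]

theorem norm_character (ξ : Fin 2 → ℤ) (x : Torus) : ‖character ξ x‖ = 1 := by
  simp only [character_apply, norm_prod, fourier_apply, Circle.norm_coe, Finset.prod_const_one]

theorem conj_mul_character (ξ : Fin 2 → ℤ) (x : Torus) :
    conj (character ξ x) * character ξ x = 1 := by
  rw [mul_comm, Complex.mul_conj, Complex.normSq_eq_norm_sq, norm_character]; simp

theorem character_neg_right (ξ : Fin 2 → ℤ) (x : Torus) :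
    character ξ (-x) = conj (character ξ x) := by
  simp only [character_apply, Pi.neg_apply, map_prod]
  refine Finset.prod_congr rfl fun j _ => ?_
  rw [← fourier_neg, fourier_apply, fourier_apply, smul_neg, neg_smul]

theorem character_sub_right (ξ : Fin 2 → ℤ) (x y : Torus) :
    character ξ (x - y) = character ξ x * conj (character ξ y) := by
  rw [sub_eq_add_neg, character_add_right, character_neg_right]

theorem integral_fourier_addCircle (m : ℤ) :
    ∫ x : AddCircle (2 * π), fourier m x = if m = 0 then (2 * π : ℂ) else 0 := by
  split_ifs with h
  · subst h
    simp [Measure.real, AddCircle.measure_univ, Real.pi_pos.le]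
  -- A suitable translation changes the sign of the character, so its integral equals its own
  -- negative.
  · have := integral_eq_zero_of_add_right_eq_neg (μ := (volume : Measure (AddCircle (2 * π))))
      (fourier_add_half_inv_index h Real.two_pi_pos)
    exact this

theorem integral_character (ξ : Fin 2 → ℤ) :
    ∫ x : Torus, character ξ x = if ξ = 0 then (4 * π ^ 2 : ℂ) else 0 := by
  simp only [character_apply]
  rw [MeasureTheory.integral_fintype_prod_volume_eq_prod
    (fun j (x : AddCircle (2 * π)) => (fourier (ξ j) x : ℂ))]
  simp only [integral_fourier_addCircle]
  split_ifs with h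
  · subst h; simp; ring
  · obtain ⟨i, hi⟩ := Function.ne_iff.mp h
    exact Finset.prod_eq_zero (Finset.mem_univ i) (if_neg hi)

theorem inner_toL2 (f g : C(Torus, ℂ)) : inner ℂ (toL2 f) (toL2 g) = ∫ x, g x * conj (f x) :=
  ContinuousMap.inner_toLp volume f g

theorem inner_character (ξ η : Fin 2 → ℤ) :
    inner ℂ (toL2 (character ξ)) (toL2 (character η)) = if ξ = η then (4 * π ^ 2 : ℂ) else 0 := by
  simp only [inner_toL2, ← character_neg_left, ← character_add_left, integral_character,
    add_neg_eq_zero, eq_comm]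

/-- The star subalgebra of trigonometric polynomials. -/
def trigAlgebra : StarSubalgebra ℂ C(Torus, ℂ) where
  toSubalgebra := Algebra.adjoin ℂ (Set.range character)
  star_mem' := by
    change Algebra.adjoin ℂ (Set.range character) ≤ star (Algebra.adjoin ℂ (Set.range character))
    refine Algebra.adjoin_le ?_
    rintro _ ⟨n, rfl⟩
    refine Algebra.subset_adjoin ⟨-n, ?_⟩
    ext1 x
    simp only [character_neg_left, starRingEnd_apply, ContinuousMap.star_apply]

theorem trigAlgebra_coe :
    trigAlgebra.toSubalgebra.toSubmodule = Submodule.span ℂ (Set.range character) := by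
  apply Algebra.adjoin_eq_span_of_subset
  refine .trans (fun x ↦ Submonoid.closure_induction (fun _ ↦ id) ⟨0, ?_⟩ ?_)
    Submodule.subset_span
  · exact character_zero_left
  · rintro _ _ _ _ ⟨m, rfl⟩ ⟨n, rfl⟩
    refine ⟨m + n, ?_⟩
    ext z
    rw [character_add_left, ContinuousMap.mul_apply]

theorem trigAlgebra_separatesPoints : trigAlgebra.SeparatesPoints := by
  intro x y hxy
  rw [Ne, funext_iff, not_forall] at hxy
  obtain ⟨i, hi⟩ := hxy
  refine ⟨_, ⟨character (Pi.single i 1), Algebra.subset_adjoin ⟨Pi.single i 1, rfl⟩, rfl⟩, ?_⟩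
  have key : ∀ z : Torus, character (Pi.single i 1) z = fourier 1 (z i) := by
    intro z
    rw [character_apply, Finset.prod_eq_single i]
    · rw [Pi.single_eq_same]
    · intro j _ hj; rw [Pi.single_eq_of_ne hj, fourier_zero]
    · simp
  intro h
  have h1 : character (Pi.single i 1) x = character (Pi.single i 1) y := h
  rw [key, key, fourier_one, fourier_one] at h1
  exact hi (AddCircle.injective_toCircle Real.two_pi_pos.ne' (Circle.ext h1))

/-- Stone–Weierstrass. Characters are closed under multiplication, so the algebra they generate is
just their span. -/
theorem span_character_closure :
    (Submodule.span ℂ (Set.range character)).topologicalClosure = ⊤ := by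
  rw [← trigAlgebra_coe]
  exact congr_arg (Subalgebra.toSubmodule <| StarSubalgebra.toSubalgebra ·)
    (ContinuousMap.starSubalgebra_topologicalClosure_eq_top_of_separatesPoints _
    trigAlgebra_separatesPoints)

theorem span_toL2_character_closure :
    (Submodule.span ℂ (Set.range fun ξ => toL2 (character ξ))).topologicalClosure = ⊤ := by
  have := (ContinuousMap.toLp_denseRange (p := 2) ℂ (volume : Measure Torus) ℂ
      (by simp)).topologicalClosure_map_submodule span_character_closure
  rw [Submodule.map_span, ← Set.range_comp] at this
  exact this

/-- The normalized characters. -/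
def normalizedCharacter (ξ : Fin 2 → ℤ) : L2 := (1 / (2 * π) : ℂ) • toL2 (character ξ)

theorem pi_ne : (π : ℂ) ≠ 0 := Complex.ofReal_ne_zero.2 Real.pi_ne_zero

theorem orthonormal_normalizedCharacter : Orthonormal ℂ normalizedCharacter := by
  rw [orthonormal_iff_ite]
  intro ξ η
  simp only [normalizedCharacter, inner_smul_left, inner_smul_right, inner_character]
  split_ifs with h
  · have := pi_ne
    simp only [map_div₀, map_one, map_mul, map_ofNat, Complex.conj_ofReal]
    field_simp
    norm_num
  · simp

/-- The Hilbert basis of normalized characters. -/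
def fourierBasis : HilbertBasis (Fin 2 → ℤ) ℂ L2 :=
  HilbertBasis.mk orthonormal_normalizedCharacter <| by
    rw [← span_toL2_character_closure]
    apply Submodule.topologicalClosure_mono
    rw [Submodule.span_le]
    rintro _ ⟨ξ, rfl⟩
    have : toL2 (character ξ) = (2 * π : ℂ) • normalizedCharacter ξ := by
      rw [normalizedCharacter, smul_smul, mul_one_div_cancel (by simp), one_smul]
    simp only [this]
    exact Submodule.smul_mem _ _ (Submodule.subset_span ⟨ξ, rfl⟩)

theorem fourierBasis_apply (ξ : Fin 2 → ℤ) : fourierBasis ξ = normalizedCharacter ξ := by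
  rw [fourierBasis, HilbertBasis.coe_mk]

theorem inner_fourierBasis (f : L2) (ξ : Fin 2 → ℤ) :
    inner ℂ (fourierBasis ξ) f = 2 * π * fourierCoefficient f ξ := by
  rw [fourierBasis_apply, normalizedCharacter, inner_smul_left, fourierCoefficient]
  have := pi_ne
  simp only [map_div₀, map_one, map_mul, map_ofNat, Complex.conj_ofReal]
  field_simp
  norm_num [mul_comm]

theorem fourierBasis_repr (f : L2) (ξ : Fin 2 → ℤ) :
    fourierBasis.repr f ξ = 2 * π * fourierCoefficient f ξ := by
  rw [HilbertBasis.repr_apply_apply, inner_fourierBasis]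

theorem fourierCoefficient_injective {f g : L2}
    (h : ∀ ξ, fourierCoefficient f ξ = fourierCoefficient g ξ) : f = g := by
  apply fourierBasis.repr.injective
  ext ξ
  rw [fourierBasis_repr, fourierBasis_repr, h]

/-- Parseval's identity. -/
theorem hasSum_inner (f g : L2) :
    HasSum (fun ξ => 4 * π ^ 2 * (conj (fourierCoefficient f ξ) * fourierCoefficient g ξ))
      (inner ℂ f g) := by
  refine HasSum.congr_fun (fourierBasis.hasSum_inner_mul_inner f g) fun ξ => ?_
  rw [← inner_conj_symm f, inner_fourierBasis, inner_fourierBasis]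
  simp only [map_mul, map_ofNat, Complex.conj_ofReal]
  ring

theorem hasSum_norm_sq (f : L2) :
    HasSum (fun ξ => 4 * π ^ 2 * ‖fourierCoefficient f ξ‖ ^ 2) (‖f‖ ^ 2) := by
  have h := hasSum_inner f f
  rw [inner_self_eq_norm_sq_to_K] at h
  refine Complex.hasSum_ofReal.1 ?_
  rw [Complex.ofReal_pow]
  refine HasSum.congr_fun h fun ξ => ?_
  rw [mul_comm (conj _), Complex.mul_conj, Complex.normSq_eq_norm_sq]; push_cast; ring

theorem summable_norm_sq (f : L2) : Summable fun ξ => ‖fourierCoefficient f ξ‖ ^ 2 := by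
  have h := (hasSum_norm_sq f).summable
  rwa [summable_mul_left_iff (by positivity)] at h

theorem fourierCoefficient_zero (ξ : Fin 2 → ℤ) : fourierCoefficient 0 ξ = 0 := by
  simp [fourierCoefficient]

theorem fourierCoefficient_neg (f : L2) (ξ : Fin 2 → ℤ) :
    fourierCoefficient (-f) ξ = -fourierCoefficient f ξ := by
  simp [fourierCoefficient]

theorem fourierCoefficient_sub (f g : L2) (ξ : Fin 2 → ℤ) :
    fourierCoefficient (f - g) ξ = fourierCoefficient f ξ - fourierCoefficient g ξ := by
  rw [sub_eq_add_neg, fourierCoefficient_add, fourierCoefficient_neg, sub_eq_add_neg]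

theorem fourierCoefficient_sum {ι : Type*} (s : Finset ι) (f : ι → L2) (ξ : Fin 2 → ℤ) :
    fourierCoefficient (∑ i ∈ s, f i) ξ = ∑ i ∈ s, fourierCoefficient (f i) ξ := by
  simp only [fourierCoefficient, inner_sum, Finset.mul_sum]

/-- Riesz-Fischer: a square summable family is the family of coefficients of its Fourier series. -/
theorem fourierCoefficient_tsum {a : (Fin 2 → ℤ) → ℂ} (ha : Summable fun ξ => ‖a ξ‖ ^ 2)
    (ξ : Fin 2 → ℤ) : fourierCoefficient (∑' η, a η • toL2 (character η)) ξ = a ξ := by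
  -- Characters have norm 2π, hence this factor in the coordinates with respect to the orthonormal
  -- basis.
  have hm : Memℓp (fun ξ => 2 * π * a ξ) 2 := by
    apply memℓp_gen
    simp only [ENNReal.toReal_ofNat, norm_mul, Real.rpow_ofNat, mul_pow]
    exact ha.mul_left _
  set F : lp (fun _ : Fin 2 → ℤ => ℂ) 2 := ⟨_, hm⟩
  have h := (fourierBasis.hasSum_repr_symm F).tsum_eq
  have e : ∀ η, F η • fourierBasis η = a η • toL2 (character η) := by
    intro η
    have := pi_ne
    rw [fourierBasis_apply, normalizedCharacter, smul_smul]
    congr 1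
    change 2 * π * a η * _ = _
    field_simp
  simp only [e] at h
  have h2 := fourierBasis_repr (∑' η, a η • toL2 (character η)) ξ
  rw [h, LinearIsometryEquiv.apply_symm_apply] at h2
  rw [h]
  exact (mul_left_cancel₀ (by simp) h2).symm

theorem fourierCoefficient_character (ξ η : Fin 2 → ℤ) :
    fourierCoefficient (toL2 (character η)) ξ = if ξ = η then 1 else 0 := by
  have := pi_ne
  rw [fourierCoefficient, inner_character]
  split_ifs
  · field_simp
  · simp

/-! ### Absolutely convergent Fourier series -/

theorem normSq_nonneg (ξ : Fin 2 → ℤ) : 0 ≤ normSq ξ :=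
  Finset.sum_nonneg fun _ _ => sq_nonneg _

theorem summable_inv_one_add_sq : Summable fun m : ℤ => (1 + (m : ℝ) ^ 2)⁻¹ := by
  refine Summable.of_norm_bounded_eventually (Real.summable_one_div_int_pow (p := 2).2 one_lt_two) ?_
  filter_upwards [(Set.finite_singleton (0 : ℤ)).compl_mem_cofinite] with m hm
  have : 0 < (m : ℝ) ^ 2 := by
    have : (m : ℝ) ≠ 0 := by exact_mod_cast hm
    positivity
  rw [norm_inv, Real.norm_of_nonneg (by positivity), one_div]
  exact inv_anti₀ this (by linarith)

/-- Since (1 + |ξ|²)² ≥ (1 + ξ₀²)(1 + ξ₁²), a product of two convergent one-dimensional sums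
dominates. -/
theorem summable_lattice : Summable fun ξ : Fin 2 → ℤ => ((1 + normSq ξ) ^ 2)⁻¹ := by
  have h := (summable_inv_one_add_sq.mul_of_nonneg summable_inv_one_add_sq
    (fun m => by positivity) (fun m => by positivity))
  have h2 := (finTwoArrowEquiv ℤ).summable_iff.2 h
  refine Summable.of_nonneg_of_le (fun ξ => by positivity) (fun ξ => ?_) h2
  change _ ≤ (1 + (ξ 0 : ℝ) ^ 2)⁻¹ * (1 + (ξ 1 : ℝ) ^ 2)⁻¹
  rw [← mul_inv, normSq, Fin.sum_univ_two]
  refine inv_anti₀ (by positivity) ?_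
  nlinarith [sq_nonneg (ξ 0 : ℝ), sq_nonneg (ξ 1 : ℝ), sq_nonneg ((ξ 0 : ℝ) ^ 2),
    sq_nonneg ((ξ 1 : ℝ) ^ 2), mul_nonneg (sq_nonneg (ξ 0 : ℝ)) (sq_nonneg (ξ 1 : ℝ))]

/-- Sobolev embedding in dimension two: with n = |ξ|² and a the modulus of the coefficient, 2a ≤
(1+n)²a² + (1+n)⁻², and both terms on the right are summable. -/
theorem summable_norm_of_mem_sobolevH2 {f : L2} (hf : f ∈ sobolevH2) :
    Summable fun ξ => ‖fourierCoefficient f ξ‖ := by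
  refine Summable.of_nonneg_of_le (fun ξ => norm_nonneg _) (fun ξ => ?_)
    (Summable.add hf summable_lattice)
  have h1 : 0 < 1 + normSq ξ := by linarith [normSq_nonneg ξ]
  set a := ‖fourierCoefficient f ξ‖
  have h2 := two_mul_le_add_sq ((1 + normSq ξ) * a) (1 + normSq ξ)⁻¹
  have h3 : (1 + normSq ξ) * a * (1 + normSq ξ)⁻¹ = a := by field_simp
  have h4 : 0 ≤ a := norm_nonneg _
  rw [mul_assoc, h3, mul_pow, inv_pow] at h2
  linarith

theorem continuous_tsum_character {a : (Fin 2 → ℤ) → ℂ} (ha : Summable fun ξ => ‖a ξ‖) :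
    ∃ F : C(Torus, ℂ), (∀ ξ, fourierCoefficient (toL2 F) ξ = a ξ) ∧
      ∀ x, HasSum (fun ξ => a ξ * character ξ x) (F x) := by
  have hs : Summable fun ξ => a ξ • character ξ := by
    refine Summable.of_norm_bounded ha fun ξ => ?_
    rw [norm_smul]
    refine mul_le_of_le_one_right (norm_nonneg _) ?_
    rw [ContinuousMap.norm_le _ zero_le_one]
    exact fun x => (norm_character ξ x).le
  refine ⟨∑' ξ, a ξ • character ξ, fun ξ => ?_, fun x => ?_⟩
  · rw [toL2.map_tsum hs]
    simp only [map_smul]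
    refine fourierCoefficient_tsum ?_ ξ
    have hb : ∀ᶠ ξ in cofinite, ‖‖a ξ‖ ^ 2‖ ≤ ‖a ξ‖ := by
      filter_upwards [ha.tendsto_cofinite_zero.eventually (gt_mem_nhds zero_lt_one)] with ξ h
      rw [norm_pow, norm_norm, sq]
      exact mul_le_of_le_one_left (norm_nonneg _) h.le
    exact Summable.of_norm_bounded_eventually ha hb
  · exact ContinuousMap.hasSum_apply hs.hasSum x

/-- An `L²` function with summable Fourier coefficients has a continuous representative, the sum
of its Fourier series. -/
theorem exists_continuous_rep {f : L2} (hf : Summable fun ξ => ‖fourierCoefficient f ξ‖) :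
    ∃ F : C(Torus, ℂ), toL2 F = f ∧
      ∀ x, HasSum (fun ξ => fourierCoefficient f ξ * character ξ x) (F x) := by
  obtain ⟨F, h1, h2⟩ := continuous_tsum_character hf
  exact ⟨F, fourierCoefficient_injective h1, h2⟩

theorem hasSum_apply_of_summable {F : C(Torus, ℂ)}
    (hF : Summable fun ξ => ‖fourierCoefficient (toL2 F) ξ‖) (x : Torus) :
    HasSum (fun ξ => fourierCoefficient (toL2 F) ξ * character ξ x) (F x) := by
  obtain ⟨G, h1, h2⟩ := exists_continuous_rep hF
  rw [← toL2_injective h1]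
  have := h2 x
  rwa [← h1] at this

/-- Absolute convergence identifies point values with sums of Fourier series, the form in which all
boundary conditions are computed below. -/
theorem mem_sobolevH2Vanishing_iff {x₁ x₂ : Torus} {f : L2} :
    f ∈ sobolevH2Vanishing x₁ x₂ ↔ f ∈ sobolevH2 ∧
      HasSum (fun ξ => fourierCoefficient f ξ * character ξ x₁) 0 ∧
      HasSum (fun ξ => fourierCoefficient f ξ * character ξ x₂) 0 := by
  constructor
  · rintro ⟨hf, F, rfl, h1, h2⟩
    have hs := summable_norm_of_mem_sobolevH2 hf
    exact ⟨hf, h1 ▸ hasSum_apply_of_summable hs x₁, h2 ▸ hasSum_apply_of_summable hs x₂⟩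
  · rintro ⟨hf, h1, h2⟩
    obtain ⟨F, hF, h⟩ := exists_continuous_rep (summable_norm_of_mem_sobolevH2 hf)
    exact ⟨hf, F, hF, (h x₁).unique h1, (h x₂).unique h2⟩

/-! ### Derivatives of smooth functions -/

/-- The `j`-th unit vector. -/
def unitVector (j : Fin 2) : EuclideanSpace ℝ (Fin 2) := EuclideanSpace.basisFun (Fin 2) ℝ j

/-- The `j`-th partial derivative of a function on the torus. -/
def partialDeriv (j : Fin 2) (φ : Torus → ℂ) (x : Torus) : ℂ :=
  deriv (fun t : ℝ => φ (x + proj (t • unitVector j))) 0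

theorem IsSmooth.continuous {φ : Torus → ℂ} (h : IsSmooth φ) : Continuous φ := by
  rw [proj_isQuotientMap.continuous_iff]
  exact ContDiff.continuous (n := ∞) h

theorem IsSmooth.hasDerivAt_proj {φ : Torus → ℂ} (h : IsSmooth φ) (j : Fin 2)
    (z : EuclideanSpace ℝ (Fin 2)) :
    HasDerivAt (fun t : ℝ => φ (proj z + proj (t • unitVector j)))
      (fderiv ℝ (fun y => φ (proj y)) z (unitVector j)) 0 := by
  have hd : DifferentiableAt ℝ (fun y => φ (proj y)) z :=
    (ContDiff.differentiable (n := ∞) h (by simp)) z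
  have h1 := hd.hasFDerivAt.hasLineDerivAt (unitVector j)
  have h2 : HasDerivAt (fun t : ℝ => φ (proj (z + t • unitVector j)))
    (fderiv ℝ (fun y => φ (proj y)) z (unitVector j)) 0 := h1
  simpa only [proj_add] using h2

theorem partialDeriv_proj {φ : Torus → ℂ} (h : IsSmooth φ) (j : Fin 2)
    (z : EuclideanSpace ℝ (Fin 2)) :
    partialDeriv j φ (proj z) = fderiv ℝ (fun y => φ (proj y)) z (unitVector j) :=
  (h.hasDerivAt_proj j z).deriv

theorem IsSmooth.partialDeriv {φ : Torus → ℂ} (h : IsSmooth φ) (j : Fin 2) :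
    IsSmooth (partialDeriv j φ) := by
  have e : (fun z => TwoScatterers.partialDeriv j φ (proj z))
      = fun z => fderiv ℝ (fun y => φ (proj y)) z (unitVector j) :=
    funext (partialDeriv_proj h j)
  unfold IsSmooth
  rw [e]
  exact (ContDiff.fderiv_right (n := ∞) (m := ∞) h le_rfl).clm_apply contDiff_const

theorem IsSmooth.hasDerivAt {φ : Torus → ℂ} (h : IsSmooth φ) (j : Fin 2) (x : Torus) (t : ℝ) :
    HasDerivAt (fun t : ℝ => φ (x + proj (t • unitVector j)))
      (TwoScatterers.partialDeriv j φ (x + proj (t • unitVector j))) t := by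
  obtain ⟨z, rfl⟩ := proj_isQuotientMap.surjective x
  have h1 := h.hasDerivAt_proj j (z + t • unitVector j)
  rw [← proj_add, partialDeriv_proj h]
  have h0 : HasDerivAt (fun s : ℝ => s - t) 1 t := (hasDerivAt_id t).sub_const t
  rw [← sub_self t] at h1
  have h2 := HasDerivAt.scomp (h := fun s : ℝ => s - t) t h1 h0
  rw [one_smul] at h2
  refine h2.congr_of_eventuallyEq (Eventually.of_forall fun s => ?_)
  simp only [Function.comp, ← proj_add]
  congr 2
  rw [add_assoc, ← add_smul]; congr 2; ring

theorem lapl_eq_sum_partialDeriv {φ : Torus → ℂ} (h : IsSmooth φ) :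
    lapl φ = fun x => ∑ j, partialDeriv j (partialDeriv j φ) x := by
  funext x
  obtain ⟨z, rfl⟩ := proj_isQuotientMap.surjective x
  rw [lapl_proj, InnerProductSpace.laplacian_eq_iteratedFDeriv_orthonormalBasis _
    (EuclideanSpace.basisFun (Fin 2) ℝ)]
  refine Finset.sum_congr rfl fun j _ => ?_
  rw [iteratedFDeriv_two_apply, partialDeriv_proj (h.partialDeriv j)]
  have e : (fun z => partialDeriv j φ (proj z))
      = fun z => fderiv ℝ (fun y => φ (proj y)) z (unitVector j) :=
    funext (partialDeriv_proj h j)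
  have hd : DifferentiableAt ℝ (fderiv ℝ (fun y => φ (proj y))) z :=
    (ContDiff.fderiv_right (n := ∞) (m := ∞) h le_rfl).differentiable (by simp) z
  rw [e, fderiv_clm_apply hd (differentiableAt_const _)]
  simp [unitVector]

theorem fourierCoefficient_toL2 (F : C(Torus, ℂ)) (ξ : Fin 2 → ℤ) :
    fourierCoefficient (toL2 F) ξ = 1 / (4 * (π : ℂ) ^ 2) * ∫ x, F x * conj (character ξ x) := by
  rw [fourierCoefficient, inner_toL2]

theorem character_proj_smul (ξ : Fin 2 → ℤ) (j : Fin 2) (t : ℝ) :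
    character ξ (proj (t • unitVector j)) = Complex.exp (Complex.I * ξ j * t) := by
  have := pi_ne
  rw [character_apply, Finset.prod_eq_single j]
  · simp only [proj, unitVector]
    rw [fourier_coe_apply]
    congr 1
    simp
    field_simp
  · intro k _ hk
    simp [proj, unitVector, hk]
  · simp

theorem integral_translate_mul_character (φ : Torus → ℂ) (ξ : Fin 2 → ℤ) (y : Torus) :
    ∫ x, φ (x + y) * conj (character ξ x) = character ξ y * ∫ x, φ x * conj (character ξ x) := by
  have h := integral_add_right_eq_self (μ := (volume : Measure Torus))
    (fun x => φ x * conj (character ξ (x - y))) y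
  simp only [add_sub_cancel_right] at h
  rw [h, ← integral_const_mul]
  refine integral_congr_ae (Eventually.of_forall fun x => ?_)
  simp only [character_sub_right, map_mul, Complex.conj_conj]
  ring

/-- Integration by parts through translation invariance: the integral of a translate of φ against
the conjugate character is differentiated at t = 0, once under the integral sign and once in the
factor exp(iξ_j t). -/
theorem integral_partialDeriv {φ : Torus → ℂ} (h : IsSmooth φ) (j : Fin 2) (ξ : Fin 2 → ℤ) :
    ∫ x, partialDeriv j φ x * conj (character ξ x)
      = Complex.I * ξ j * ∫ x, φ x * conj (character ξ x) := by
  have hc : Continuous fun x => conj (character ξ x) :=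
    Complex.continuous_conj.comp (character ξ).continuous
  obtain ⟨M, hM⟩ := (isCompact_range (h.partialDeriv j).continuous.norm).bddAbove
  have hM' : ∀ x, ‖partialDeriv j φ x‖ ≤ M := fun x => hM ⟨x, rfl⟩
  have key := hasDerivAt_integral_of_dominated_loc_of_deriv_le (μ := (volume : Measure Torus))
    (F := fun (t : ℝ) x => φ (x + proj (t • unitVector j)) * conj (character ξ x))
    (F' := fun (t : ℝ) x => partialDeriv j φ (x + proj (t • unitVector j)) * conj (character ξ x))
    (bound := fun _ => M) (x₀ := 0) (s := Set.univ) univ_mem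
    (Eventually.of_forall fun t =>
      ((h.continuous.comp (continuous_add_const _)).mul hc).aestronglyMeasurable)
    (((h.continuous.comp (continuous_add_const _)).mul hc).integrable_of_hasCompactSupport
      (HasCompactSupport.of_compactSpace _))
    (((h.partialDeriv j).continuous.comp (continuous_add_const _)).mul hc).aestronglyMeasurable
    (Eventually.of_forall fun x t _ => by
      rw [norm_mul, RCLike.norm_conj, norm_character, mul_one]; exact hM' _)
    (integrable_const M)
    (Eventually.of_forall fun x t _ => (h.hasDerivAt j x t).mul_const _)
  have h1 := key.2
  simp only [integral_translate_mul_character, character_proj_smul, zero_smul, proj_zero,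
    add_zero] at h1
  have h2 : HasDerivAt (fun t : ℝ => Complex.exp (Complex.I * ξ j * t)) (Complex.I * ξ j) 0 := by
    have h3 : HasDerivAt (fun t : ℝ => Complex.I * ξ j * (t : ℂ)) (Complex.I * ξ j) 0 := by
      simpa using (Complex.ofRealCLM.hasDerivAt (x := (0 : ℝ))).const_mul (Complex.I * (ξ j : ℂ))
    simpa using h3.cexp
  have h4 := h1.unique (h2.mul_const (∫ x, φ x * conj (character ξ x)))
  simpa [proj_zero] using h4

theorem fourierCoefficient_lapl {φ : Torus → ℂ} (h : IsSmooth φ) (ξ : Fin 2 → ℤ) :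
    fourierCoefficient (toL2 ⟨lapl φ, lapl_continuous h⟩) ξ
      = -normSq ξ * fourierCoefficient (toL2 ⟨φ, h.continuous⟩) ξ := by
  rw [fourierCoefficient_toL2, fourierCoefficient_toL2]
  simp only [ContinuousMap.coe_mk]
  rw [lapl_eq_sum_partialDeriv h]
  have hi : ∀ j, Integrable fun x =>
      partialDeriv j (partialDeriv j φ) x * conj (character ξ x) := fun j =>
    (((h.partialDeriv j).partialDeriv j).continuous.mul
      (Complex.continuous_conj.comp (character ξ).continuous)).integrable_of_hasCompactSupport
      (HasCompactSupport.of_compactSpace _)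
  simp only [Finset.sum_mul]
  rw [integral_finsetSum _ fun j _ => hi j]
  simp only [integral_partialDeriv (h.partialDeriv _), integral_partialDeriv h, Fin.sum_univ_two,
    normSq]
  push_cast
  linear_combination (1 / (4 * (π : ℂ) ^ 2) * (∫ x, φ x * conj (character ξ x))
    * ((ξ 0 : ℂ) ^ 2 + (ξ 1 : ℂ) ^ 2)) * Complex.I_sq

/-! ### Density of the test functions -/

theorem isSmooth_character (ξ : Fin 2 → ℤ) : IsSmooth (character ξ) := by
  have e : (fun y => character ξ (proj y))
      = fun y : EuclideanSpace ℝ (Fin 2) =>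
        ∏ j, Complex.exp (2 * π * Complex.I * ξ j * (y j : ℝ) / (2 * π : ℝ)) := by
    funext y
    simp only [character_apply, proj, fourier_coe_apply]
  unfold IsSmooth
  rw [e]
  refine contDiff_prod fun j _ => Complex.contDiff_exp.comp ?_
  refine ContDiff.div_const (contDiff_const.mul ?_) _
  have hp : ContDiff ℝ ∞ fun y : EuclideanSpace ℝ (Fin 2) => y j :=
    (EuclideanSpace.proj j : EuclideanSpace ℝ (Fin 2) →L[ℝ] ℝ).contDiff
  exact Complex.ofRealCLM.contDiff.comp hp

theorem character_zero_right (ξ : Fin 2 → ℤ) : character ξ 0 = 1 := by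
  simp only [character_apply, Pi.zero_apply, fourier_eval_zero, Finset.prod_const_one]

/-- A smooth function which vanishes precisely at `y`. -/
def bump (y x : Torus) : ℝ := ∑ j, (1 - (character (Pi.single j 1) (x - y)).re)

theorem one_sub_re_nonneg (ξ : Fin 2 → ℤ) (x : Torus) : 0 ≤ 1 - (character ξ x).re := by
  have := Complex.re_le_norm (character ξ x)
  rw [norm_character] at this
  linarith

theorem continuous_bump (y : Torus) : Continuous (bump y) := by
  unfold bump
  fun_prop

theorem bump_self (y : Torus) : bump y y = 0 := by
  simp [bump, character_zero_right]

theorem bump_pos {x y : Torus} (h : x ≠ y) : 0 < bump y x := by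
  refine lt_of_le_of_ne (Finset.sum_nonneg fun j _ => one_sub_re_nonneg _ _) fun h0 => h ?_
  funext j
  have hj := (Finset.sum_eq_zero_iff_of_nonneg fun j _ => one_sub_re_nonneg _ _).1 h0.symm j
    (Finset.mem_univ j)
  have h1 : character (Pi.single j 1) (x - y) = 1 := by
    have hre : (character (Pi.single j 1) (x - y)).re = 1 := by linarith
    have hn := Complex.sq_norm_sub_sq_re (character (Pi.single j 1) (x - y))
    rw [norm_character, hre] at hn
    refine Complex.ext hre ?_
    have : (character (Pi.single j 1) (x - y)).im ^ 2 = 0 := by linarith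
    simpa using this
  rw [character_apply, Finset.prod_eq_single j] at h1
  · rw [Pi.single_eq_same, fourier_one] at h1
    have h2 : AddCircle.toCircle ((x - y) j) = AddCircle.toCircle (0 : AddCircle (2 * π)) := by
      rw [AddCircle.toCircle_zero]; exact Subtype.ext h1
    have := AddCircle.injective_toCircle Real.two_pi_pos.ne' h2
    exact sub_eq_zero.1 this
  · intro k _ hk; rw [Pi.single_eq_of_ne hk, fourier_zero]
  · simp

theorem contDiff_bump (y : Torus) : ContDiff ℝ ∞ fun z => bump y (proj z) := by
  unfold bump
  refine ContDiff.sum fun j _ => contDiff_const.sub ?_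
  simp only [character_sub_right]
  exact Complex.reCLM.contDiff.comp (ContDiff.mul (isSmooth_character _) contDiff_const)

/-- A cutoff function vanishing near `y`. -/
def cutoff (y : Torus) (N : ℕ) (x : Torus) : ℝ := Real.smoothTransition (N * bump y x - 1)

theorem continuous_cutoff (y : Torus) (N : ℕ) : Continuous (cutoff y N) := by
  have := continuous_bump y
  unfold cutoff
  exact Real.smoothTransition.continuous.comp (by fun_prop)

theorem contDiff_cutoff (y : Torus) (N : ℕ) : ContDiff ℝ ∞ fun z => cutoff y N (proj z) := by
  unfold cutoff
  exact Real.smoothTransition.contDiff.comp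
    ((contDiff_const.mul (contDiff_bump y)).sub contDiff_const)

/-- The support lies in the closed set where `N * bump y` is at least 1, and the bump vanishes at y.
-/
theorem notMem_tsupport_cutoff (y : Torus) (N : ℕ) : y ∉ tsupport (cutoff y N) := by
  have hc : IsClosed {x | 0 ≤ N * bump y x - 1} := by
    have := continuous_bump y
    exact isClosed_le continuous_const (by fun_prop)
  have hs : Function.support (cutoff y N) ⊆ {x | 0 ≤ N * bump y x - 1} := by
    intro x hx
    by_contra h
    exact hx (Real.smoothTransition.zero_of_nonpos (not_le.1 h).le)
  intro h
  have := closure_minimal hs hc h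
  rw [Set.mem_ofPred_eq, bump_self] at this
  norm_num at this

theorem tendsto_cutoff {x y : Torus} (h : x ≠ y) :
    Tendsto (fun N => cutoff y N x) atTop (𝓝 1) := by
  refine tendsto_const_nhds.congr' ?_
  -- From this index on the argument of the transition function is at least 1, so the sequence is
  -- eventually constant.
  obtain ⟨N, hN⟩ := exists_nat_gt (2 / bump y x)
  filter_upwards [eventually_ge_atTop N] with M hM
  refine (Real.smoothTransition.one_of_one_le ?_).symm
  rw [div_lt_iff₀ (bump_pos h)] at hN
  have : (N : ℝ) * bump y x ≤ M * bump y x :=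
    mul_le_mul_of_nonneg_right (by exact_mod_cast hM) (bump_pos h).le
  linarith

/-- The character `ξ`, cut off near `x₁` and `x₂`. -/
def cutoffCharacter (x₁ x₂ : Torus) (ξ : Fin 2 → ℤ) (N : ℕ) : C(Torus, ℂ) where
  toFun x := ((cutoff x₁ N x * cutoff x₂ N x : ℝ) : ℂ) * character ξ x
  continuous_toFun := by
    have := continuous_cutoff x₁ N
    have := continuous_cutoff x₂ N
    fun_prop

theorem cutoffCharacter_mem (x₁ x₂ : Torus) (ξ : Fin 2 → ℤ) (N : ℕ) :
    cutoffCharacter x₁ x₂ ξ N ∈ testFunctions {x₁, x₂} := by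
  constructor
  · exact (Complex.ofRealCLM.contDiff.comp
      ((contDiff_cutoff x₁ N).mul (contDiff_cutoff x₂ N))).mul (isSmooth_character ξ)
  · have h1 : tsupport (cutoffCharacter x₁ x₂ ξ N) ⊆ tsupport (cutoff x₁ N) := by
      refine closure_mono fun x hx h0 => hx ?_
      change ((cutoff x₁ N x * cutoff x₂ N x : ℝ) : ℂ) * character ξ x = 0
      rw [h0]; simp
    have h2 : tsupport (cutoffCharacter x₁ x₂ ξ N) ⊆ tsupport (cutoff x₂ N) := by
      refine closure_mono fun x hx h0 => hx ?_
      change ((cutoff x₁ N x * cutoff x₂ N x : ℝ) : ℂ) * character ξ x = 0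
      rw [h0]; simp
    rw [Set.disjoint_right]
    rintro x (rfl | rfl) hx
    · exact notMem_tsupport_cutoff _ _ (h1 hx)
    · exact notMem_tsupport_cutoff _ _ (h2 hx)

theorem inner_toL2_left (F : C(Torus, ℂ)) (h : L2) :
    inner ℂ (toL2 F) h = ∫ x, h x * conj (F x) := by
  rw [L2.inner_def]
  refine integral_congr_ae ?_
  filter_upwards [ContinuousMap.coeFn_toLp (p := 2) (𝕜 := ℂ) (volume : Measure Torus) F] with x hx
  rw [RCLike.inner_apply, ← hx]
  rfl

theorem volume_singleton_torus (y : Torus) : (volume : Measure Torus) {y} = 0 := by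
  have h1 : (volume : Measure (AddCircle (2 * π))) {y 0} = 0 := by
    simpa using AddCircle.volume_closedBall (2 * π) (x := y 0) 0
  have h2 : ({y} : Set Torus) = Set.univ.pi fun j => {y j} := (Set.univ_pi_singleton y).symm
  rw [h2, volume_pi_pi, Fin.prod_univ_two, h1, zero_mul]

/-- Dominated convergence: the cutoffs are bounded by 1 and tend to 1 off the null set {x₁, x₂}. -/
theorem tendsto_inner_cutoffCharacter (x₁ x₂ : Torus) (ξ : Fin 2 → ℤ) (h : L2) :
    Tendsto (fun N => inner ℂ (toL2 (cutoffCharacter x₁ x₂ ξ N)) h) atTop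
      (𝓝 (inner ℂ (toL2 (character ξ)) h)) := by
  simp only [inner_toL2_left]
  have hi : Integrable (h : Torus → ℂ) volume :=
    (Lp.memLp h).integrable (by norm_num)
  refine tendsto_integral_of_dominated_convergence (fun x => ‖h x‖) (fun N => ?_) hi.norm
    (fun N => ?_) ?_
  · exact hi.1.mul (Complex.continuous_conj.comp
      (cutoffCharacter x₁ x₂ ξ N).continuous).aestronglyMeasurable
  · refine Eventually.of_forall fun x => ?_
    rw [norm_mul, RCLike.norm_conj]
    refine mul_le_of_le_one_right (norm_nonneg _) ?_
    change ‖((cutoff x₁ N x * cutoff x₂ N x : ℝ) : ℂ) * character ξ x‖ ≤ 1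
    rw [norm_mul, norm_character, mul_one, Complex.norm_real, norm_mul]
    refine mul_le_one₀ ?_ (norm_nonneg _) ?_ <;>
    · unfold cutoff
      rw [Real.norm_of_nonneg (Real.smoothTransition.nonneg _)]
      exact Real.smoothTransition.le_one _
  · have hn : ∀ y : Torus, ∀ᵐ x : Torus, x ≠ y := fun y => by
      rw [ae_iff]; simpa using volume_singleton_torus y
    filter_upwards [hn x₁, hn x₂] with x h1 h2
    have h3 := (tendsto_cutoff h1).mul (tendsto_cutoff h2)
    have h4 := (Complex.continuous_ofReal.tendsto _).comp h3
    have h5 := h4.mul_const (character ξ x)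
    have h6 := ((Complex.continuous_conj.tendsto _).comp h5).const_mul (h x)
    simpa [cutoffCharacter] using h6

/-- A vector orthogonal to the cut-off characters is, in the limit, orthogonal to all characters.
Density makes the value of the adjoint unique. -/
theorem dense_domain_negLaplaceMin (x₁ x₂ : Torus) :
    Dense ((negLaplaceMin {x₁, x₂}).domain : Set L2) := by
  rw [Submodule.dense_iff_topologicalClosure_eq_top, Submodule.topologicalClosure_eq_top_iff,
    Submodule.eq_bot_iff]
  intro h hh
  refine fourierCoefficient_injective fun ξ => ?_
  have h0 : ∀ N, inner ℂ (toL2 (cutoffCharacter x₁ x₂ ξ N)) h = 0 := fun N =>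
    (Submodule.mem_orthogonal _ _).1 hh _ ⟨⟨_, cutoffCharacter_mem x₁ x₂ ξ N⟩, rfl⟩
  have h1 := tendsto_inner_cutoffCharacter x₁ x₂ ξ h
  simp only [h0] at h1
  rw [fourierCoefficient_zero, fourierCoefficient, tendsto_nhds_unique h1 tendsto_const_nhds,
    mul_zero]

theorem dense_domain_negLaplaceMin_empty : Dense ((negLaplaceMin ∅).domain : Set L2) := by
  refine (dense_domain_negLaplaceMin 0 0).mono ?_
  rintro _ ⟨φ, rfl⟩
  exact ⟨⟨φ.1, φ.2.1, Set.disjoint_empty _⟩, rfl⟩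

/-! ### The adjoint of the Laplacian on test functions -/

/-- `g` is mapped to `h` by the adjoint of `-Δ` on test functions. -/
def IsWeakNegLapl (S : Set Torus) (g h : L2) : Prop :=
  ∀ φ : testFunctions S, inner ℂ h (toL2 φ.1) = inner ℂ g (negLaplTest S φ)

theorem IsWeakNegLapl.add {S : Set Torus} {g h g' h' : L2} (h₁ : IsWeakNegLapl S g h)
    (h₂ : IsWeakNegLapl S g' h') : IsWeakNegLapl S (g + g') (h + h') := fun φ => by
  rw [inner_add_left, inner_add_left, h₁, h₂]

theorem IsWeakNegLapl.smul {S : Set Torus} {g h : L2} (h₁ : IsWeakNegLapl S g h) (c : ℂ) :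
    IsWeakNegLapl S (c • g) (c • h) := fun φ => by
  rw [inner_smul_left, inner_smul_left, h₁]

theorem IsWeakNegLapl.sum {S : Set Torus} {ι : Type*} (s : Finset ι) {g h : ι → L2}
    (H : ∀ i, IsWeakNegLapl S (g i) (h i)) : IsWeakNegLapl S (∑ i ∈ s, g i) (∑ i ∈ s, h i) :=
  fun φ => by
    rw [sum_inner, sum_inner]
    exact Finset.sum_congr rfl fun i _ => H i φ

theorem negLaplaceMin_apply (S : Set Torus) (x : (negLaplaceMin S).domain) :
    ∃ φ : testFunctions S, (x : L2) = toL2 φ.1 ∧ negLaplaceMin S x = negLaplTest S φ := by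
  refine ⟨(testEquiv S).symm x, ?_, rfl⟩
  have := congrArg Subtype.val ((testEquiv S).apply_symm_apply x)
  exact this.symm

theorem IsWeakNegLapl.adjoint_eq {S : Set Torus}
    (hS : Dense ((negLaplaceMin S).domain : Set L2)) {g h : L2} (H : IsWeakNegLapl S g h) :
    ∃ hg : g ∈ (negLaplaceMin S).adjoint.domain, (negLaplaceMin S).adjoint ⟨g, hg⟩ = h := by
  have key : ∀ x : (negLaplaceMin S).domain,
      inner ℂ h (x : L2) = inner ℂ g (negLaplaceMin S x) := by
    intro x
    obtain ⟨φ, h1, h2⟩ := negLaplaceMin_apply S x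
    rw [h1, h2, H φ]
  exact ⟨LinearPMap.mem_adjoint_domain_of_exists _ ⟨h, key⟩,
    LinearPMap.adjoint_apply_eq hS _ key⟩

/-- By density, any h that passes the weak test is the value of the adjoint at g, so only h = μg and
membership in D remain. -/
theorem mem_eigenspace_domRestrict {S : Set Torus}
    (hS : Dense ((negLaplaceMin S).domain : Set L2)) (D : Submodule ℂ L2) {g h : L2}
    (H : IsWeakNegLapl S g h) (μ : ℝ) :
    g ∈ eigenspace ((negLaplaceMin S).adjoint.domRestrict D) μ ↔ g ∈ D ∧ h = (μ : ℂ) • g := by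
  obtain ⟨hg, e⟩ := H.adjoint_eq hS
  constructor
  · rintro ⟨h1, h2⟩
    refine ⟨h1.1, ?_⟩
    rw [← h2, ← e]
    exact (LinearPMap.domRestrict_apply (f := (negLaplaceMin S).adjoint) (x := ⟨g, h1⟩)
      (y := ⟨g, hg⟩) rfl).symm
  · rintro ⟨h1, h2⟩
    refine ⟨⟨h1, hg⟩, ?_⟩
    rw [← h2, ← e]
    exact LinearPMap.domRestrict_apply (f := (negLaplaceMin S).adjoint) (x := ⟨g, ⟨h1, hg⟩⟩)
      (y := ⟨g, hg⟩) rfl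

theorem fourierCoefficient_negLaplTest {S : Set Torus} (φ : testFunctions S) (ξ : Fin 2 → ℤ) :
    fourierCoefficient (negLaplTest S φ) ξ = normSq ξ * fourierCoefficient (toL2 φ.1) ξ := by
  change fourierCoefficient (-toL2 ⟨lapl φ.1, lapl_continuous φ.2.1⟩) ξ = _
  rw [fourierCoefficient_neg, fourierCoefficient_lapl φ.2.1]
  rw [neg_mul, neg_neg]
  rfl

/-- The coefficients of f + h are (1 + |ξ|²) times those of f, and they are square summable. -/
theorem mem_sobolevH2_of_normSq_mul {f h : L2}
    (H : ∀ ξ, fourierCoefficient h ξ = normSq ξ * fourierCoefficient f ξ) : f ∈ sobolevH2 := by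
  refine (summable_norm_sq (f + h)).congr fun ξ => ?_
  have : fourierCoefficient (f + h) ξ = ((1 + normSq ξ : ℝ) : ℂ) * fourierCoefficient f ξ := by
    rw [fourierCoefficient_add, H]; push_cast; ring
  rw [this, norm_mul, mul_pow, Complex.norm_real, Real.norm_eq_abs, sq_abs]

theorem exists_negLapl {f : L2} (hf : f ∈ sobolevH2) :
    ∃ h : L2, ∀ ξ, fourierCoefficient h ξ = normSq ξ * fourierCoefficient f ξ := by
  refine ⟨_, fourierCoefficient_tsum (a := fun ξ => normSq ξ * fourierCoefficient f ξ) ?_⟩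
  refine Summable.of_nonneg_of_le (fun ξ => by positivity) (fun ξ => ?_) hf
  rw [norm_mul, mul_pow, Complex.norm_real, Real.norm_eq_abs, sq_abs]
  have := normSq_nonneg ξ
  gcongr
  linarith

theorem inner_symm_of_normSq_mul {f h g k : L2}
    (H : ∀ ξ, fourierCoefficient h ξ = normSq ξ * fourierCoefficient f ξ)
    (K : ∀ ξ, fourierCoefficient k ξ = normSq ξ * fourierCoefficient g ξ) :
    inner ℂ h g = inner ℂ f k := by
  refine (hasSum_inner h g).unique (HasSum.congr_fun (hasSum_inner f k) fun ξ => ?_)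
  rw [H, K, map_mul, Complex.conj_ofReal]
  ring

theorem isWeakNegLapl_of_normSq_mul (S : Set Torus) {f h : L2}
    (H : ∀ ξ, fourierCoefficient h ξ = normSq ξ * fourierCoefficient f ξ) :
    IsWeakNegLapl S f h := fun φ =>
  inner_symm_of_normSq_mul H (fourierCoefficient_negLaplTest φ)

/-! ### Green's functions -/

/-- On this set the terms of the convergent lattice sum are bounded below by a positive constant. -/
theorem finite_normSq_le (R : ℝ) : {ξ : Fin 2 → ℤ | normSq ξ ≤ R}.Finite := by
  have h := summable_lattice.tendsto_cofinite_zero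
  have hR : 0 < ((1 + |R|) ^ 2)⁻¹ := by positivity
  refine Set.Finite.subset (eventually_cofinite.1 (h.eventually (gt_mem_nhds hR))) ?_
  intro ξ hξ
  have h0 := normSq_nonneg ξ
  have h1 : normSq ξ ≤ |R| := le_trans hξ (le_abs_self R)
  simp only [Set.mem_ofPred_eq, not_lt]
  gcongr

theorem eventually_le_norm_sub (z : ℂ) :
    ∀ᶠ ξ : Fin 2 → ℤ in cofinite, 1 + normSq ξ ≤ 2 * ‖(normSq ξ : ℂ) - z‖ := by
  filter_upwards [(finite_normSq_le (2 * ‖z‖ + 1)).compl_mem_cofinite] with ξ hξ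
  have h1 : 2 * ‖z‖ + 1 < normSq ξ := by simpa using hξ
  have h2 := norm_sub_norm_le (normSq ξ : ℂ) z
  rw [Complex.norm_real, Real.norm_of_nonneg (normSq_nonneg ξ)] at h2
  linarith

theorem summable_inv_sub_sq (z : ℂ) :
    Summable fun ξ : Fin 2 → ℤ => ‖((normSq ξ : ℂ) - z)⁻¹‖ ^ 2 := by
  refine Summable.of_norm_bounded_eventually (summable_lattice.mul_left 4) ?_
  filter_upwards [eventually_le_norm_sub z] with ξ hξ
  have h0 := normSq_nonneg ξ
  rw [norm_pow, norm_norm, norm_inv, inv_pow, ← div_eq_mul_inv, ← one_div,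
    div_le_div_iff₀ (by have : 0 < ‖(normSq ξ : ℂ) - z‖ := by linarith
                        positivity) (by positivity)]
  nlinarith [norm_nonneg ((normSq ξ : ℂ) - z)]

theorem fourierCoefficient_green (z : ℂ) (y : Torus) (ξ : Fin 2 → ℤ) :
    fourierCoefficient (green z y) ξ
      = -(1 / (4 * (π : ℂ) ^ 2)) * (conj (character ξ y) * ((normSq ξ : ℂ) - z)⁻¹) := by
  rw [green, fourierCoefficient_tsum]
  · rfl
  · refine ((summable_inv_sub_sq z).mul_left (‖-(1 / (4 * (π : ℂ) ^ 2))‖ ^ 2)).congr fun ξ => ?_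
    rw [norm_mul, mul_pow, div_eq_mul_inv (star _), norm_mul (star _)]
    rw [show ‖star (character ξ y)‖ = 1 from (RCLike.norm_conj _).trans (norm_character ξ y),
      one_mul]

/-- The weak form of `(Δ + z) G_z(·, y) = δ_y`. -/
theorem inner_green_sub {z : ℂ} (hz : ∀ ξ, (normSq ξ : ℂ) ≠ z) (y : Torus) {f h : L2} {a : ℂ}
    (H : ∀ ξ, fourierCoefficient h ξ = normSq ξ * fourierCoefficient f ξ)
    (ha : HasSum (fun ξ => fourierCoefficient f ξ * character ξ y) a) :
    inner ℂ (z • green z y) f - inner ℂ (green z y) h = a := by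
  refine ((hasSum_inner _ f).sub (hasSum_inner _ h)).unique (HasSum.congr_fun ha fun ξ => ?_)
  have hn : conj ((normSq ξ : ℂ) - z) ≠ 0 := by
    rw [Ne, map_eq_zero, sub_eq_zero]; exact hz ξ
  have := pi_ne
  rw [fourierCoefficient_smul, H, fourierCoefficient_green]
  simp only [map_mul, map_neg, map_div₀, map_one, map_pow, Complex.conj_ofReal, map_ofNat,
    Complex.conj_conj, map_inv₀]
  field_simp
  simp only [map_sub, Complex.conj_ofReal]
  ring

/-- The delta contributes the value of the test function at y, which is zero because its support
avoids S. -/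
theorem isWeakNegLapl_green {z : ℂ} (hz : ∀ ξ, (normSq ξ : ℂ) ≠ z) {S : Set Torus} {y : Torus}
    (hy : y ∈ S) : IsWeakNegLapl S (green z y) (z • green z y) := fun φ => by
  have h1 := mem_sobolevH2_of_normSq_mul (fourierCoefficient_negLaplTest φ)
  have h2 := hasSum_apply_of_summable (summable_norm_of_mem_sobolevH2 h1) y
  have h3 : (φ.1 : C(Torus, ℂ)) y = 0 := by
    by_contra h
    exact Set.disjoint_left.1 φ.2.2 (subset_tsupport _ h) hy
  rw [h3] at h2
  exact sub_eq_zero.1 (inner_green_sub hz y (fourierCoefficient_negLaplTest φ) h2)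

/-! ### The spectrum of the standard Laplacian -/

theorem mem_eigenspace_negLaplace {g : L2} {μ : ℝ} :
    g ∈ eigenspace negLaplace μ ↔ ∀ ξ, normSq ξ ≠ μ → fourierCoefficient g ξ = 0 := by
  constructor
  · intro hg ξ hξ
    obtain ⟨h, hh⟩ := exists_negLapl hg.1.1
    have H := isWeakNegLapl_of_normSq_mul ∅ hh
    obtain ⟨-, rfl⟩ := (mem_eigenspace_domRestrict dense_domain_negLaplaceMin_empty _ H μ).1 hg
    have h1 := hh ξ
    rw [fourierCoefficient_smul, ← sub_eq_zero, ← sub_mul, mul_eq_zero, sub_eq_zero] at h1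
    exact h1.resolve_left fun h => hξ (by exact_mod_cast h.symm)
  · intro hg
    have hh : ∀ ξ, fourierCoefficient ((μ : ℂ) • g) ξ = normSq ξ * fourierCoefficient g ξ := by
      intro ξ
      rw [fourierCoefficient_smul]
      by_cases h : normSq ξ = μ
      · rw [h]
      · rw [hg ξ h, mul_zero, mul_zero]
    exact (mem_eigenspace_domRestrict dense_domain_negLaplaceMin_empty _
      (isWeakNegLapl_of_normSq_mul ∅ hh) μ).2 ⟨mem_sobolevH2_of_normSq_mul hh, rfl⟩

theorem toL2_character_mem_eigenspace (ξ : Fin 2 → ℤ) :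
    toL2 (character ξ) ∈ eigenspace negLaplace (normSq ξ) := by
  rw [mem_eigenspace_negLaplace]
  intro η hη
  rw [fourierCoefficient_character, if_neg]
  rintro rfl
  exact hη rfl

theorem mem_eigenvalues_negLaplace {μ : ℝ} :
    μ ∈ eigenvalues negLaplace ↔ ∃ ξ, normSq ξ = μ := by
  constructor
  · intro h
    by_contra! hne
    refine h ((Submodule.eq_bot_iff _).2 fun g hg => fourierCoefficient_injective fun ξ => ?_)
    rw [mem_eigenspace_negLaplace.1 hg ξ (hne ξ), fourierCoefficient_zero]
  · rintro ⟨ξ, rfl⟩ h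
    have h1 := (Submodule.eq_bot_iff _).1 h _ (toL2_character_mem_eigenspace ξ)
    have h2 := fourierCoefficient_character ξ ξ
    rw [h1, fourierCoefficient_zero, if_pos rfl] at h2
    exact zero_ne_one h2

/-- The lattice points on a circle. -/
def shell (μ : ℝ) : Finset (Fin 2 → ℤ) :=
  (Set.Finite.subset (finite_normSq_le μ)
    (show {ξ | normSq ξ = μ} ⊆ {ξ | normSq ξ ≤ μ} from fun _ h => le_of_eq h)).toFinset

theorem mem_shell {μ : ℝ} {ξ : Fin 2 → ℤ} : ξ ∈ shell μ ↔ normSq ξ = μ := by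
  rw [shell, Set.Finite.mem_toFinset]; rfl

/-- The Fourier coefficient as a linear functional. -/
def fourierFunctional (ξ : Fin 2 → ℤ) : L2 →ₗ[ℂ] ℂ where
  toFun f := fourierCoefficient f ξ
  map_add' f g := fourierCoefficient_add f g ξ
  map_smul' c f := fourierCoefficient_smul c f ξ

theorem finiteDimensional_eigenspace_negLaplace (μ : ℝ) :
    FiniteDimensional ℂ (eigenspace negLaplace μ) := by
  let L : eigenspace negLaplace μ →ₗ[ℂ] (shell μ → ℂ) :=
    LinearMap.pi fun ξ => fourierFunctional ξ ∘ₗ (eigenspace negLaplace μ).subtype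
  refine Module.Finite.of_injective L fun f g h => Subtype.ext (fourierCoefficient_injective ?_)
  intro ξ
  by_cases hξ : normSq ξ = μ
  · exact congrFun h ⟨ξ, mem_shell.2 hξ⟩
  · rw [mem_eigenspace_negLaplace.1 f.2 ξ hξ, mem_eigenspace_negLaplace.1 g.2 ξ hξ]

theorem hasSum_shell {g : L2} {μ : ℝ} (hg : g ∈ eigenspace negLaplace μ) (x : Torus) :
    HasSum (fun ξ => fourierCoefficient g ξ * character ξ x)
      (∑ ξ ∈ shell μ, fourierCoefficient g ξ * character ξ x) := by
  refine hasSum_sum_of_ne_finset_zero fun ξ hξ => ?_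
  rw [mem_eigenspace_negLaplace.1 hg ξ (fun h => hξ (mem_shell.2 h)), zero_mul]

/-! ### Independence of the point evaluations -/

/-- On every circle other than `{0}`, the characters restricted to `{x₁, x₂}` span a plane. -/
def Separates (x₁ x₂ : Torus) : Prop :=
  ∀ ξ : Fin 2 → ℤ, normSq ξ ≠ 0 → ∃ η ζ, normSq η = normSq ξ ∧ normSq ζ = normSq ξ ∧
    character η x₁ * character ζ x₂ ≠ character ζ x₁ * character η x₂

theorem fourier_two_mul_eq_one {m : ℤ} {a : ℝ}
    (h : fourier (2 * m) ((a : ℝ) : AddCircle (2 * π)) = (1 : ℂ)) : ∃ p : ℤ, m * (a / π) = p := by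
  rw [fourier_coe_apply, Complex.exp_eq_one_iff] at h
  obtain ⟨p, hp⟩ := h
  refine ⟨p, ?_⟩
  have := pi_ne
  have h1 := Complex.I_ne_zero
  apply Complex.ofReal_injective
  push_cast at hp ⊢
  field_simp at hp ⊢
  linear_combination hp

/-- A rational vector of denominator m is at distance zero from its own approximation, below the
positive bound C/m^κ. -/
theorem not_isDiophantine {a : Fin 2 → ℝ} {m : ℤ} (hm : m ≠ 0) {p : Fin 2 → ℤ}
    (h : ∀ j, m * a j = p j) : ¬ IsDiophantine a := by
  wlog hpos : 0 < m generalizing m p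
  · exact this (m := -m) (p := fun j => -p j) (by simpa) (fun j => by push_cast; rw [← h j]; ring)
      (by omega)
  rintro ⟨κ, C, hC, H⟩
  have h1 := H (p 0) (p 1) m hpos
  have hm' : (m : ℝ) ≠ 0 := by exact_mod_cast hm
  have h2 : ∀ j, a j - p j / m = 0 := fun j => by rw [← h j]; field_simp; ring
  rw [h2, h2] at h1
  have h3 : 0 < C / (m : ℝ) ^ κ := div_pos hC (Real.rpow_pos_of_pos (by exact_mod_cast hpos) κ)
  simp at h1
  linarith

/-- If all these determinants vanish on a circle, every character of that circle takes the same
value at x₂ - x₁. The symmetries of the circle then make α/π rational in both coordinates with a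
common denominator. -/
theorem separates_of_isDiophantine {x₁ x₂ : Torus} {α : Fin 2 → ℝ}
    (hα : ∀ j, ((α j : ℝ) : AddCircle (2 * π)) = x₂ j - x₁ j)
    (hdio : IsDiophantine fun j => α j / π) : Separates x₁ x₂ := by
  intro ξ hξ
  by_contra! hall
  have hδ : x₂ - x₁ = fun j => ((α j : ℝ) : AddCircle (2 * π)) := funext fun j => (hα j).symm
  have key : ∀ η ζ, normSq η = normSq ξ → normSq ζ = normSq ξ →
      character η (x₂ - x₁) = character ζ (x₂ - x₁) := by
    intro η ζ h1 h2
    rw [character_sub_right, character_sub_right]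
    linear_combination (conj (character η x₁) * conj (character ζ x₁)) * hall ζ η h2 h1
      + (conj (character ζ x₁) * character ζ x₂) * conj_mul_character η x₁
      - (conj (character η x₁) * character η x₂) * conj_mul_character ζ x₁
  -- Comparing (a,b) with (-a,b) gives exp(2iaα₁) = 1, and comparing (b,a) with (b,-a) gives
  -- exp(2iaα₂) = 1, so a is the common denominator.
  have step : ∀ a b : ℤ, (a : ℝ) ^ 2 + (b : ℝ) ^ 2 = normSq ξ → a ≠ 0 → False := by
    intro a b hab ha
    have e1 := key ![a, b] ![-a, b] (by simp [normSq, hab]) (by simp [normSq, hab])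
    have e2 := key ![b, a] ![b, -a] (by rw [← hab]; simp [normSq, add_comm])
      (by rw [← hab]; simp [normSq, add_comm])
    have hc : ∀ (m : ℤ) (t : AddCircle (2 * π)), (fourier m t : ℂ) * fourier (-m) t = 1 := by
      intro m t
      rw [← fourier_add, add_neg_cancel, fourier_zero]
    have cancel : ∀ t : AddCircle (2 * π), (fourier a t : ℂ) = fourier (-a) t →
        (fourier (2 * a) t : ℂ) = 1 := by
      intro t ht
      have h2 := fourier_add (m := a) (n := a) (x := t)
      rw [← two_mul a] at h2
      rw [h2, ← hc a t, ← ht]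
    simp only [character_apply, Fin.prod_univ_two, Matrix.cons_val_zero, Matrix.cons_val_one]
      at e1 e2
    have hb : ∀ t : AddCircle (2 * π), (fourier b t : ℂ) ≠ 0 := fun t =>
      left_ne_zero_of_mul_eq_one (hc b t)
    have f0 := cancel _ (mul_right_cancel₀ (hb _) e1)
    have f1 := cancel _ (mul_left_cancel₀ (hb _) e2)
    rw [hδ] at f0 f1
    obtain ⟨p, hp⟩ := fourier_two_mul_eq_one f0
    obtain ⟨q, hq⟩ := fourier_two_mul_eq_one f1
    exact not_isDiophantine ha (p := ![p, q]) (by rw [Fin.forall_fin_two]; exact ⟨hp, hq⟩) hdio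
  have hs : (ξ 0 : ℝ) ^ 2 + (ξ 1 : ℝ) ^ 2 = normSq ξ := by simp [normSq]
  by_cases h0 : ξ 0 = 0
  · by_cases h1 : ξ 1 = 0
    · rw [← hs, h0, h1] at hξ; simp at hξ
    · exact step _ _ ((add_comm _ _).trans hs) h1
  · exact step _ _ hs h0

/-- The two scatterers, as a family. -/
def points (x₁ x₂ : Torus) : Fin 2 → Torus := ![x₁, x₂]

theorem greenPair_apply (x₁ x₂ : Torus) (z : ℂ) (k : Fin 2) :
    greenPair x₁ x₂ z k = green z (points x₁ x₂ k) := by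
  fin_cases k <;> rfl

theorem Separates.eq_zero {x₁ x₂ : Torus} (hs : Separates x₁ x₂) {μ : ℝ} (hμ : μ ≠ 0)
    (hN : ∃ ξ, normSq ξ = μ) {b : Fin 2 → ℂ}
    (hb : ∀ ξ, normSq ξ = μ → ∑ k, b k * conj (character ξ (points x₁ x₂ k)) = 0) : b = 0 := by
  obtain ⟨ξ, rfl⟩ := hN
  obtain ⟨η, ζ, h1, h2, h3⟩ := hs ξ hμ
  have e1 := hb η h1
  have e2 := hb ζ h2
  simp only [points, Fin.sum_univ_two, Matrix.cons_val_zero, Matrix.cons_val_one] at e1 e2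
  have h4 : conj (character η x₁) * conj (character ζ x₂)
      - conj (character ζ x₁) * conj (character η x₂) ≠ 0 := by
    rw [← map_mul, ← map_mul, ← map_sub, Ne, map_eq_zero]
    exact sub_ne_zero.2 h3
  have b0 : b 0 = 0 := (mul_eq_zero.1 (show _ * b 0 = 0 by
    linear_combination conj (character ζ x₂) * e1 - conj (character η x₂) * e2)).resolve_left h4
  have b1 : b 1 = 0 := (mul_eq_zero.1 (show _ * b 1 = 0 by
    linear_combination conj (character η x₁) * e2 - conj (character ζ x₁) * e1)).resolve_left h4
  funext k
  fin_cases k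
  · exact b0
  · exact b1

/-- Cramer's rule in the span of the two characters supplied by `Separates`: evaluation at the pair
of points is onto. -/
theorem Separates.exists_eigenfunction {x₁ x₂ : Torus} (hs : Separates x₁ x₂) {μ : ℝ} (hμ : μ ≠ 0)
    (hN : ∃ ξ, normSq ξ = μ) (y : Fin 2 → ℂ) : ∃ g ∈ eigenspace negLaplace μ,
      ∀ k, ∑ ξ ∈ shell μ, fourierCoefficient g ξ * character ξ (points x₁ x₂ k) = y k := by
  obtain ⟨ξ, rfl⟩ := hN
  obtain ⟨η, ζ, h1, h2, h3⟩ := hs ξ hμ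
  have h4 : character η x₁ * character ζ x₂ - character ζ x₁ * character η x₂ ≠ 0 :=
    sub_ne_zero.2 h3
  set d := character η x₁ * character ζ x₂ - character ζ x₁ * character η x₂
  have m1 := toL2_character_mem_eigenspace η
  have m2 := toL2_character_mem_eigenspace ζ
  rw [h1] at m1
  rw [h2] at m2
  refine ⟨((y 0 * character ζ x₂ - y 1 * character ζ x₁) / d) • toL2 (character η)
    + ((y 1 * character η x₁ - y 0 * character η x₂) / d) • toL2 (character ζ),
    Submodule.add_mem _ (Submodule.smul_mem _ _ m1) (Submodule.smul_mem _ _ m2), fun k => ?_⟩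
  simp only [fourierCoefficient_add, fourierCoefficient_smul, fourierCoefficient_character,
    mul_ite, mul_one, mul_zero, add_mul, ite_mul, zero_mul, Finset.sum_add_distrib,
    Finset.sum_ite_eq', mem_shell, if_pos h1, if_pos h2]
  fin_cases k <;>
  · simp only [points, Fin.zero_eta, Fin.mk_one, Matrix.cons_val_zero, Matrix.cons_val_one]
    field_simp
    simp only [d]
    ring

/-! ### Kernels -/

/-- The function with Fourier coefficients `c / 4π²`. -/
def kernel (c : (Fin 2 → ℤ) → ℂ) (y : Torus) : ℂ :=
  1 / (4 * (π : ℂ) ^ 2) * ∑' ξ, c ξ * character ξ y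

/-- The matrix of values of a kernel at the differences of the two points. -/
def kernelMatrix (x₁ x₂ : Torus) (c : (Fin 2 → ℤ) → ℂ) : Matrix (Fin 2) (Fin 2) ℂ :=
  Matrix.of fun l k => kernel c (points x₁ x₂ l - points x₁ x₂ k)

theorem hasSum_kernel {c : (Fin 2 → ℤ) → ℂ} (hc : Summable fun ξ => ‖c ξ‖) (y : Torus) :
    HasSum (fun ξ => 1 / (4 * (π : ℂ) ^ 2) * (c ξ * character ξ y)) (kernel c y) := by
  refine HasSum.mul_left _ (Summable.hasSum ?_)
  refine Summable.of_norm ?_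
  simpa only [norm_mul, norm_character, mul_one] using hc

theorem normSq_neg (ξ : Fin 2 → ℤ) : normSq (-ξ) = normSq ξ := by simp [normSq]

theorem kernel_neg {c : (Fin 2 → ℤ) → ℂ} (hc : ∀ ξ, c (-ξ) = c ξ) (y : Torus) :
    kernel c (-y) = kernel c y := by
  unfold kernel
  rw [← (Equiv.neg (Fin 2 → ℤ)).tsum_eq]
  simp only [Equiv.neg_apply, hc, character_neg_left, character_neg_right, Complex.conj_conj]

theorem conj_kernel {c : (Fin 2 → ℤ) → ℂ} (hc : ∀ ξ, conj (c ξ) = c ξ) (y : Torus) :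
    conj (kernel c y) = kernel c (-y) := by
  unfold kernel
  rw [map_mul, Complex.conj_tsum]
  simp only [map_mul, hc, character_neg_right, map_div₀, map_one, map_pow, Complex.conj_ofReal,
    map_ofNat]

/-- Symmetry without conjugation lets row vectors be traded for column vectors. -/
theorem kernelMatrix_isSymm (x₁ x₂ : Torus) {c : (Fin 2 → ℤ) → ℂ} (hc : ∀ ξ, c (-ξ) = c ξ) :
    (kernelMatrix x₁ x₂ c)ᵀ = kernelMatrix x₁ x₂ c := by
  ext l k
  simp only [kernelMatrix, Matrix.transpose_apply, Matrix.of_apply]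
  rw [← kernel_neg hc, neg_sub]

theorem kernelMatrix_isHermitian (x₁ x₂ : Torus) {c : (Fin 2 → ℤ) → ℂ}
    (hc : ∀ ξ, conj (c ξ) = c ξ) : (kernelMatrix x₁ x₂ c).IsHermitian := by
  ext l k
  simp only [kernelMatrix, Matrix.conjTranspose_apply, Matrix.of_apply]
  rw [RCLike.star_def, conj_kernel hc, neg_sub]

/-! ### The Gram matrix of the Green's functions -/

/-- The weight `1 / (|ξ|⁴ + 1)`. -/
def gramWeight (ξ : Fin 2 → ℤ) : ℂ := (((normSq ξ ^ 2 + 1)⁻¹ : ℝ) : ℂ)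

theorem normSq_ne {z : ℂ} (hz : z.im ≠ 0) (ξ : Fin 2 → ℤ) : (normSq ξ : ℂ) ≠ z := by
  rintro rfl
  simp at hz

theorem gramWeight_eq {z : ℂ} (hz : z = Complex.I ∨ z = -Complex.I) (ξ : Fin 2 → ℤ) :
    conj (((normSq ξ : ℂ) - z)⁻¹) * ((normSq ξ : ℂ) - z)⁻¹ = gramWeight ξ := by
  rw [map_inv₀, ← mul_inv, gramWeight, Complex.ofReal_inv]
  congr 1
  rcases hz with rfl | rfl <;>
  · simp only [map_sub, map_neg, Complex.conj_ofReal, Complex.conj_I]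
    push_cast
    linear_combination -Complex.I_sq

theorem gramWeight_eq_sub (ξ : Fin 2 → ℤ) :
    ((normSq ξ : ℂ) - Complex.I)⁻¹ - ((normSq ξ : ℂ) - -Complex.I)⁻¹
      = 2 * Complex.I * gramWeight ξ := by
  have h1 : (normSq ξ : ℂ) - Complex.I ≠ 0 := sub_ne_zero.2 (normSq_ne (by simp) ξ)
  have h2 : (normSq ξ : ℂ) + Complex.I ≠ 0 := by
    have := sub_ne_zero.2 (normSq_ne (z := -Complex.I) (by simp) ξ)
    rwa [sub_neg_eq_add] at this
  rw [← gramWeight_eq (Or.inl rfl), map_inv₀, map_sub, Complex.conj_ofReal, Complex.conj_I,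
    sub_neg_eq_add]
  field_simp
  ring

theorem summable_gramWeight : Summable fun ξ => ‖gramWeight ξ‖ := by
  refine (summable_inv_sub_sq Complex.I).congr fun ξ => ?_
  rw [← gramWeight_eq (Or.inl rfl), norm_mul, RCLike.norm_conj, sq]

/-- By Parseval the Gram matrix is the same for z = i and z = -i, so a single T orthonormalizes both
pairs. -/
theorem inner_green {z : ℂ} (hz : z = Complex.I ∨ z = -Complex.I) (y y' : Torus) :
    inner ℂ (green z y) (green z y') = kernel gramWeight (y - y') := by
  refine (hasSum_inner _ _).unique (HasSum.congr_fun (hasSum_kernel summable_gramWeight _)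
    fun ξ => ?_)
  have := pi_ne
  rw [fourierCoefficient_green, fourierCoefficient_green, ← gramWeight_eq hz, character_sub_right]
  simp only [map_mul, map_neg, map_div₀, map_one, map_pow, Complex.conj_ofReal, map_ofNat,
    Complex.conj_conj]
  field_simp

/-- The Gram matrix of `(G_i(·, x₁), G_i(·, x₂))`. -/
def gramB (x₁ x₂ : Torus) : Matrix (Fin 2) (Fin 2) ℂ := kernelMatrix x₁ x₂ gramWeight

theorem gramWeight_neg (ξ : Fin 2 → ℤ) : gramWeight (-ξ) = gramWeight ξ := by
  rw [gramWeight, normSq_neg, gramWeight]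

theorem conj_gramWeight (ξ : Fin 2 → ℤ) : conj (gramWeight ξ) = gramWeight ξ :=
  Complex.conj_ofReal _

theorem kernel_gramWeight_zero (x₁ : Torus) : kernel gramWeight 0 = c₁ x₁ := by
  rw [← sub_self x₁, ← inner_green (Or.inl rfl), inner_self_eq_norm_sq_to_K, c₁]
  simp

theorem kernel_gramWeight_sub (x₁ x₂ : Torus) : kernel gramWeight (x₂ - x₁) = c₂ x₁ x₂ := by
  rw [c₂, inner_green (Or.inl rfl)]
  refine (Complex.conj_eq_iff_re.1 ?_).symm
  rw [conj_kernel conj_gramWeight, kernel_neg gramWeight_neg]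

theorem gramB_eq (x₁ x₂ : Torus) :
    gramB x₁ x₂ = !![(c₁ x₁ : ℂ), (c₂ x₁ x₂ : ℂ); (c₂ x₁ x₂ : ℂ), (c₁ x₁ : ℂ)] := by
  ext l k
  fin_cases l <;> fin_cases k
  · simp [gramB, kernelMatrix, kernel_gramWeight_zero x₁]
  · simp only [gramB, kernelMatrix, points, Matrix.of_apply, Fin.zero_eta, Fin.mk_one,
      Matrix.cons_val_zero, Matrix.cons_val_one]
    rw [← kernel_gramWeight_sub, ← kernel_neg gramWeight_neg, neg_sub]
  · simp [gramB, kernelMatrix, points, kernel_gramWeight_sub]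
  · simp [gramB, kernelMatrix, kernel_gramWeight_zero x₁]

/-- Strict Cauchy–Schwarz: 2(c₁ ± c₂) is the squared norm of the sum, respectively the difference,
of the two Green's functions. -/
theorem Separates.c₂_sq_lt {x₁ x₂ : Torus} (hs : Separates x₁ x₂) :
    0 < c₁ x₁ ∧ 0 < c₁ x₁ ^ 2 - c₂ x₁ x₂ ^ 2 := by
  have e1 : ‖green Complex.I x₁‖ ^ 2 = c₁ x₁ := rfl
  have e2 : ‖green Complex.I x₂‖ ^ 2 = c₁ x₁ := by
    have h1 := kernel_gramWeight_zero x₁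
    rw [kernel_gramWeight_zero x₂] at h1
    exact_mod_cast h1
  have e3 : RCLike.re (inner ℂ (green Complex.I x₂) (green Complex.I x₁)) = c₂ x₁ x₂ := rfl
  have hI : ∀ ξ, (((normSq ξ : ℂ) - Complex.I)⁻¹) ≠ 0 := fun ξ =>
    inv_ne_zero (sub_ne_zero.2 (normSq_ne (by simp) ξ))
  have hpi : (1 / (4 * (π : ℂ) ^ 2)) ≠ 0 := by simp
  have p1 : 0 < c₁ x₁ + c₂ x₁ x₂ := by
    -- The mode ξ = 0 does not see the points, so the two constant terms add instead of cancelling.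
    have h : green Complex.I x₂ + green Complex.I x₁ ≠ 0 := by
      intro h
      have h1 := congrArg (fun f => fourierCoefficient f 0) h
      simp only [fourierCoefficient_add, fourierCoefficient_green, fourierCoefficient_zero,
        character_zero_left, ContinuousMap.one_apply, map_one, one_mul] at h1
      have h2 : -(1 / (4 * (π : ℂ) ^ 2)) * (((normSq 0 : ℂ) - Complex.I)⁻¹) = 0 := by
        linear_combination h1 / 2
      exact (mul_ne_zero (neg_ne_zero.2 hpi) (hI 0)) h2
    have h1 : 0 < ‖green Complex.I x₂ + green Complex.I x₁‖ ^ 2 := by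
      have := norm_pos_iff.2 h
      positivity
    rw [norm_add_sq (𝕜 := ℂ), e1, e2, e3] at h1
    linarith
  have p2 : 0 < c₁ x₁ - c₂ x₁ x₂ := by
    have h : green Complex.I x₂ - green Complex.I x₁ ≠ 0 := by
      intro h
      -- Equal Green's functions would make all characters agree at x₁ and x₂, against separation on
      -- the unit circle.
      obtain ⟨η, ζ, -, -, hne⟩ := hs (Pi.single 0 1) (by simp [normSq])
      have key : ∀ ξ, character ξ x₁ = character ξ x₂ := by
        intro ξ
        have h1 := congrArg (fun f => fourierCoefficient f ξ) h
        simp only [fourierCoefficient_sub, fourierCoefficient_green,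
          fourierCoefficient_zero] at h1
        rw [← mul_sub, ← sub_mul] at h1
        have h2 := (mul_eq_zero.1 ((mul_eq_zero.1 h1).resolve_left
          (neg_ne_zero.2 hpi))).resolve_right (hI ξ)
        exact ((RingHom.injective _) (sub_eq_zero.1 h2)).symm
      exact hne (by rw [key, key]; ring)
    have h1 : 0 < ‖green Complex.I x₂ - green Complex.I x₁‖ ^ 2 := by
      have := norm_pos_iff.2 h
      positivity
    rw [norm_sub_sq (𝕜 := ℂ), e1, e2, e3] at h1
    linarith
  exact ⟨by linarith, by nlinarith⟩

theorem star_gramT (x₁ x₂ : Torus) : (gramT x₁ x₂)ᴴ = (gramT x₁ x₂)ᵀ := by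
  ext i j
  fin_cases i <;> fin_cases j <;>
  simp only [gramT, Matrix.conjTranspose_apply, Matrix.transpose_apply, Fin.zero_eta, Fin.mk_one,
    Matrix.of_apply, Matrix.cons_val_zero, Matrix.cons_val_one, RCLike.star_def,
    Complex.conj_ofReal, map_zero, Matrix.cons_val', Matrix.cons_val_fin_one]

/-- Gram–Schmidt: T orthonormalizes the Green's functions. As T is real, its transpose is its
adjoint. -/
theorem Separates.gramT_mul {x₁ x₂ : Torus} (hs : Separates x₁ x₂) :
    gramT x₁ x₂ * gramB x₁ x₂ * (gramT x₁ x₂)ᵀ = 1 := by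
  obtain ⟨h1, h2⟩ := hs.c₂_sq_lt
  rw [gramB_eq, gramT, Real.sqrt_mul h1.le, Real.sqrt_div h1.le]
  set c := c₁ x₁
  set d := c₂ x₁ x₂
  have hs0 : 0 < √c := Real.sqrt_pos.2 h1
  have hr0 : 0 < √(c ^ 2 - d ^ 2) := Real.sqrt_pos.2 h2
  have es : ((√c : ℝ) : ℂ) ^ 2 = c := by exact_mod_cast Real.sq_sqrt h1.le
  have er : ((√(c ^ 2 - d ^ 2) : ℝ) : ℂ) ^ 2 = c ^ 2 - d ^ 2 := by
    exact_mod_cast Real.sq_sqrt h2.le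
  have hs1 : ((√c : ℝ) : ℂ) ≠ 0 := by exact_mod_cast hs0.ne'
  have hr1 : ((√(c ^ 2 - d ^ 2) : ℝ) : ℂ) ≠ 0 := by exact_mod_cast hr0.ne'
  push_cast
  -- With s = √c₁ and r = √(c₁² - c₂²) the entries are rational in s, r and c₂, subject to r² = s⁴ -
  -- c₂².
  generalize ((√c : ℝ) : ℂ) = s at *
  generalize ((√(c ^ 2 - d ^ 2) : ℝ) : ℂ) = r at *
  rw [← es] at er
  rw [← es]
  ext i j
  fin_cases i <;> fin_cases j <;>
  simp only [Matrix.mul_apply, Fin.sum_univ_two, Matrix.transpose_apply, Fin.zero_eta, Fin.mk_one,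
    Matrix.of_apply, Matrix.cons_val_zero, Matrix.cons_val_one, Matrix.cons_val',
    Matrix.cons_val_fin_one, Matrix.one_apply_eq, ne_eq, zero_ne_one, one_ne_zero,
    not_false_eq_true, Matrix.one_apply_ne] <;>
  field_simp
  · ring
  · ring
  · ring
  · linear_combination -er

/-! ### The domain of the extension -/

/-- The combination `∑ₖ aₖ G_z(·, xₖ)`. -/
def greenSum (x₁ x₂ : Torus) (z : ℂ) (a : Fin 2 → ℂ) : L2 :=
  ∑ k, a k • green z (points x₁ x₂ k)

theorem fourierCoefficient_greenSum (x₁ x₂ : Torus) (z : ℂ) (a : Fin 2 → ℂ) (ξ : Fin 2 → ℤ) :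
    fourierCoefficient (greenSum x₁ x₂ z a) ξ = -(1 / (4 * (π : ℂ) ^ 2)) *
      ((∑ k, a k * conj (character ξ (points x₁ x₂ k))) * ((normSq ξ : ℂ) - z)⁻¹) := by
  rw [greenSum, fourierCoefficient_sum, Finset.sum_mul, Finset.mul_sum]
  refine Finset.sum_congr rfl fun k _ => ?_
  rw [fourierCoefficient_smul, fourierCoefficient_green]
  ring

/-- Applying |ξ|² - z leaves the coefficients of -∑ a_k δ_{x_k}, which do not depend on z. Hence a
change of z alters the sum by a function in H². -/
theorem normSq_mul_greenSum (x₁ x₂ : Torus) {z : ℂ} (hz : ∀ ξ, (normSq ξ : ℂ) ≠ z)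
    (a : Fin 2 → ℂ) (ξ : Fin 2 → ℤ) :
    normSq ξ * fourierCoefficient (greenSum x₁ x₂ z a) ξ
      = z * fourierCoefficient (greenSum x₁ x₂ z a) ξ
        - 1 / (4 * (π : ℂ) ^ 2) * ∑ k, a k * conj (character ξ (points x₁ x₂ k)) := by
  have := sub_ne_zero.2 (hz ξ)
  have := pi_ne
  rw [fourierCoefficient_greenSum]
  field_simp
  ring

theorem isWeakNegLapl_greenSum (x₁ x₂ : Torus) {z : ℂ} (hz : ∀ ξ, (normSq ξ : ℂ) ≠ z)
    (a : Fin 2 → ℂ) :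
    IsWeakNegLapl {x₁, x₂} (greenSum x₁ x₂ z a) (z • greenSum x₁ x₂ z a) := by
  rw [greenSum, Finset.smul_sum]
  refine IsWeakNegLapl.sum _ fun k => ?_
  rw [smul_comm]
  refine (isWeakNegLapl_green hz ?_).smul _
  fin_cases k <;> simp [points]

theorem pairing_greenPair (x₁ x₂ : Torus) (z : ℂ) (v : Fin 2 → ℂ) (M : Matrix (Fin 2) (Fin 2) ℂ) :
    pairing v M (greenPair x₁ x₂ z) = greenSum x₁ x₂ z (star v ᵥ* M) := by
  simp only [pairing, greenSum, greenPair_apply, Matrix.vecMul, dotProduct, Finset.sum_smul,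
    Finset.smul_sum, smul_smul]
  rw [Finset.sum_comm]
  rfl

/-- Conjugating v makes the parametrization of the domain linear. -/
theorem mem_extensionDomain {x₁ x₂ : Torus} {U : Matrix.unitaryGroup (Fin 2) ℂ} {g : L2} :
    g ∈ extensionDomain x₁ x₂ U ↔ ∃ f ∈ sobolevH2Vanishing x₁ x₂, ∃ w : Fin 2 → ℂ,
      g = f + greenSum x₁ x₂ Complex.I (w ᵥ* gramT x₁ x₂)
        + greenSum x₁ x₂ (-Complex.I) (w ᵥ* (U * gramT x₁ x₂)) := by
  constructor
  · rintro ⟨f, hf, v, rfl⟩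
    exact ⟨f, hf, star v, by simp only [pairing_greenPair]⟩
  · rintro ⟨f, hf, w, rfl⟩
    exact ⟨f, hf, star w, by simp only [pairing_greenPair, star_star]⟩

theorem normSq_ne_I (ξ : Fin 2 → ℤ) : (normSq ξ : ℂ) ≠ Complex.I := normSq_ne (by simp) ξ

theorem normSq_ne_neg_I (ξ : Fin 2 → ℤ) : (normSq ξ : ℂ) ≠ -Complex.I := normSq_ne (by simp) ξ

theorem vecMul_one_add (x₁ x₂ : Torus) (U : Matrix (Fin 2) (Fin 2) ℂ) (w : Fin 2 → ℂ) :
    w ᵥ* ((1 + U) * gramT x₁ x₂) = w ᵥ* gramT x₁ x₂ + w ᵥ* (U * gramT x₁ x₂) := by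
  rw [add_mul, one_mul, Matrix.vecMul_add]

/-- The action of the extension: `h = -Δ_U g`. -/
theorem exists_isWeakNegLapl {x₁ x₂ : Torus} (U : Matrix (Fin 2) (Fin 2) ℂ) {f : L2}
    (hf : f ∈ sobolevH2) (w : Fin 2 → ℂ) {g : L2}
    (hg : g = f + greenSum x₁ x₂ Complex.I (w ᵥ* gramT x₁ x₂)
        + greenSum x₁ x₂ (-Complex.I) (w ᵥ* (U * gramT x₁ x₂))) :
    ∃ h, IsWeakNegLapl {x₁, x₂} g h ∧ ∀ ξ, fourierCoefficient h ξ
      = normSq ξ * fourierCoefficient g ξ + 1 / (4 * (π : ℂ) ^ 2) *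
        ∑ k, (w ᵥ* ((1 + U) * gramT x₁ x₂)) k * conj (character ξ (points x₁ x₂ k)) := by
  obtain ⟨h₀, hh⟩ := exists_negLapl hf
  -- The Green's functions G_{±i} are eigenvectors of the adjoint with eigenvalues ±i.
  refine ⟨h₀ + Complex.I • greenSum x₁ x₂ Complex.I (w ᵥ* gramT x₁ x₂)
    + (-Complex.I) • greenSum x₁ x₂ (-Complex.I) (w ᵥ* (U * gramT x₁ x₂)), ?_, fun ξ => ?_⟩
  · rw [hg]
    exact ((isWeakNegLapl_of_normSq_mul _ hh).add
      (isWeakNegLapl_greenSum x₁ x₂ normSq_ne_I _)).add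
      (isWeakNegLapl_greenSum x₁ x₂ normSq_ne_neg_I _)
  · rw [hg, vecMul_one_add]
    simp only [fourierCoefficient_add, fourierCoefficient_smul, hh, mul_add,
      normSq_mul_greenSum x₁ x₂ normSq_ne_I, normSq_mul_greenSum x₁ x₂ normSq_ne_neg_I,
      Pi.add_apply, add_mul, Finset.sum_add_distrib]
    ring

theorem mem_eigenspace_negLaplaceExt {x₁ x₂ : Torus} {U : Matrix.unitaryGroup (Fin 2) ℂ} {μ : ℝ}
    {g : L2} : g ∈ eigenspace (negLaplaceExt x₁ x₂ U) μ ↔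
      ∃ f ∈ sobolevH2Vanishing x₁ x₂, ∃ w : Fin 2 → ℂ,
        g = f + greenSum x₁ x₂ Complex.I (w ᵥ* gramT x₁ x₂)
          + greenSum x₁ x₂ (-Complex.I) (w ᵥ* (U * gramT x₁ x₂)) ∧
        ∀ ξ, (normSq ξ - μ) * fourierCoefficient g ξ = -(1 / (4 * (π : ℂ) ^ 2)) *
          ∑ k, (w ᵥ* ((1 + (U : Matrix (Fin 2) (Fin 2) ℂ)) * gramT x₁ x₂)) k
            * conj (character ξ (points x₁ x₂ k)) := by
  constructor
  · intro h
    obtain ⟨f, hf, w, hg⟩ := mem_extensionDomain.1 h.1.1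
    refine ⟨f, hf, w, hg, fun ξ => ?_⟩
    obtain ⟨k, h1, h2⟩ := exists_isWeakNegLapl (U : Matrix (Fin 2) (Fin 2) ℂ) hf.1 w hg
    obtain ⟨-, rfl⟩ := (mem_eigenspace_domRestrict (dense_domain_negLaplaceMin x₁ x₂) _ h1 μ).1 h
    have h3 := h2 ξ
    rw [fourierCoefficient_smul] at h3
    linear_combination -h3
  · rintro ⟨f, hf, w, hg, H⟩
    obtain ⟨k, h1, h2⟩ := exists_isWeakNegLapl (U : Matrix (Fin 2) (Fin 2) ℂ) hf.1 w hg
    refine (mem_eigenspace_domRestrict (dense_domain_negLaplaceMin x₁ x₂) _ h1 μ).2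
      ⟨mem_extensionDomain.2 ⟨f, hf, w, hg⟩, fourierCoefficient_injective fun ξ => ?_⟩
    rw [h2, fourierCoefficient_smul]
    linear_combination H ξ

/-- Values of a combination of kernels at the two points. -/
theorem hasSum_kernelMatrix (x₁ x₂ : Torus) {c : (Fin 2 → ℤ) → ℂ} (hc : Summable fun ξ => ‖c ξ‖)
    (a : Fin 2 → ℂ) (l : Fin 2) :
    HasSum (fun ξ => -(1 / (4 * (π : ℂ) ^ 2)) *
        ((∑ k, a k * conj (character ξ (points x₁ x₂ k))) * c ξ) * character ξ (points x₁ x₂ l))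
      (-(kernelMatrix x₁ x₂ c *ᵥ a) l) := by
  have h : HasSum (fun ξ => ∑ k, (1 / (4 * (π : ℂ) ^ 2) *
      (c ξ * character ξ (points x₁ x₂ l - points x₁ x₂ k))) * a k)
      ((kernelMatrix x₁ x₂ c *ᵥ a) l) :=
    hasSum_sum fun k _ => (hasSum_kernel hc _).mul_right _
  refine HasSum.congr_fun h.neg fun ξ => ?_
  rw [Finset.sum_mul, Finset.mul_sum, Finset.sum_mul, ← Finset.sum_neg_distrib]
  refine Finset.sum_congr rfl fun k _ => ?_
  rw [character_sub_right]
  ring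

/-! ### Old eigenvalues of the extension -/

theorem Separates.vecMul_gramT_injective {x₁ x₂ : Torus} (hs : Separates x₁ x₂) {w : Fin 2 → ℂ}
    (h : w ᵥ* gramT x₁ x₂ = 0) : w = 0 := by
  rw [← Matrix.vecMul_one w, ← hs.gramT_mul, Matrix.mul_assoc, ← Matrix.vecMul_vecMul, h,
    Matrix.zero_vecMul]

theorem Separates.gramT_mulVec {x₁ x₂ : Torus} (hs : Separates x₁ x₂) (w : Fin 2 → ℂ) :
    gramT x₁ x₂ *ᵥ (gramB x₁ x₂ *ᵥ (w ᵥ* gramT x₁ x₂)) = w := by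
  rw [← Matrix.mulVec_transpose, Matrix.mulVec_mulVec, Matrix.mulVec_mulVec,
    hs.gramT_mul, Matrix.one_mulVec]

theorem greenSum_sub_mem_sobolevH2 (x₁ x₂ : Torus) {z z' : ℂ} (hz : ∀ ξ, (normSq ξ : ℂ) ≠ z)
    (hz' : ∀ ξ, (normSq ξ : ℂ) ≠ z') (a : Fin 2 → ℂ) :
    greenSum x₁ x₂ z a - greenSum x₁ x₂ z' a ∈ sobolevH2 := by
  refine mem_sobolevH2_of_normSq_mul
    (h := z • greenSum x₁ x₂ z a - z' • greenSum x₁ x₂ z' a) fun ξ => ?_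
  rw [fourierCoefficient_sub, fourierCoefficient_sub, fourierCoefficient_smul,
    fourierCoefficient_smul, mul_sub, normSq_mul_greenSum x₁ x₂ hz, normSq_mul_greenSum x₁ x₂ hz']
  ring

/-- The difference of the resolvents at i and -i is 2i/(|ξ|⁴ + 1), so the singularities cancel and
the point values are entries of the Gram matrix. -/
theorem hasSum_greenSum_sub_I (x₁ x₂ : Torus) (a : Fin 2 → ℂ) (l : Fin 2) :
    HasSum (fun ξ => fourierCoefficient
        (greenSum x₁ x₂ Complex.I a - greenSum x₁ x₂ (-Complex.I) a) ξ
          * character ξ (points x₁ x₂ l))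
      (-2 * Complex.I * (gramB x₁ x₂ *ᵥ a) l) := by
  have h := (hasSum_kernelMatrix x₁ x₂ summable_gramWeight a l).mul_left (2 * Complex.I)
  rw [show -2 * Complex.I * (gramB x₁ x₂ *ᵥ a) l
    = 2 * Complex.I * -(kernelMatrix x₁ x₂ gramWeight *ᵥ a) l by rw [gramB]; ring]
  refine HasSum.congr_fun h fun ξ => ?_
  rw [fourierCoefficient_sub, fourierCoefficient_greenSum, fourierCoefficient_greenSum, ← mul_sub,
    ← mul_sub, gramWeight_eq_sub]
  ring

theorem greenSum_neg (x₁ x₂ : Torus) (z : ℂ) (a : Fin 2 → ℂ) :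
    greenSum x₁ x₂ z (-a) = -greenSum x₁ x₂ z a := by
  simp only [greenSum, Pi.neg_apply, neg_smul, Finset.sum_neg_distrib]

theorem mem_sobolevH2Vanishing_iff_points {x₁ x₂ : Torus} {f : L2} :
    f ∈ sobolevH2Vanishing x₁ x₂ ↔ f ∈ sobolevH2 ∧
      ∀ l, HasSum (fun ξ => fourierCoefficient f ξ * character ξ (points x₁ x₂ l)) 0 := by
  rw [mem_sobolevH2Vanishing_iff, Fin.forall_fin_two]
  rfl

/-- On the circle |ξ|² = μ the left side of the eigenvalue equation vanishes, so separation kills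
the charges. What remains of the boundary condition prescribes the two values of g. -/
theorem Separates.mem_eigenspace_negLaplaceExt_iff {x₁ x₂ : Torus} (hs : Separates x₁ x₂)
    {U : Matrix.unitaryGroup (Fin 2) ℂ} {μ : ℝ} (hμ : μ ≠ 0) (hN : ∃ ξ, normSq ξ = μ) {g : L2} :
    g ∈ eigenspace (negLaplaceExt x₁ x₂ U) μ ↔ g ∈ eigenspace negLaplace μ ∧
      ∃ w : Fin 2 → ℂ, w ᵥ* (1 + (U : Matrix (Fin 2) (Fin 2) ℂ)) = 0 ∧
        ∀ l, ∑ ξ ∈ shell μ, fourierCoefficient g ξ * character ξ (points x₁ x₂ l)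
          = -2 * Complex.I * (gramB x₁ x₂ *ᵥ (w ᵥ* gramT x₁ x₂)) l := by
  have hneg : ∀ w : Fin 2 → ℂ, w ᵥ* (1 + (U : Matrix (Fin 2) (Fin 2) ℂ)) = 0 →
      w ᵥ* ((U : Matrix (Fin 2) (Fin 2) ℂ) * gramT x₁ x₂) = -(w ᵥ* gramT x₁ x₂) := by
    intro w hw
    have h := vecMul_one_add x₁ x₂ U w
    rw [← Matrix.vecMul_vecMul, hw, Matrix.zero_vecMul] at h
    exact (neg_eq_of_add_eq_zero_right h.symm).symm
  constructor
  · intro hg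
    obtain ⟨f, hf, w, rfl, H⟩ := mem_eigenspace_negLaplaceExt.1 hg
    have hb : w ᵥ* ((1 + (U : Matrix (Fin 2) (Fin 2) ℂ)) * gramT x₁ x₂) = 0 := by
      refine hs.eq_zero hμ hN fun ξ hξ => ?_
      have h := H ξ
      rw [hξ, sub_self, zero_mul] at h
      exact (mul_eq_zero.1 h.symm).resolve_left (by simp)
    have hw : w ᵥ* (1 + (U : Matrix (Fin 2) (Fin 2) ℂ)) = 0 :=
      hs.vecMul_gramT_injective (by rw [Matrix.vecMul_vecMul, hb])
    have hE : f + greenSum x₁ x₂ Complex.I (w ᵥ* gramT x₁ x₂)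
        + greenSum x₁ x₂ (-Complex.I) (w ᵥ* (U * gramT x₁ x₂)) ∈ eigenspace negLaplace μ := by
      rw [mem_eigenspace_negLaplace]
      intro ξ hξ
      have h := H ξ
      simp only [hb, Pi.zero_apply, zero_mul, Finset.sum_const_zero, mul_zero] at h
      exact (mul_eq_zero.1 h).resolve_left (sub_ne_zero.2 (by exact_mod_cast hξ))
    refine ⟨hE, w, hw, fun l => (hasSum_shell hE _).unique ?_⟩
    have h := ((mem_sobolevH2Vanishing_iff_points.1 hf).2 l).add
      (hasSum_greenSum_sub_I x₁ x₂ (w ᵥ* gramT x₁ x₂) l)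
    rw [zero_add] at h
    refine HasSum.congr_fun h fun ξ => ?_
    rw [hneg w hw, greenSum_neg, ← add_mul, ← fourierCoefficient_add, add_assoc, sub_eq_add_neg]
  · rintro ⟨hg, w, hw, h⟩
    -- Since wUT = -wT, the Green part is a difference of the same combination at i and -i, which
    -- lies in H².
    refine mem_eigenspace_negLaplaceExt.2 ⟨g - (greenSum x₁ x₂ Complex.I (w ᵥ* gramT x₁ x₂)
      - greenSum x₁ x₂ (-Complex.I) (w ᵥ* gramT x₁ x₂)), ?_, w, ?_, fun ξ => ?_⟩
    · refine mem_sobolevH2Vanishing_iff_points.2 ⟨sobolevH2.sub_mem hg.1.1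
        (greenSum_sub_mem_sobolevH2 x₁ x₂ normSq_ne_I normSq_ne_neg_I _), fun l => ?_⟩
      have h1 := (hasSum_shell hg (points x₁ x₂ l)).sub
        (hasSum_greenSum_sub_I x₁ x₂ (w ᵥ* gramT x₁ x₂) l)
      rw [h l, sub_self] at h1
      refine HasSum.congr_fun h1 fun ξ => ?_
      rw [← sub_mul, ← fourierCoefficient_sub]
    · rw [hneg w hw, greenSum_neg]
      abel
    · rw [← Matrix.vecMul_vecMul, hw, Matrix.zero_vecMul]
      simp only [Pi.zero_apply, zero_mul, Finset.sum_const_zero, mul_zero]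
      by_cases hξ : normSq ξ = μ
      · rw [hξ, sub_self, zero_mul]
      · rw [mem_eigenspace_negLaplace.1 hg ξ hξ, mul_zero]

theorem finrank_comap_add_of_surjective {E F : Type*} [AddCommGroup E] [Module ℂ E]
    [FiniteDimensional ℂ E] [AddCommGroup F] [Module ℂ F] [FiniteDimensional ℂ F]
    {L : E →ₗ[ℂ] F} (hL : Function.Surjective L) (R : Submodule ℂ F) :
    Module.finrank ℂ (R.comap L) + Module.finrank ℂ F
      = Module.finrank ℂ E + Module.finrank ℂ R := by
  have h1 := LinearMap.finrank_range_add_finrank_ker (R.mkQ ∘ₗ L)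
  have h2 : LinearMap.range (R.mkQ ∘ₗ L) = ⊤ :=
    LinearMap.range_eq_top.2 ((Submodule.mkQ_surjective R).comp hL)
  have h3 : LinearMap.ker (R.mkQ ∘ₗ L) = R.comap L := by
    rw [LinearMap.ker_comp, Submodule.ker_mkQ]
  rw [h2, h3, finrank_top] at h1
  have h4 := Submodule.finrank_quotient_add_finrank R
  omega

theorem finrank_ker_vecMul (M : Matrix (Fin 2) (Fin 2) ℂ) :
    Module.finrank ℂ (LinearMap.ker M.vecMulLinear) + M.rank = 2 := by
  have h := LinearMap.finrank_range_add_finrank_ker M.vecMulLinear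
  rw [← Matrix.rank_transpose, Matrix.rank, Matrix.mulVecLin_transpose, add_comm, h]
  simp

theorem Separates.exists_evaluation {x₁ x₂ : Torus} (hs : Separates x₁ x₂) {μ : ℝ} (hμ : μ ≠ 0)
    (hN : ∃ ξ, normSq ξ = μ) : ∃ L : eigenspace negLaplace μ →ₗ[ℂ] (Fin 2 → ℂ),
      Function.Surjective L ∧ ∀ g l, L g l
        = ∑ ξ ∈ shell μ, fourierCoefficient g.1 ξ * character ξ (points x₁ x₂ l) := by
  let L : eigenspace negLaplace μ →ₗ[ℂ] (Fin 2 → ℂ) :=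
    LinearMap.pi fun l => ∑ ξ ∈ shell μ, character ξ (points x₁ x₂ l) •
      (fourierFunctional ξ ∘ₗ (eigenspace negLaplace μ).subtype)
  have hL : ∀ g l, L g l
      = ∑ ξ ∈ shell μ, fourierCoefficient g.1 ξ * character ξ (points x₁ x₂ l) := by
    intro g l
    simp only [L, LinearMap.pi_apply, LinearMap.sum_apply]
    exact Finset.sum_congr rfl fun ξ _ => mul_comm _ _
  refine ⟨L, fun y => ?_, hL⟩
  obtain ⟨g, hg, h⟩ := hs.exists_eigenfunction hμ hN y
  exact ⟨⟨g, hg⟩, funext fun l => (hL _ l).trans (h l)⟩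

theorem Separates.exists_boundaryMap {x₁ x₂ : Torus} (hs : Separates x₁ x₂) :
    ∃ J : (Fin 2 → ℂ) →ₗ[ℂ] (Fin 2 → ℂ), Function.Injective J ∧
      ∀ w l, J w l = -2 * Complex.I * (gramB x₁ x₂ *ᵥ (w ᵥ* gramT x₁ x₂)) l := by
  refine ⟨(-2 * Complex.I) • ((gramB x₁ x₂).mulVecLin ∘ₗ (gramT x₁ x₂).vecMulLinear),
    fun v w h => ?_, fun w l => rfl⟩
  have h1 : gramB x₁ x₂ *ᵥ (v ᵥ* gramT x₁ x₂) = gramB x₁ x₂ *ᵥ (w ᵥ* gramT x₁ x₂) := by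
    funext l
    have h2 : -2 * Complex.I * (gramB x₁ x₂ *ᵥ (v ᵥ* gramT x₁ x₂)) l
      = -2 * Complex.I * (gramB x₁ x₂ *ᵥ (w ᵥ* gramT x₁ x₂)) l := congrFun h l
    exact mul_left_cancel₀ (mul_ne_zero (neg_ne_zero.2 two_ne_zero) Complex.I_ne_zero) h2
  rw [← hs.gramT_mulVec v, h1, hs.gramT_mulVec]

/-- The eigenspace is the preimage under the surjective evaluation L of J(K), where K is the left
kernel of 1+U and J is injective. Its dimension is d - 2 + dim K, and dim K = 2 - rank(1+U). -/
theorem Separates.finrank_eigenspace_negLaplaceExt {x₁ x₂ : Torus} (hs : Separates x₁ x₂)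
    (U : Matrix.unitaryGroup (Fin 2) ℂ) {μ : ℝ} (hμ : μ ≠ 0) (hN : ∃ ξ, normSq ξ = μ) :
    Module.finrank ℂ (eigenspace (negLaplaceExt x₁ x₂ U) μ)
      + (1 + (U : Matrix (Fin 2) (Fin 2) ℂ)).rank
      = Module.finrank ℂ (eigenspace negLaplace μ) := by
  have := finiteDimensional_eigenspace_negLaplace μ
  obtain ⟨L, hsurj, hL⟩ := hs.exists_evaluation hμ hN
  obtain ⟨J, hJ, hJw⟩ := hs.exists_boundaryMap
  set K := LinearMap.ker (1 + (U : Matrix (Fin 2) (Fin 2) ℂ)).vecMulLinear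
  have hE : eigenspace (negLaplaceExt x₁ x₂ U) μ
      = ((K.map J).comap L).map (eigenspace negLaplace μ).subtype := by
    ext g
    rw [hs.mem_eigenspace_negLaplaceExt_iff hμ hN]
    constructor
    · rintro ⟨hg, w, hw, h⟩
      refine Submodule.mem_map.2 ⟨⟨g, hg⟩, Submodule.mem_comap.2 (Submodule.mem_map.2
        ⟨w, LinearMap.mem_ker.2 hw, funext fun l => ?_⟩), rfl⟩
      rw [hJw, hL, h]
    · intro hg
      obtain ⟨γ, hγ, rfl⟩ := Submodule.mem_map.1 hg
      obtain ⟨w, hw, h⟩ := Submodule.mem_map.1 (Submodule.mem_comap.1 hγ)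
      refine ⟨γ.2, w, LinearMap.mem_ker.1 hw, fun l => ?_⟩
      rw [Submodule.subtype_apply, ← hL γ l, ← h, hJw]
  have h1 := finrank_comap_add_of_surjective hsurj (K.map J)
  have h2 : Module.finrank ℂ (K.map J) = Module.finrank ℂ K :=
    (Submodule.equivMapOfInjective J hJ K).finrank_eq.symm
  have h3 := finrank_ker_vecMul (1 + (U : Matrix (Fin 2) (Fin 2) ℂ))
  have h4 : Module.finrank ℂ (eigenspace (negLaplaceExt x₁ x₂ U) μ)
      = Module.finrank ℂ ((K.map J).comap L) := by
    rw [hE, Submodule.finrank_map_subtype_eq]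
  have h5 : Module.finrank ℂ (Fin 2 → ℂ) = 2 := by simp
  change Module.finrank ℂ K + _ = 2 at h3
  omega

/-! ### Symmetry of the extension -/

theorem inner_greenSum {x₁ x₂ : Torus} {z : ℂ} (hz : z = Complex.I ∨ z = -Complex.I)
    (a b : Fin 2 → ℂ) :
    inner ℂ (greenSum x₁ x₂ z a) (greenSum x₁ x₂ z b) = star a ⬝ᵥ (gramB x₁ x₂ *ᵥ b) := by
  simp only [greenSum, sum_inner, inner_sum, inner_smul_left, inner_smul_right, inner_green hz,
    dotProduct, Matrix.mulVec, Finset.mul_sum]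
  rw [Finset.sum_comm]
  refine Finset.sum_congr rfl fun i _ => Finset.sum_congr rfl fun j _ => ?_
  simp only [gramB, kernelMatrix, Matrix.of_apply, Pi.star_apply, RCLike.star_def]
  ring

theorem Separates.inner_greenSum_vecMul {x₁ x₂ : Torus} (hs : Separates x₁ x₂) {z : ℂ}
    (hz : z = Complex.I ∨ z = -Complex.I) (v w : Fin 2 → ℂ) :
    inner ℂ (greenSum x₁ x₂ z (v ᵥ* gramT x₁ x₂)) (greenSum x₁ x₂ z (w ᵥ* gramT x₁ x₂))
      = star v ⬝ᵥ w := by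
  rw [inner_greenSum hz, Matrix.star_vecMul, star_gramT, Matrix.mulVec_transpose,
    ← Matrix.dotProduct_mulVec, hs.gramT_mulVec]

theorem star_dotProduct_vecMul_unitary (U : Matrix.unitaryGroup (Fin 2) ℂ) (v w : Fin 2 → ℂ) :
    star (v ᵥ* (U : Matrix (Fin 2) (Fin 2) ℂ)) ⬝ᵥ (w ᵥ* (U : Matrix (Fin 2) (Fin 2) ℂ))
      = star v ⬝ᵥ w := by
  rw [Matrix.star_vecMul, dotProduct_comm, Matrix.dotProduct_mulVec, Matrix.vecMul_vecMul,
    ← Matrix.star_eq_conjTranspose, Matrix.mem_unitaryGroup_iff.1 U.2, Matrix.vecMul_one,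
    dotProduct_comm]

theorem inner_greenSum_normSq_mul {x₁ x₂ : Torus} {z : ℂ} (hz : ∀ ξ, (normSq ξ : ℂ) ≠ z)
    (a : Fin 2 → ℂ) {f h : L2} (hf : f ∈ sobolevH2Vanishing x₁ x₂)
    (H : ∀ ξ, fourierCoefficient h ξ = normSq ξ * fourierCoefficient f ξ) :
    inner ℂ (greenSum x₁ x₂ z a) h = inner ℂ (z • greenSum x₁ x₂ z a) f := by
  simp only [greenSum, Finset.smul_sum, sum_inner]
  refine Finset.sum_congr rfl fun k _ => ?_
  have h1 := inner_green_sub hz (points x₁ x₂ k) H ((mem_sobolevH2Vanishing_iff_points.1 hf).2 k)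
  rw [smul_comm, inner_smul_left, inner_smul_left (y := f), sub_eq_zero.1 h1]

/-- Eigenfunctions of the extension with different eigenvalues are orthogonal. -/
theorem Separates.inner_eq_zero {x₁ x₂ : Torus} (hs : Separates x₁ x₂)
    {U : Matrix.unitaryGroup (Fin 2) ℂ} {μ μ' : ℝ} {g g' : L2}
    (hg : g ∈ eigenspace (negLaplaceExt x₁ x₂ U) μ)
    (hg' : g' ∈ eigenspace (negLaplaceExt x₁ x₂ U) μ') (hne : μ ≠ μ') : inner ℂ g g' = 0 := by
  have key : ∀ {ν : ℝ} {γ : L2}, γ ∈ eigenspace (negLaplaceExt x₁ x₂ U) ν →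
      ∃ f ∈ sobolevH2Vanishing x₁ x₂, ∃ k, ∃ w : Fin 2 → ℂ,
        (∀ ξ, fourierCoefficient k ξ = normSq ξ * fourierCoefficient f ξ) ∧
        γ = f + greenSum x₁ x₂ Complex.I (w ᵥ* gramT x₁ x₂)
          + greenSum x₁ x₂ (-Complex.I) (w ᵥ* U ᵥ* gramT x₁ x₂) ∧
        k + Complex.I • greenSum x₁ x₂ Complex.I (w ᵥ* gramT x₁ x₂)
          + (-Complex.I) • greenSum x₁ x₂ (-Complex.I) (w ᵥ* U ᵥ* gramT x₁ x₂)
          = (ν : ℂ) • γ := by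
    intro ν γ hγ
    obtain ⟨f, hf, w, rfl⟩ := mem_extensionDomain.1 hγ.1.1
    obtain ⟨k, hk⟩ := exists_negLapl hf.1
    have H := ((isWeakNegLapl_of_normSq_mul {x₁, x₂} hk).add
      (isWeakNegLapl_greenSum x₁ x₂ normSq_ne_I (w ᵥ* gramT x₁ x₂))).add
      (isWeakNegLapl_greenSum x₁ x₂ normSq_ne_neg_I (w ᵥ* (U * gramT x₁ x₂)))
    have H2 := (mem_eigenspace_domRestrict (dense_domain_negLaplaceMin x₁ x₂) _ H ν).1 hγ
    refine ⟨f, hf, k, w, hk, ?_, ?_⟩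
    · rw [Matrix.vecMul_vecMul]
    · rw [Matrix.vecMul_vecMul]; exact H2.2
  obtain ⟨f, hf, k, w, hk, e1, e2⟩ := key hg
  obtain ⟨f', hf', k', w', hk', e1', e2'⟩ := key hg'
  have hp := hs.inner_greenSum_vecMul (Or.inl rfl) w w'
  have hq := hs.inner_greenSum_vecMul (Or.inr rfl) (w ᵥ* U) (w' ᵥ* U)
  rw [star_dotProduct_vecMul_unitary, ← hp] at hq
  have a1 := inner_greenSum_normSq_mul normSq_ne_I (w ᵥ* gramT x₁ x₂) hf' hk'
  have a2 := inner_greenSum_normSq_mul normSq_ne_neg_I (w ᵥ* U ᵥ* gramT x₁ x₂) hf' hk'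
  have a3 := congrArg conj (inner_greenSum_normSq_mul normSq_ne_I (w' ᵥ* gramT x₁ x₂) hf hk)
  have a4 := congrArg conj
    (inner_greenSum_normSq_mul normSq_ne_neg_I (w' ᵥ* U ᵥ* gramT x₁ x₂) hf hk)
  have a5 := inner_symm_of_normSq_mul hk hk'
  rw [inner_conj_symm, inner_conj_symm] at a3 a4
  generalize greenSum x₁ x₂ Complex.I (w ᵥ* gramT x₁ x₂) = p at *
  generalize greenSum x₁ x₂ Complex.I (w' ᵥ* gramT x₁ x₂) = p' at *
  generalize greenSum x₁ x₂ (-Complex.I) (w ᵥ* U ᵥ* gramT x₁ x₂) = q at *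
  generalize greenSum x₁ x₂ (-Complex.I) (w' ᵥ* U ᵥ* gramT x₁ x₂) = q' at *
  -- Symmetry of the operator: the H² terms and the mixed terms cancel, and the remainder 2i(⟨q,q'⟩
  -- - ⟨p,p'⟩) vanishes because U is unitary and T orthonormalizes both deficiency bases.
  have h1 : inner ℂ ((μ : ℂ) • g) g' = inner ℂ g ((μ' : ℂ) • g') := by
    rw [← e2, ← e2', e1, e1']
    simp only [inner_add_left, inner_add_right, inner_smul_left, inner_smul_right, map_neg,
      Complex.conj_I] at *
    linear_combination a5 - a1 - a2 + a3 + a4 + 2 * Complex.I * hq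
  rw [inner_smul_left, inner_smul_right, Complex.conj_ofReal, ← sub_eq_zero, ← sub_mul] at h1
  exact (mul_eq_zero.1 h1).resolve_left (sub_ne_zero.2 (by exact_mod_cast hne))

/-! ### At most two new eigenvalues between old ones -/

theorem norm_sum_smul_sq {ι : Type*} [Fintype ι] {g : ι → L2}
    (hg : ∀ i j, i ≠ j → inner ℂ (g i) (g j) = 0) (c : ι → ℂ) :
    ‖∑ i, c i • g i‖ ^ 2 = ∑ i, ‖c i‖ ^ 2 * ‖g i‖ ^ 2 := by
  have h : inner ℂ (∑ i, c i • g i) (∑ i, c i • g i)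
      = ((∑ i, ‖c i‖ ^ 2 * ‖g i‖ ^ 2 : ℝ) : ℂ) := by
    simp only [sum_inner, inner_sum, inner_smul_left, inner_smul_right]
    push_cast
    refine Finset.sum_congr rfl fun i _ => ?_
    rw [Finset.sum_eq_single i]
    · rw [inner_self_eq_norm_sq_to_K]
      have := Complex.mul_conj (c i)
      rw [Complex.normSq_eq_norm_sq] at this
      push_cast at this
      simp only [Complex.coe_algebraMap]
      linear_combination (‖g i‖ : ℂ) ^ 2 * this
    · intro j _ hj; simp [hg _ _ hj]
    · simp
  rw [inner_self_eq_norm_sq_to_K] at h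
  exact Complex.ofReal_injective (by rw [← h, Complex.ofReal_pow]; rfl)

theorem sum_smul_vecMul {ι : Type*} [Fintype ι] (c : ι → ℂ) (w : ι → Fin 2 → ℂ)
    (M : Matrix (Fin 2) (Fin 2) ℂ) : ∑ i, c i • (w i ᵥ* M) = (∑ i, c i • w i) ᵥ* M := by
  rw [Matrix.sum_vecMul]
  simp only [Matrix.smul_vecMul]

/-- The spectral gap of the standard Laplacian. -/
theorem le_norm_sub_smul {f h : L2} {c r : ℝ} (hr : 0 ≤ r)
    (H : ∀ ξ, fourierCoefficient h ξ = normSq ξ * fourierCoefficient f ξ)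
    (hgap : ∀ ξ, r ≤ |normSq ξ - c|) : r ^ 2 * ‖f‖ ^ 2 ≤ ‖h - (c : ℂ) • f‖ ^ 2 := by
  refine hasSum_le (fun ξ => ?_) ((hasSum_norm_sq f).mul_left (r ^ 2)) (hasSum_norm_sq _)
  have e : fourierCoefficient (h - (c : ℂ) • f) ξ
      = ((normSq ξ - c : ℝ) : ℂ) * fourierCoefficient f ξ := by
    rw [fourierCoefficient_sub, fourierCoefficient_smul, H]; push_cast; ring
  rw [e, norm_mul, Complex.norm_real, Real.norm_eq_abs, mul_pow]
  have h1 : r ^ 2 ≤ |normSq ξ - c| ^ 2 := pow_le_pow_left₀ hr (hgap ξ) 2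
  have h2 : 0 ≤ 4 * π ^ 2 * ‖fourierCoefficient f ξ‖ ^ 2 := by positivity
  nlinarith [mul_le_mul_of_nonneg_right h1 h2]

/-- A combination without charges obeys the spectral gap of the standard Laplacian around the
midpoint of the interval, but by Pythagoras its frequencies all lie strictly inside. -/
theorem Separates.not_three_new {x₁ x₂ : Torus} (hs : Separates x₁ x₂)
    {U : Matrix.unitaryGroup (Fin 2) ℂ} {s t : ℝ} (hgap : ∀ ξ, normSq ξ ∉ Set.Ioo s t)
    {μ : Fin 3 → ℝ} (hμ : Function.Injective μ) (hmem : ∀ j, μ j ∈ Set.Ioo s t)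
    {g : Fin 3 → L2} (hg0 : ∀ j, g j ≠ 0)
    (hg : ∀ j, g j ∈ eigenspace (negLaplaceExt x₁ x₂ U) (μ j)) : False := by
  have horth : ∀ i j, i ≠ j → inner ℂ (g i) (g j) = 0 := fun i j hij =>
    hs.inner_eq_zero (hg i) (hg j) (hμ.ne hij)
  have hg' := fun j => mem_eigenspace_negLaplaceExt.1 (hg j)
  choose f hf w hfw hcoef using hg'
  -- Three vectors in ℂ² are dependent.
  obtain ⟨c, hc, hc0⟩ : ∃ c : Fin 3 → ℂ, ∑ j, c j • w j = 0 ∧ c ≠ 0 := by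
    have h := LinearMap.ker_ne_bot_of_finrank_lt
      (f := Fintype.linearCombination ℂ w) (by simp)
    obtain ⟨c, hc, hc0⟩ := (Submodule.ne_bot_iff _).1 h
    exact ⟨c, by simpa [Fintype.linearCombination_apply] using hc, hc0⟩
  obtain ⟨j₀, hj₀⟩ := Function.ne_iff.1 hc0
  set G := ∑ j, c j • g j with hG
  set H := ∑ j, c j • (μ j : ℂ) • g j with hH
  -- The charges are linear in w, so ∑ c_j w_j = 0 removes them.
  have hGH : ∀ ξ, fourierCoefficient H ξ = normSq ξ * fourierCoefficient G ξ := by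
    intro ξ
    have hz : ∑ j, c j * ∑ k, (w j ᵥ* ((1 + (U : Matrix (Fin 2) (Fin 2) ℂ)) * gramT x₁ x₂)) k
        * conj (character ξ (points x₁ x₂ k)) = 0 := by
      simp only [Finset.mul_sum]
      rw [Finset.sum_comm]
      refine Finset.sum_eq_zero fun k _ => ?_
      have h1 := congrFun (sum_smul_vecMul c w
        ((1 + (U : Matrix (Fin 2) (Fin 2) ℂ)) * gramT x₁ x₂)) k
      rw [hc, Matrix.zero_vecMul, Finset.sum_apply] at h1
      simp only [Pi.smul_apply, smul_eq_mul, Pi.zero_apply] at h1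
      simp only [← mul_assoc, ← Finset.sum_mul, h1, zero_mul]
    rw [hG, hH, fourierCoefficient_sum, fourierCoefficient_sum, Finset.mul_sum, ← sub_eq_zero,
      ← Finset.sum_sub_distrib]
    rw [← mul_zero (1 / (4 * (π : ℂ) ^ 2)), ← hz, Finset.mul_sum]
    refine Finset.sum_congr rfl fun j _ => ?_
    rw [fourierCoefficient_smul, fourierCoefficient_smul, fourierCoefficient_smul]
    linear_combination -(c j) * hcoef j ξ
  obtain ⟨h1, h2⟩ := hmem j₀
  have hle := le_norm_sub_smul (f := G) (h := H) (c := (s + t) / 2) (r := (t - s) / 2)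
    (by linarith) hGH fun ξ => by
      by_contra! hlt
      rw [abs_lt] at hlt
      exact hgap ξ ⟨by linarith [hlt.1], by linarith [hlt.2]⟩
  have hHG : H - (((s + t) / 2 : ℝ) : ℂ) • G
      = ∑ j, (c j * ((μ j - (s + t) / 2 : ℝ) : ℂ)) • g j := by
    rw [hG, hH, Finset.smul_sum, ← Finset.sum_sub_distrib]
    refine Finset.sum_congr rfl fun j _ => ?_
    rw [smul_smul, smul_smul, ← sub_smul]
    congr 1
    push_cast
    ring
  rw [hHG, hG, norm_sum_smul_sq horth, norm_sum_smul_sq horth, Finset.mul_sum] at hle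
  refine absurd hle (not_le.2 (Finset.sum_lt_sum (fun j _ => ?_) ⟨j₀, Finset.mem_univ _, ?_⟩))
  · rw [norm_mul, mul_pow, Complex.norm_real, Real.norm_eq_abs, sq_abs]
    have h3 : (μ j - (s + t) / 2) ^ 2 ≤ ((t - s) / 2) ^ 2 := by
      obtain ⟨h1, h2⟩ := hmem j
      nlinarith
    have h4 : 0 ≤ ‖c j‖ ^ 2 * ‖g j‖ ^ 2 := by positivity
    nlinarith [mul_le_mul_of_nonneg_right h3 h4]
  · rw [norm_mul, mul_pow, Complex.norm_real, Real.norm_eq_abs, sq_abs]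
    have h3 : (μ j₀ - (s + t) / 2) ^ 2 < ((t - s) / 2) ^ 2 := by nlinarith
    have h4 : 0 < ‖c j₀‖ ^ 2 * ‖g j₀‖ ^ 2 := by
      have := norm_pos_iff.2 (hg0 j₀)
      have := norm_pos_iff.2 hj₀
      positivity
    nlinarith [mul_lt_mul_of_pos_right h3 h4]

theorem encard_le_two_of_forall {A : Set ℝ}
    (h : ∀ μ : Fin 3 → ℝ, Function.Injective μ → ¬ ∀ j, μ j ∈ A) : A.encard ≤ 2 := by
  by_contra! hlt
  obtain ⟨B, hB, hB3⟩ := Set.exists_subset_encard_eq (s := A) (k := 3)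
    (by simpa [two_add_one_eq_three] using Order.add_one_le_of_lt hlt)
  obtain ⟨a, b, c, hab, hac, hbc, rfl⟩ := Set.encard_eq_three.1 hB3
  refine h ![a, b, c] ?_ ?_
  · intro i j hij
    fin_cases i <;> fin_cases j <;> simp_all
  · intro j
    apply hB
    fin_cases j <;> simp

theorem Separates.encard_newEigenvalues_le {x₁ x₂ : Torus} (hs : Separates x₁ x₂)
    (U : Matrix.unitaryGroup (Fin 2) ℂ) {s t : ℝ}
    (hd : Disjoint (Set.Ioo s t) (eigenvalues negLaplace)) :
    (Set.Ioo s t ∩ newEigenvalues x₁ x₂ U).encard ≤ 2 := by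
  refine encard_le_two_of_forall fun μ hμ hmem => ?_
  have h := fun j => (Submodule.ne_bot_iff _).1 (hmem j).2.1
  choose g hg hg0 using h
  exact hs.not_three_new (fun ξ hξ => Set.disjoint_left.1 hd hξ
    (mem_eigenvalues_negLaplace.2 ⟨ξ, rfl⟩)) hμ (fun j => (hmem j).1) hg0 hg

open scoped ComplexOrder

/-! ### Intermediate values for Hermitian matrices -/

theorem isHermitian_det_im {M : Matrix (Fin 2) (Fin 2) ℂ} (hM : M.IsHermitian) :
    M.det.im = 0 := by
  have h := Matrix.det_conjTranspose M
  rw [hM.eq] at h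
  exact Complex.conj_eq_iff_im.1 h.symm

/-- The determinant is positive at both ends, so it cannot be compared there directly. The trace
changes sign, and where it vanishes the determinant is nonpositive. -/
theorem exists_det_eq_zero {M : ℝ → Matrix (Fin 2) (Fin 2) ℂ} {a b : ℝ} (hab : a < b)
    (hc : ∀ i j, ContinuousOn (fun t => M t i j) (Set.Icc a b))
    (hM : ∀ t ∈ Set.Icc a b, (M t).IsHermitian) (ha : (M a).PosDef) (hb : (-M b).PosDef) :
    ∃ t ∈ Set.Ioo a b, (M t).det = 0 := by
  have hdet : ContinuousOn (fun t => (M t).det.re) (Set.Icc a b) := by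
    simp only [Matrix.det_fin_two]
    exact Complex.continuous_re.comp_continuousOn
      (((hc 0 0).mul (hc 1 1)).sub ((hc 0 1).mul (hc 1 0)))
  have htr : ContinuousOn (fun t => (M t).trace.re) (Set.Icc a b) := by
    simp only [Matrix.trace_fin_two]
    exact Complex.continuous_re.comp_continuousOn ((hc 0 0).add (hc 1 1))
  have d1 : 0 < (M a).det.re := (Complex.pos_iff.1 ha.det_pos).1
  have t1 : 0 < (M a).trace.re := (Complex.pos_iff.1 ha.trace_pos).1
  have t2 : (M b).trace.re < 0 := by
    have h := (Complex.pos_iff.1 hb.trace_pos).1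
    rw [Matrix.trace_neg, Complex.neg_re] at h
    linarith
  obtain ⟨c, hc1, hc2⟩ := intermediate_value_Icc' hab.le htr ⟨t2.le, t1.le⟩
  have hca : c < b := lt_of_le_of_ne hc1.2 (by rintro rfl; exact t2.ne hc2)
  -- A traceless Hermitian matrix with diagonal x, -x and off-diagonal entry z has determinant -x² -
  -- |z|².
  have d2 : (M c).det.re ≤ 0 := by
    have hH := hM c hc1
    have h00 := Complex.conj_eq_iff_im.1 (hH.apply 0 0)
    have h11 := Complex.conj_eq_iff_im.1 (hH.apply 1 1)
    have h01 : conj (M c 0 1) = M c 1 0 := hH.apply 1 0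
    simp only [Matrix.trace_fin_two, Complex.add_re] at hc2
    have h := Complex.mul_conj (M c 0 1)
    rw [Matrix.det_fin_two, ← h01, h, Complex.sub_re, Complex.mul_re, h00, Complex.ofReal_re,
      show (M c 1 1).re = -(M c 0 0).re by linarith]
    nlinarith [Complex.normSq_nonneg (M c 0 1), sq_nonneg (M c 0 0).re]
  obtain ⟨t, ht1, ht2⟩ := intermediate_value_Icc' hc1.1
    (hdet.mono (Set.Icc_subset_Icc_right hc1.2)) ⟨d2, d1.le⟩
  have hta : a < t := lt_of_le_of_ne ht1.1 (by rintro rfl; exact d1.ne' ht2)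
  have htb : t < b := ht1.2.trans_lt hca
  exact ⟨t, ⟨hta, htb⟩, Complex.ext ht2 (isHermitian_det_im (hM t ⟨hta.le, htb.le⟩))⟩

/-! ### The boundary condition -/

theorem unitary_mul_star (U : Matrix.unitaryGroup (Fin 2) ℂ) :
    (U : Matrix (Fin 2) (Fin 2) ℂ) * (U : Matrix (Fin 2) (Fin 2) ℂ)ᴴ = 1 :=
  Matrix.mem_unitaryGroup_iff.1 U.2

/-- The Cayley transform of a unitary matrix is Hermitian. -/
theorem isHermitian_cayley (U : Matrix.unitaryGroup (Fin 2) ℂ)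
    (hU : IsUnit (1 + (U : Matrix (Fin 2) (Fin 2) ℂ)).det) :
    (Complex.I • ((1 + (U : Matrix (Fin 2) (Fin 2) ℂ))⁻¹
      * (1 - (U : Matrix (Fin 2) (Fin 2) ℂ)))).IsHermitian := by
  set V := (U : Matrix (Fin 2) (Fin 2) ℂ) with hV
  set K := 1 + V with hK
  have e1 : K * K⁻¹ = 1 := Matrix.mul_nonsing_inv _ hU
  have e2 : K⁻¹ * K = 1 := Matrix.nonsing_inv_mul _ hU
  have e1' : K⁻¹ᴴ * Kᴴ = 1 := by rw [← Matrix.conjTranspose_mul, e1, Matrix.conjTranspose_one]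
  have e2' : Kᴴ * K⁻¹ᴴ = 1 := by rw [← Matrix.conjTranspose_mul, e2, Matrix.conjTranspose_one]
  have hVV : V * Vᴴ = 1 := unitary_mul_star U
  -- This is unitarity in terms of K = 1 + V. Multiplied by the inverses on both sides, it says that
  -- K⁻¹ has Hermitian part 1/2.
  have h1 : K * Kᴴ = K + Kᴴ := by
    rw [hK, Matrix.conjTranspose_add, Matrix.conjTranspose_one, add_mul, mul_add, mul_add, hVV]
    simp only [one_mul, mul_one]
    abel
  have h2 : K⁻¹ + K⁻¹ᴴ = 1 := by
    have h3 := congrArg (fun X => K⁻¹ * X * K⁻¹ᴴ) h1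
    simp only [mul_add, add_mul] at h3
    rw [← mul_assoc, e2, one_mul, e2', one_mul, mul_assoc, e2', mul_one] at h3
    rw [h3, add_comm]
  -- Hence this matrix is skew-Hermitian, and i times it is Hermitian.
  have h4 : K⁻¹ * (1 - V) = 2 • K⁻¹ - 1 := by
    rw [show 1 - V = 2 • 1 - K by rw [hK, two_smul]; abel, mul_sub, e2, mul_smul_comm, mul_one]
  rw [h4, Matrix.IsHermitian, Matrix.conjTranspose_smul, Matrix.conjTranspose_sub,
    Matrix.conjTranspose_one, Matrix.conjTranspose_nsmul, RCLike.star_def, Complex.conj_I, neg_smul,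
    ← smul_neg]
  congr 1
  rw [neg_sub, sub_eq_sub_iff_add_eq_add, ← smul_add, add_comm, h2]
  rw [two_smul]

/-- Multiplying by (1+U)⁻¹ turns the condition into singularity of M + pL with L the Hermitian
Cayley transform, and p vanishes at both ends. -/
theorem exists_vecMul_eq_zero_of_isUnit (U : Matrix.unitaryGroup (Fin 2) ℂ)
    (hU : IsUnit (1 + (U : Matrix (Fin 2) (Fin 2) ℂ)).det)
    {M : ℝ → Matrix (Fin 2) (Fin 2) ℂ} {p : ℝ → ℝ} {a b : ℝ} (hab : a < b)
    (hc : ∀ i j, ContinuousOn (fun t => M t i j) (Set.Icc a b))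
    (hM : ∀ t ∈ Set.Icc a b, (M t).IsHermitian) (ha : (M a).PosDef) (hb : (-M b).PosDef)
    (hp : ContinuousOn p (Set.Icc a b)) (hpa : p a = 0) (hpb : p b = 0) :
    ∃ t ∈ Set.Ioo a b, ∃ w : Fin 2 → ℂ, w ≠ 0 ∧
      w ᵥ* ((1 + (U : Matrix (Fin 2) (Fin 2) ℂ)) * M t
        + (Complex.I * p t) • (1 - (U : Matrix (Fin 2) (Fin 2) ℂ))) = 0 := by
  have hL := isHermitian_cayley U hU
  set V := (U : Matrix (Fin 2) (Fin 2) ℂ)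
  set L := Complex.I • ((1 + V)⁻¹ * (1 - V)) with hLdef
  obtain ⟨t, ht, hdet⟩ := exists_det_eq_zero (M := fun t => M t + (p t : ℂ) • L) hab
    (fun i j => by
      simp only [Matrix.add_apply, Matrix.smul_apply, smul_eq_mul]
      exact (hc i j).add ((Complex.continuous_ofReal.comp_continuousOn hp).mul continuousOn_const))
    (fun t ht => (hM t ht).add (by
      rw [Matrix.IsHermitian, Matrix.conjTranspose_smul, hL.eq, RCLike.star_def,
        Complex.conj_ofReal]))
    (by simpa [hpa] using ha) (by simpa [hpb] using hb)
  obtain ⟨v, hv, hv0⟩ := Matrix.exists_vecMul_eq_zero_iff.2 hdet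
  refine ⟨t, ht, v ᵥ* (1 + V)⁻¹, ?_, ?_⟩
  · intro h
    apply hv
    rw [← Matrix.vecMul_one v, ← Matrix.nonsing_inv_mul _ hU, ← Matrix.vecMul_vecMul, h,
      Matrix.zero_vecMul]
  · rw [Matrix.vecMul_vecMul, mul_add, ← mul_assoc, Matrix.nonsing_inv_mul _ hU, one_mul,
      mul_smul_comm, mul_comm Complex.I, ← smul_smul, ← hLdef]
    exact hv0

/-- Here -1 is an eigenvalue of U with left eigenvector e₀. The orthogonal vector e is an
eigenvector too, because U is unitary, and its eigenvalue is not -1 because U ≠ -1. -/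
theorem exists_unit_eigenvector (U : Matrix.unitaryGroup (Fin 2) ℂ)
    (hU : (U : Matrix (Fin 2) (Fin 2) ℂ) ≠ -1)
    (hdet : (1 + (U : Matrix (Fin 2) (Fin 2) ℂ)).det = 0) :
    ∃ e e₀ : Fin 2 → ℂ, ∃ θ : ℂ, e ≠ 0 ∧ e₀ ᵥ* (U : Matrix (Fin 2) (Fin 2) ℂ) = -e₀ ∧
      e ᵥ* (U : Matrix (Fin 2) (Fin 2) ℂ) = θ • e ∧ θ * conj θ = 1 ∧ θ ≠ -1 ∧
      (∀ x : Fin 2 → ℂ, x ⬝ᵥ star e = 0 → ∃ s : ℂ, x = s • e₀) ∧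
      ∀ s : ℂ, e + s • e₀ ≠ 0 := by
  have hstar := star_dotProduct_vecMul_unitary U
  set V := (U : Matrix (Fin 2) (Fin 2) ℂ)
  obtain ⟨e₀, he₀, h0⟩ := Matrix.exists_vecMul_eq_zero_iff.2 hdet
  rw [Matrix.vecMul_add, Matrix.vecMul_one] at h0
  have hV0 : e₀ ᵥ* V = -e₀ := (neg_eq_of_add_eq_zero_right h0).symm
  set A := e₀ 0 with hA
  set B := e₀ 1 with hB
  have hAB : A * conj A + B * conj B ≠ 0 := by
    rw [Complex.mul_conj, Complex.mul_conj]
    intro h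
    have h1 : Complex.normSq A + Complex.normSq B = 0 := by exact_mod_cast h
    have h2 := Complex.normSq_nonneg A
    have h3 := Complex.normSq_nonneg B
    have hA0 : A = 0 := Complex.normSq_eq_zero.1 (by linarith)
    have hB0 : B = 0 := Complex.normSq_eq_zero.1 (by linarith)
    apply he₀
    funext i
    fin_cases i
    · exact hA0
    · exact hB0
  set e : Fin 2 → ℂ := ![-conj B, conj A] with he
  have span : ∀ x y : Fin 2 → ℂ, ∀ c : ℂ, c ≠ 0 → y 0 * conj (y 0) + y 1 * conj (y 1) = c →
      x 0 * y 1 = x 1 * y 0 → ∃ s : ℂ, x = s • y := by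
    intro x y c hc0 hc h
    refine ⟨(x 0 * conj (y 0) + x 1 * conj (y 1)) / c, funext fun i => ?_⟩
    fin_cases i
    · simp only [Fin.zero_eta, Pi.smul_apply, smul_eq_mul]
      field_simp
      rw [← hc]
      linear_combination conj (y 1) * h
    · simp only [Fin.mk_one, Pi.smul_apply, smul_eq_mul]
      field_simp
      rw [← hc]
      linear_combination -conj (y 0) * h
  have e0 : e 0 = -conj B := rfl
  have e1 : e 1 = conj A := rfl
  have hspan0 : ∀ x : Fin 2 → ℂ, x ⬝ᵥ star e = 0 → ∃ s : ℂ, x = s • e₀ := by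
    intro x hx
    refine span x e₀ _ hAB rfl ?_
    simp only [dotProduct, Fin.sum_univ_two, Pi.star_apply, e0, e1, RCLike.star_def, map_neg,
      Complex.conj_conj] at hx
    linear_combination -hx
  have horth : star (e ᵥ* V) ⬝ᵥ e₀ = 0 := by
    have h := hstar e e₀
    rw [hV0, dotProduct_neg] at h
    rw [← neg_eq_zero, h]
    simp only [dotProduct, Fin.sum_univ_two, Pi.star_apply, e0, e1, RCLike.star_def, map_neg,
      Complex.conj_conj]
    ring
  obtain ⟨θ, hθ⟩ : ∃ θ : ℂ, e ᵥ* V = θ • e := by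
    refine span _ e _ hAB (by rw [e0, e1, map_neg, Complex.conj_conj, Complex.conj_conj]; ring) ?_
    have h := congrArg conj horth
    simp only [dotProduct, Fin.sum_univ_two, Pi.star_apply, RCLike.star_def, map_add, map_mul,
      Complex.conj_conj, map_zero] at h
    rw [e0, e1]
    linear_combination h
  have hee : star e ⬝ᵥ e = A * conj A + B * conj B := by
    simp only [dotProduct, Fin.sum_univ_two, Pi.star_apply, e0, e1, RCLike.star_def, map_neg,
      Complex.conj_conj]
    ring
  refine ⟨e, e₀, θ, ?_, hV0, hθ, ?_, ?_, hspan0, ?_⟩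
  · intro h
    rw [h] at hee
    exact hAB (by rw [← hee]; simp)
  · have h := hstar e e
    rw [hθ, star_smul, smul_dotProduct, dotProduct_smul, hee, smul_eq_mul, smul_eq_mul,
      RCLike.star_def] at h
    have h1 : (θ * conj θ - 1) * (A * conj A + B * conj B) = 0 := by linear_combination h
    exact sub_eq_zero.1 ((mul_eq_zero.1 h1).resolve_right hAB)
  · rintro rfl
    apply hU
    have h1 : ∀ y : Fin 2 → ℂ, y ᵥ* V = -y := by
      intro y
      have h2 : (y - ((y ⬝ᵥ star e) / (star e ⬝ᵥ e)) • e) ⬝ᵥ star e = 0 := by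
        rw [sub_dotProduct, smul_dotProduct, smul_eq_mul, dotProduct_comm e, hee,
          div_mul_cancel₀ _ hAB, sub_self]
      obtain ⟨s, hs⟩ := hspan0 _ h2
      rw [sub_eq_iff_eq_add] at hs
      rw [hs, Matrix.add_vecMul, Matrix.smul_vecMul, Matrix.smul_vecMul, hV0, hθ]
      module
    ext i j
    have h3 := congrFun (h1 (Pi.single i 1)) j
    rw [Matrix.single_one_vecMul] at h3
    simpa [Matrix.one_apply, Pi.single_apply, eq_comm] using h3
  · intro s hs
    have h : (e + s • e₀) ⬝ᵥ star e = 0 := by rw [hs, zero_dotProduct]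
    have h1 : e₀ ⬝ᵥ star e = 0 := by
      simp only [dotProduct, Fin.sum_univ_two, Pi.star_apply, e0, e1, RCLike.star_def, map_neg,
        Complex.conj_conj]
      ring
    rw [add_dotProduct, smul_dotProduct, h1, smul_zero, add_zero, dotProduct_comm, hee] at h
    exact hAB h

/-- Now 1+U has rank one. For w = e + σe₀ the component of the condition along e is a real scalar
equation independent of σ, solved by the intermediate value theorem. The component along e₀ then
determines σ. -/
theorem exists_vecMul_eq_zero_of_det_eq_zero (U : Matrix.unitaryGroup (Fin 2) ℂ)
    (hU : (U : Matrix (Fin 2) (Fin 2) ℂ) ≠ -1)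
    (hdet : (1 + (U : Matrix (Fin 2) (Fin 2) ℂ)).det = 0)
    {M : ℝ → Matrix (Fin 2) (Fin 2) ℂ} {p : ℝ → ℝ} {a b : ℝ} (hab : a < b)
    (hc : ∀ i j, ContinuousOn (fun t => M t i j) (Set.Icc a b))
    (hM : ∀ t ∈ Set.Icc a b, (M t).IsHermitian) (ha : (M a).PosDef) (hb : (-M b).PosDef)
    (hp : ContinuousOn p (Set.Icc a b)) (hpa : p a = 0) (hpb : p b = 0)
    (hp0 : ∀ t ∈ Set.Ioo a b, p t ≠ 0) :
    ∃ t ∈ Set.Ioo a b, ∃ w : Fin 2 → ℂ, w ≠ 0 ∧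
      w ᵥ* ((1 + (U : Matrix (Fin 2) (Fin 2) ℂ)) * M t
        + (Complex.I * p t) • (1 - (U : Matrix (Fin 2) (Fin 2) ℂ))) = 0 := by
  obtain ⟨e, e₀, θ, he, h0, hθ, hθ1, hθ2, hspan, hne⟩ := exists_unit_eigenvector U hU hdet
  set V := (U : Matrix (Fin 2) (Fin 2) ℂ)
  have hθ3 : 1 + θ ≠ 0 := fun h => hθ2 (by linear_combination h)
  -- The scalar Cayley transform of a number of modulus one is real.
  have hre : conj (Complex.I * (1 - θ) / (1 + θ)) = Complex.I * (1 - θ) / (1 + θ) := by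
    have h4 : 1 + conj θ ≠ 0 := by
      have h5 := (map_ne_zero (starRingEnd ℂ)).2 hθ3
      rwa [map_add, map_one] at h5
    simp only [map_div₀, map_mul, map_sub, map_add, map_one, Complex.conj_I]
    rw [div_eq_div_iff h4 hθ3]
    linear_combination 2 * Complex.I * hθ1
  set r := (Complex.I * (1 - θ) / (1 + θ)).re with hr
  have hr' : Complex.I * (1 - θ) / (1 + θ) = r := (Complex.conj_eq_iff_re.1 hre).symm
  have hse : star e ≠ 0 := star_ne_zero.2 he
  have hq : ∀ X : Matrix (Fin 2) (Fin 2) ℂ, star (star e) ⬝ᵥ (X *ᵥ star e) = e ⬝ᵥ (X *ᵥ star e) :=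
    fun X => by rw [star_star]
  set φ : ℝ → ℂ := fun t => e ⬝ᵥ (M t *ᵥ star e) + p t * r * (e ⬝ᵥ star e) with hφ
  have hφc : ContinuousOn (fun t => (φ t).re) (Set.Icc a b) := by
    refine Complex.continuous_re.comp_continuousOn ?_
    simp only [hφ, dotProduct, Matrix.mulVec, Fin.sum_univ_two]
    have hp' := Complex.continuous_ofReal.comp_continuousOn hp
    have h00 := hc 0 0
    have h01 := hc 0 1
    have h10 := hc 1 0
    have h11 := hc 1 1
    simp only [Function.comp_def] at hp'
    fun_prop
  have hφa : 0 < (φ a).re := by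
    have h := (Complex.pos_iff.1 (ha.dotProduct_mulVec_pos hse)).1
    rw [hq] at h
    simpa [hφ, hpa] using h
  have hφb : (φ b).re < 0 := by
    have h := (Complex.pos_iff.1 (hb.dotProduct_mulVec_pos hse)).1
    rw [hq, Matrix.neg_mulVec, dotProduct_neg, Complex.neg_re] at h
    simp only [hφ, hpb, Complex.ofReal_zero, zero_mul, add_zero]
    linarith
  obtain ⟨t, ht1, ht2⟩ := intermediate_value_Icc' hab.le hφc ⟨hφb.le, hφa.le⟩
  have hta : a < t := lt_of_le_of_ne ht1.1 (by rintro rfl; exact hφa.ne' ht2)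
  have htb : t < b := lt_of_le_of_ne ht1.2 (by rintro rfl; exact hφb.ne ht2)
  have him : (φ t).im = 0 := by
    have h1 : (e ⬝ᵥ (M t *ᵥ star e)).im = 0 := by
      rw [← hq]
      exact (hM t ht1).im_star_dotProduct_mulVec_self (star e)
    have h2 : (e ⬝ᵥ star e).im = 0 := by
      simp [dotProduct, Fin.sum_univ_two, Complex.mul_conj]
    simp only [hφ, Complex.add_im, Complex.mul_im, Complex.mul_re, Complex.ofReal_im,
      Complex.ofReal_re, h1, h2]
    ring
  have hφt : φ t = 0 := Complex.ext ht2 him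
  have hpt : (p t : ℂ) ≠ 0 := by exact_mod_cast hp0 t ⟨hta, htb⟩
  obtain ⟨s, hs⟩ := hspan ((1 + θ) • (e ᵥ* M t) + (Complex.I * p t * (1 - θ)) • e) (by
    have h3 : Complex.I * (1 - θ) = r * (1 + θ) := by rw [← hr']; field_simp
    rw [add_dotProduct, smul_dotProduct, smul_dotProduct, ← Matrix.dotProduct_mulVec, smul_eq_mul,
      smul_eq_mul]
    linear_combination (1 + θ) * hφt + p t * (e ⬝ᵥ star e) * h3)
  -- On e₀ the matrix acts as 2ip(t), so this coefficient cancels the remainder s e₀. It requires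
  -- p(t) ≠ 0.
  refine ⟨t, ⟨hta, htb⟩, e + (-s / (2 * Complex.I * p t)) • e₀, hne _, ?_⟩
  have k0 : e₀ ᵥ* (1 + V) = 0 := by rw [Matrix.vecMul_add, Matrix.vecMul_one, h0, add_neg_cancel]
  have k1 : e ᵥ* (1 + V) = (1 + θ) • e := by
    rw [Matrix.vecMul_add, Matrix.vecMul_one, hθ, add_smul, one_smul]
  have k2 : e₀ ᵥ* (1 - V) = (2 : ℂ) • e₀ := by
    rw [Matrix.vecMul_sub, Matrix.vecMul_one, h0, sub_neg_eq_add, two_smul]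
  have k3 : e ᵥ* (1 - V) = (1 - θ) • e := by
    rw [Matrix.vecMul_sub, Matrix.vecMul_one, hθ, sub_smul, one_smul]
  have k4 : (e + (-s / (2 * Complex.I * p t)) • e₀) ᵥ* (1 + V) = (1 + θ) • e := by
    rw [Matrix.add_vecMul, Matrix.smul_vecMul, k0, k1, smul_zero, add_zero]
  have k5 : (e + (-s / (2 * Complex.I * p t)) • e₀) ᵥ* (1 - V)
      = (1 - θ) • e + (-s / (2 * Complex.I * p t) * 2) • e₀ := by
    rw [Matrix.add_vecMul, Matrix.smul_vecMul, k2, k3, smul_smul]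
  rw [Matrix.vecMul_add, ← Matrix.vecMul_vecMul, Matrix.vecMul_smul, k4, k5, Matrix.smul_vecMul,
    smul_add, smul_smul, smul_smul, ← add_assoc, hs, ← add_smul]
  have := Complex.I_ne_zero
  convert zero_smul ℂ e₀ using 2
  field_simp
  ring

theorem exists_vecMul_eq_zero (U : Matrix.unitaryGroup (Fin 2) ℂ)
    (hU : (U : Matrix (Fin 2) (Fin 2) ℂ) ≠ -1)
    {M : ℝ → Matrix (Fin 2) (Fin 2) ℂ} {p : ℝ → ℝ} {a b : ℝ} (hab : a < b)
    (hc : ∀ i j, ContinuousOn (fun t => M t i j) (Set.Icc a b))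
    (hM : ∀ t ∈ Set.Icc a b, (M t).IsHermitian) (ha : (M a).PosDef) (hb : (-M b).PosDef)
    (hp : ContinuousOn p (Set.Icc a b)) (hpa : p a = 0) (hpb : p b = 0)
    (hp0 : ∀ t ∈ Set.Ioo a b, p t ≠ 0) :
    ∃ t ∈ Set.Ioo a b, ∃ w : Fin 2 → ℂ, w ≠ 0 ∧
      w ᵥ* ((1 + (U : Matrix (Fin 2) (Fin 2) ℂ)) * M t
        + (Complex.I * p t) • (1 - (U : Matrix (Fin 2) (Fin 2) ℂ))) = 0 := by
  by_cases hdet : (1 + (U : Matrix (Fin 2) (Fin 2) ℂ)).det = 0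
  · exact exists_vecMul_eq_zero_of_det_eq_zero U hU hdet hab hc hM ha hb hp hpa hpb hp0
  · exact exists_vecMul_eq_zero_of_isUnit U (isUnit_iff_ne_zero.2 hdet) hab hc hM ha hb hp hpa hpb

/-! ### New eigenvalues from the boundary condition -/

/-- The weight `1 / (|ξ|² - μ) - |ξ|² / (|ξ|⁴ + 1)`. -/
def resolventWeight (μ : ℝ) (ξ : Fin 2 → ℤ) : ℂ :=
  (((normSq ξ - μ)⁻¹ - normSq ξ / (normSq ξ ^ 2 + 1) : ℝ) : ℂ)

theorem resolventWeight_neg (μ : ℝ) (ξ : Fin 2 → ℤ) :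
    resolventWeight μ (-ξ) = resolventWeight μ ξ := by
  rw [resolventWeight, normSq_neg, resolventWeight]

/-- Splitting 1/(n ∓ i) into n/(n²+1) ± i/(n²+1) explains the subtraction in `resolventWeight`: the
common real part pairs with a + a', the Gram weight with a - a'. -/
theorem inv_sub_I (ξ : Fin 2 → ℤ) : ((normSq ξ : ℂ) - Complex.I)⁻¹
    = (normSq ξ / (normSq ξ ^ 2 + 1) : ℝ) + Complex.I * gramWeight ξ := by
  have h := sub_ne_zero.2 (normSq_ne_I ξ)
  have h1 : (normSq ξ : ℂ) ^ 2 + 1 ≠ 0 := by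
    have : normSq ξ ^ 2 + 1 ≠ 0 := by positivity
    exact_mod_cast this
  rw [gramWeight]
  push_cast
  field_simp
  linear_combination Complex.I_sq

theorem inv_sub_neg_I (ξ : Fin 2 → ℤ) : ((normSq ξ : ℂ) - -Complex.I)⁻¹
    = (normSq ξ / (normSq ξ ^ 2 + 1) : ℝ) - Complex.I * gramWeight ξ := by
  linear_combination inv_sub_I ξ - gramWeight_eq_sub ξ

theorem greenSum_add (x₁ x₂ : Torus) (z : ℂ) (a b : Fin 2 → ℂ) :
    greenSum x₁ x₂ z (a + b) = greenSum x₁ x₂ z a + greenSum x₁ x₂ z b := by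
  simp only [greenSum, Pi.add_apply, add_smul, Finset.sum_add_distrib]

/-- The candidate is ∑ b_k G_μ(·,x_k) with b = w(1+U)T. Replacing G_μ by G_i on a = wT and by G_{-i}
on a' = wUT costs an H² function, and the hypothesis on w says exactly that it vanishes at the two
points. -/
theorem Separates.mem_newEigenvalues {x₁ x₂ : Torus} (hs : Separates x₁ x₂)
    {U : Matrix.unitaryGroup (Fin 2) ℂ} {μ : ℝ} (hμ : ∀ ξ, normSq ξ ≠ μ)
    (hsum : Summable fun ξ => ‖resolventWeight μ ξ‖) {w : Fin 2 → ℂ} (hw : w ≠ 0)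
    (h : w ᵥ* ((1 + (U : Matrix (Fin 2) (Fin 2) ℂ))
        * (gramT x₁ x₂ * -kernelMatrix x₁ x₂ (resolventWeight μ) * (gramT x₁ x₂)ᵀ)
        + Complex.I • (1 - (U : Matrix (Fin 2) (Fin 2) ℂ))) = 0) :
    μ ∈ newEigenvalues x₁ x₂ U := by
  set V := (U : Matrix (Fin 2) (Fin 2) ℂ) with hV
  set T := gramT x₁ x₂ with hT
  set a := w ᵥ* T with ha
  set a' := w ᵥ* (V * T) with ha'
  have hb : w ᵥ* ((1 + V) * T) = a + a' := vecMul_one_add x₁ x₂ V w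
  have hμ' : ∀ ξ, (normSq ξ : ℂ) ≠ μ := fun ξ => by exact_mod_cast hμ ξ
  have hzero : -(kernelMatrix x₁ x₂ (resolventWeight μ) *ᵥ (a + a'))
      + Complex.I • (gramB x₁ x₂ *ᵥ (a - a')) = 0 := by
    have hTT : Tᵀ * (T * gramB x₁ x₂) = 1 :=
      mul_eq_one_comm.1 hs.gramT_mul
    -- Inserting T B Tᵀ = 1 exposes a common right factor Tᵀ, which is then cancelled.
    have h1 : (1 - V) = (1 - V) * T * gramB x₁ x₂ * Tᵀ := by
      rw [mul_assoc (1 - V), mul_assoc (1 - V), hs.gramT_mul, mul_one]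
    have h2 : (a + a') ᵥ* -kernelMatrix x₁ x₂ (resolventWeight μ) ᵥ* Tᵀ
        + Complex.I • ((a - a') ᵥ* gramB x₁ x₂ ᵥ* Tᵀ) = 0 := by
      rw [← h]
      conv_rhs => rw [h1]
      have h3 : w ᵥ* ((1 - V) * T) = a - a' := by
        rw [sub_mul, one_mul, Matrix.vecMul_sub]
      rw [Matrix.vecMul_add, Matrix.vecMul_smul, ← hb, ← h3]
      simp only [Matrix.vecMul_vecMul, mul_assoc]
    have key : ∀ y y', (y ᵥ* Tᵀ + Complex.I • (y' ᵥ* Tᵀ)) ᵥ* (T * gramB x₁ x₂)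
        = y + Complex.I • y' := fun y y' => by
      rw [Matrix.add_vecMul, Matrix.smul_vecMul, Matrix.vecMul_vecMul, Matrix.vecMul_vecMul, hTT,
        Matrix.vecMul_one, Matrix.vecMul_one]
    have hsymm : ∀ {c : (Fin 2 → ℤ) → ℂ}, (∀ ξ, c (-ξ) = c ξ) → ∀ y,
        y ᵥ* kernelMatrix x₁ x₂ c = kernelMatrix x₁ x₂ c *ᵥ y := fun hc y => by
      rw [← Matrix.mulVec_transpose, kernelMatrix_isSymm x₁ x₂ hc]
    have h3 := key ((a + a') ᵥ* -kernelMatrix x₁ x₂ (resolventWeight μ)) ((a - a') ᵥ* gramB x₁ x₂)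
    rw [h2, Matrix.zero_vecMul, Matrix.vecMul_neg, hsymm (resolventWeight_neg μ)] at h3
    rw [h3, gramB, hsymm gramWeight_neg]
  have hmem : greenSum x₁ x₂ μ (a + a') ∈ eigenspace (negLaplaceExt x₁ x₂ U) μ := by
    refine mem_eigenspace_negLaplaceExt.2 ⟨(greenSum x₁ x₂ μ a - greenSum x₁ x₂ Complex.I a)
      + (greenSum x₁ x₂ μ a' - greenSum x₁ x₂ (-Complex.I) a'), ?_, w, ?_, fun ξ => ?_⟩
    · refine mem_sobolevH2Vanishing_iff_points.2 ⟨sobolevH2.add_mem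
        (greenSum_sub_mem_sobolevH2 x₁ x₂ hμ' normSq_ne_I _)
        (greenSum_sub_mem_sobolevH2 x₁ x₂ hμ' normSq_ne_neg_I _), fun l => ?_⟩
      have h1 := (hasSum_kernelMatrix x₁ x₂ hsum (a + a') l).sub
        ((hasSum_kernelMatrix x₁ x₂ summable_gramWeight (a - a') l).mul_left Complex.I)
      have h2 := congrFun hzero l
      simp only [Pi.add_apply, Pi.neg_apply, Pi.smul_apply, smul_eq_mul, Pi.zero_apply] at h2
      rw [gramB] at h2
      rw [mul_neg, sub_neg_eq_add, h2] at h1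
      refine HasSum.congr_fun h1 fun ξ => ?_
      simp only [fourierCoefficient_add, fourierCoefficient_sub, fourierCoefficient_greenSum,
        inv_sub_I, inv_sub_neg_I, Pi.add_apply, Pi.sub_apply, add_mul, sub_mul,
        Finset.sum_add_distrib, Finset.sum_sub_distrib, resolventWeight]
      push_cast
      ring
    · rw [greenSum_add]
      abel
    · rw [← hV, hb, fourierCoefficient_greenSum]
      have := sub_ne_zero.2 (hμ' ξ)
      have := pi_ne
      field_simp
  refine ⟨fun hbot => ?_, fun hN => ?_⟩
  · have h0 := (Submodule.eq_bot_iff _).1 hbot _ hmem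
    -- If the candidate vanishes, so do its charges. Then w(1+U) = 0, the hypothesis leaves w(1-U) =
    -- 0, and adding gives 2w = 0.
    have hb0 : a + a' = 0 := by
      refine hs.eq_zero (μ := 1) one_ne_zero ⟨Pi.single 0 1, by simp [normSq]⟩ fun ξ _ => ?_
      have h1 := fourierCoefficient_greenSum x₁ x₂ μ (a + a') ξ
      rw [h0, fourierCoefficient_zero] at h1
      have h2 := (mul_eq_zero.1 h1.symm).resolve_left (by simp)
      exact (mul_eq_zero.1 h2).resolve_right (inv_ne_zero (sub_ne_zero.2 (hμ' ξ)))
    have hw1 : w ᵥ* (1 + V) = 0 :=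
      hs.vecMul_gramT_injective (by rw [Matrix.vecMul_vecMul, ← hT, hb, hb0])
    rw [Matrix.vecMul_add, ← Matrix.vecMul_vecMul, hw1, Matrix.zero_vecMul, zero_add,
      Matrix.vecMul_smul, smul_eq_zero] at h
    have hw2 := h.resolve_left Complex.I_ne_zero
    rw [Matrix.vecMul_sub, Matrix.vecMul_one] at hw2
    rw [Matrix.vecMul_add, Matrix.vecMul_one] at hw1
    have hw3 : (2 : ℂ) • w = 0 := by
      rw [two_smul]
      nth_rewrite 1 [sub_eq_zero.1 hw2]
      rw [add_comm, hw1]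
    exact hw ((smul_eq_zero.1 hw3).resolve_left two_ne_zero)
  · obtain ⟨ξ, hξ⟩ := mem_eigenvalues_negLaplace.1 hN
    exact hμ ξ hξ

/-! ### Regularized kernels between two neighbouring old eigenvalues -/

/-- The function `(μ - m) (m' - μ) (1 / (n - μ) - n / (n² + 1))`, extended continuously to `μ = m`
and `μ = m'`. -/
def regularizedTerm (m m' n μ : ℝ) : ℝ :=
  (if n = m then -(m' - μ) else if n = m' then μ - m else (μ - m) * (m' - μ) * (n - μ)⁻¹)
    - (μ - m) * (m' - μ) * (n / (n ^ 2 + 1))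

theorem regularizedTerm_eq {m m' n μ : ℝ} (hμ : μ ∈ Set.Ioo m m') :
    regularizedTerm m m' n μ = (μ - m) * (m' - μ) * ((n - μ)⁻¹ - n / (n ^ 2 + 1)) := by
  obtain ⟨h1, h2⟩ := hμ
  rw [regularizedTerm, mul_sub ((μ - m) * (m' - μ))]
  congr 1
  split_ifs with h h'
  · subst h
    have : n - μ ≠ 0 := by linarith
    field_simp
    ring
  · subst h'
    have : n - μ ≠ 0 := by linarith
    field_simp
  · rfl

theorem exists_int_normSq (ξ : Fin 2 → ℤ) : ∃ k : ℤ, normSq ξ = k :=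
  ⟨∑ j, ξ j ^ 2, by simp [normSq]⟩

/-- `m` and `m'` are neighbouring elements of the spectrum, and `0 < m`. -/
structure Neighbours (m m' : ℝ) : Prop where
  pos : 0 < m
  lt : m < m'
  left : ∃ ξ, normSq ξ = m
  right : ∃ ξ, normSq ξ = m'
  gap : ∀ ξ, normSq ξ ∉ Set.Ioo m m'

/-- Values of |ξ|² are integers, so those other than m and m' stay at distance at least 1 from [m,
m']. -/
theorem Neighbours.le_mul_abs {m m' : ℝ} (h : Neighbours m m') {ξ : Fin 2 → ℤ}
    (h1 : normSq ξ ≠ m) (h2 : normSq ξ ≠ m') {μ : ℝ} (hμ : μ ∈ Set.Icc m m') :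
    1 + normSq ξ ≤ (m' + 2) * |normSq ξ - μ| := by
  obtain ⟨k, hk⟩ := exists_int_normSq ξ
  obtain ⟨ξ₁, hm⟩ := h.left
  obtain ⟨ξ₂, hm'⟩ := h.right
  obtain ⟨a, ha⟩ := exists_int_normSq ξ₁
  obtain ⟨b, hb⟩ := exists_int_normSq ξ₂
  have hpos := h.pos
  have hlt := h.lt
  obtain ⟨hμ1, hμ2⟩ := hμ
  rcases lt_or_ge (normSq ξ) m with hc | hc
  · have h3 : normSq ξ + 1 ≤ m := by
      rw [← hm, ha, hk] at hc ⊢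
      exact_mod_cast hc
    have h4 : 1 ≤ |normSq ξ - μ| := by
      rw [abs_sub_comm]
      exact le_trans (by linarith) (le_abs_self _)
    nlinarith
  · have hc' : m < normSq ξ := lt_of_le_of_ne hc h1.symm
    have hc'' : m' < normSq ξ := lt_of_le_of_ne (not_lt.1 fun h5 => h.gap ξ ⟨hc', h5⟩) h2.symm
    have h3 : m' + 1 ≤ normSq ξ := by
      rw [← hm', hb, hk] at hc'' ⊢
      exact_mod_cast hc''
    have h4 : normSq ξ - m' ≤ |normSq ξ - μ| := le_trans (by linarith) (le_abs_self _)
    nlinarith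

/-- The bound for the regularized terms. -/
def regularizedBound (m' : ℝ) : ℝ :=
  (m' + m' ^ 2) * (m' ^ 2 + 1) + m' ^ 2 * ((1 + m') * (m' + 2))

/-- Uniformity in μ up to the endpoints is what allows passing to the limit in the kernel. The two
summands of the constant cover n ∈ {m, m'} and all other n. -/
theorem Neighbours.abs_regularizedTerm_le {m m' : ℝ} (h : Neighbours m m') (ξ : Fin 2 → ℤ) {μ : ℝ}
    (hμ : μ ∈ Set.Icc m m') :
    |regularizedTerm m m' (normSq ξ) μ| ≤ regularizedBound m' * (normSq ξ ^ 2 + 1)⁻¹ := by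
  have hpos := h.pos
  have hlt := h.lt
  have hn := normSq_nonneg ξ
  have hle := h.le_mul_abs (ξ := ξ) (μ := μ)
  obtain ⟨hμ1, hμ2⟩ := hμ
  generalize normSq ξ = n at *
  have hm' : 0 < m' := by linarith
  have hp0 : 0 ≤ (μ - m) * (m' - μ) := mul_nonneg (by linarith) (by linarith)
  have hp1 : (μ - m) * (m' - μ) ≤ m' ^ 2 := by nlinarith
  have hq0 : 0 ≤ n / (n ^ 2 + 1) := by positivity
  have hq1 : n / (n ^ 2 + 1) ≤ 1 := by
    rw [div_le_one (by positivity)]; nlinarith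
  have hC : 0 ≤ (m' + m' ^ 2) * (m' ^ 2 + 1) := by positivity
  have hC' : 0 ≤ m' ^ 2 * ((1 + m') * (m' + 2)) := by positivity
  rw [← div_eq_mul_inv, le_div_iff₀ (by positivity)]
  have hpq0 := mul_nonneg hp0 hq0
  have hpq1 : (μ - m) * (m' - μ) * (n / (n ^ 2 + 1)) ≤ m' ^ 2 :=
    (mul_le_of_le_one_right hp0 hq1).trans hp1
  by_cases hn1 : n = m ∨ n = m'
  · have hb : |regularizedTerm m m' n μ| ≤ m' + m' ^ 2 := by
      unfold regularizedTerm
      rw [abs_le]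
      split_ifs with h1 h2
      · constructor <;> nlinarith
      · constructor <;> nlinarith
      · exact absurd hn1 (by tauto)
    have hn2 : n ^ 2 + 1 ≤ m' ^ 2 + 1 := by rcases hn1 with rfl | rfl <;> nlinarith
    have := mul_le_mul hb hn2 (by positivity) (by positivity)
    unfold regularizedBound
    linarith
  · push Not at hn1
    have hd := hle hn1.1 hn1.2 ⟨hμ1, hμ2⟩
    have hd0 : 0 < |n - μ| := by
      by_contra! h0
      nlinarith
    have hne : n - μ ≠ 0 := abs_pos.1 hd0
    -- Combining the fractions, 1/(n-μ) - n/(n²+1) = (1+nμ)/((n-μ)(n²+1)), gains one order of decay.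
    have e : regularizedTerm m m' n μ * (n ^ 2 + 1)
        = (μ - m) * (m' - μ) * ((1 + n * μ) / (n - μ)) := by
      rw [regularizedTerm, if_neg hn1.1, if_neg hn1.2]
      field_simp
      ring
    have h1 : |(1 + n * μ) / (n - μ)| ≤ (1 + m') * (m' + 2) := by
      have hnμ : 0 ≤ n * μ := mul_nonneg hn (by linarith)
      rw [abs_div, abs_of_nonneg (by linarith), div_le_iff₀ hd0]
      have h3 : 1 + n * μ ≤ (1 + m') * (1 + n) := by nlinarith
      have h4 := mul_le_mul_of_nonneg_left hd (by linarith : (0 : ℝ) ≤ 1 + m')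
      linarith
    rw [← abs_of_pos (by positivity : 0 < n ^ 2 + 1), ← abs_mul, e, abs_mul, abs_of_nonneg hp0]
    have h2 := mul_le_mul hp1 h1 (abs_nonneg _) (by positivity)
    unfold regularizedBound
    linarith

theorem Neighbours.continuousOn_regularizedTerm {m m' : ℝ} (h : Neighbours m m')
    (ξ : Fin 2 → ℤ) :
    ContinuousOn (fun μ => regularizedTerm m m' (normSq ξ) μ) (Set.Icc m m') := by
  unfold regularizedTerm
  refine ContinuousOn.sub ?_ (by fun_prop)
  split_ifs with h1 h2
  · fun_prop
  · fun_prop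
  · refine ContinuousOn.mul (by fun_prop) (ContinuousOn.inv₀ (by fun_prop) fun μ hμ h0 => ?_)
    have h3 := h.le_mul_abs h1 h2 hμ
    rw [h0, abs_zero, mul_zero] at h3
    linarith [normSq_nonneg ξ]

/-- The weight of the regularized kernel. -/
def regularizedWeight (m m' μ : ℝ) (ξ : Fin 2 → ℤ) : ℂ :=
  ((regularizedTerm m m' (normSq ξ) μ : ℝ) : ℂ)

theorem Neighbours.norm_regularizedWeight_le {m m' : ℝ} (h : Neighbours m m') (ξ : Fin 2 → ℤ)
    {μ : ℝ} (hμ : μ ∈ Set.Icc m m') :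
    ‖regularizedWeight m m' μ ξ‖ ≤ regularizedBound m' * ‖gramWeight ξ‖ := by
  rw [regularizedWeight, gramWeight, Complex.norm_real, Complex.norm_real, Real.norm_eq_abs,
    Real.norm_of_nonneg (by positivity)]
  exact h.abs_regularizedTerm_le ξ hμ

theorem Neighbours.continuousOn_kernel {m m' : ℝ} (h : Neighbours m m') (y : Torus) :
    ContinuousOn (fun μ => kernel (regularizedWeight m m' μ) y) (Set.Icc m m') := by
  unfold kernel
  refine continuousOn_const.mul (continuousOn_tsum (fun ξ => ?_)
    (summable_gramWeight.mul_left (regularizedBound m')) fun ξ μ hμ => ?_)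
  · exact (Complex.continuous_ofReal.comp_continuousOn
      (h.continuousOn_regularizedTerm ξ)).mul continuousOn_const
  · rw [norm_mul, norm_character, mul_one]
    exact h.norm_regularizedWeight_le ξ hμ

theorem kernelMatrix_smul (x₁ x₂ : Torus) (r : ℂ) (c : (Fin 2 → ℤ) → ℂ) :
    kernelMatrix x₁ x₂ (r • c) = r • kernelMatrix x₁ x₂ c := by
  ext l k
  simp only [kernelMatrix, kernel, Matrix.of_apply, Matrix.smul_apply, Pi.smul_apply, smul_eq_mul,
    mul_assoc, tsum_mul_left]
  ring

/-- The indicator function of a circle. -/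
def shellWeight (ν : ℝ) (ξ : Fin 2 → ℤ) : ℂ := if normSq ξ = ν then 1 else 0

/-- The quadratic form is (1/4π²) ∑ |∑ v_k conj(e_ξ(x_k))|² over the circle, which by separation
vanishes only at v = 0. -/
theorem Separates.posDef_shellWeight {x₁ x₂ : Torus} (hs : Separates x₁ x₂) {ν : ℝ} (hν : ν ≠ 0)
    (hN : ∃ ξ, normSq ξ = ν) : (kernelMatrix x₁ x₂ (shellWeight ν)).PosDef := by
  refine Matrix.PosDef.of_dotProduct_mulVec_pos (kernelMatrix_isHermitian x₁ x₂ fun ξ => ?_)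
    fun v hv => ?_
  · unfold shellWeight
    split_ifs <;> simp
  have hk : ∀ y, kernel (shellWeight ν) y
      = 1 / (4 * (π : ℂ) ^ 2) * ∑ ξ ∈ shell ν, character ξ y := by
    intro y
    rw [kernel, tsum_eq_sum (s := shell ν) fun ξ hξ => by
      rw [shellWeight, if_neg fun h => hξ (mem_shell.2 h), zero_mul]]
    congr 1
    refine Finset.sum_congr rfl fun ξ hξ => ?_
    rw [shellWeight, if_pos (mem_shell.1 hξ), one_mul]
  have e : star v ⬝ᵥ (kernelMatrix x₁ x₂ (shellWeight ν) *ᵥ v)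
      = ((1 / (4 * π ^ 2) * ∑ ξ ∈ shell ν,
        ‖∑ k, v k * conj (character ξ (points x₁ x₂ k))‖ ^ 2 : ℝ) : ℂ) := by
    simp only [dotProduct, Matrix.mulVec, kernelMatrix, Matrix.of_apply, hk, Finset.mul_sum,
      Finset.sum_mul, Fin.sum_univ_two, Pi.star_apply, RCLike.star_def, ← Finset.sum_add_distrib]
    push_cast
    refine Finset.sum_congr rfl fun ξ _ => ?_
    rw [← Complex.mul_conj']
    simp only [character_sub_right, map_add, map_mul, Complex.conj_conj]
    ring
  rw [e, Complex.zero_lt_real]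
  refine mul_pos (by positivity) ((Finset.sum_nonneg fun ξ _ => by positivity).lt_of_ne' ?_)
  intro h0
  refine hv (hs.eq_zero hν hN fun ξ hξ => ?_)
  have h1 := (Finset.sum_eq_zero_iff_of_nonneg fun ξ _ => by positivity).1 h0 ξ (mem_shell.2 hξ)
  simpa using h1

theorem Separates.posDef_gramT_mul {x₁ x₂ : Torus} (hs : Separates x₁ x₂)
    {S : Matrix (Fin 2) (Fin 2) ℂ} (hS : S.PosDef) :
    (gramT x₁ x₂ * S * (gramT x₁ x₂)ᵀ).PosDef := by
  rw [← star_gramT]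
  refine hS.mul_mul_conjTranspose_same fun v w hvw => sub_eq_zero.1 ?_
  refine hs.vecMul_gramT_injective ?_
  rw [Matrix.sub_vecMul, sub_eq_zero]
  exact hvw

/-- At each endpoint the factor p kills all terms of the kernel except those of the circle with its
pole there, and these have opposite signs at m and m'. So M passes from positive to negative
definite. -/
theorem Separates.exists_newEigenvalue {x₁ x₂ : Torus} (hs : Separates x₁ x₂)
    {U : Matrix.unitaryGroup (Fin 2) ℂ} (hU : (U : Matrix (Fin 2) (Fin 2) ℂ) ≠ -1) {m m' : ℝ}
    (h : Neighbours m m') : ∃ μ ∈ Set.Ioo m m', μ ∈ newEigenvalues x₁ x₂ U := by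
  have hlt := h.lt
  have hpos := h.pos
  set T := gramT x₁ x₂ with hT
  have hend : ((m' - m : ℝ) : ℂ) > 0 := Complex.zero_lt_real.2 (by linarith)
  have hleft : regularizedWeight m m' m = -((m' - m : ℝ) : ℂ) • shellWeight m := by
    funext ξ
    simp only [regularizedWeight, regularizedTerm, shellWeight, Pi.smul_apply, smul_eq_mul]
    by_cases h1 : normSq ξ = m
    · simp [h1]
    · simp [h1]
  have hright : regularizedWeight m m' m' = ((m' - m : ℝ) : ℂ) • shellWeight m' := by
    funext ξ
    simp only [regularizedWeight, regularizedTerm, shellWeight, Pi.smul_apply, smul_eq_mul]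
    by_cases h1 : normSq ξ = m'
    · simp [h1, hlt.ne']
    · simp [h1]
  obtain ⟨μ, hμ, w, hw, hw0⟩ := exists_vecMul_eq_zero U hU
    (M := fun μ => T * -kernelMatrix x₁ x₂ (regularizedWeight m m' μ) * Tᵀ)
    (p := fun μ => (μ - m) * (m' - μ)) hlt
    (fun i j => by
      simp only [Matrix.mul_apply, Fin.sum_univ_two, Matrix.neg_apply, kernelMatrix,
        Matrix.of_apply]
      have := h.continuousOn_kernel
      fun_prop (disch := exact this _))
    (fun μ _ => by
      rw [hT, ← star_gramT]
      refine Matrix.isHermitian_mul_mul_conjTranspose _ (Matrix.IsHermitian.neg ?_)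
      exact kernelMatrix_isHermitian x₁ x₂ fun ξ => Complex.conj_ofReal _)
    (by
      rw [hleft, kernelMatrix_smul, neg_smul, neg_neg]
      exact hs.posDef_gramT_mul ((hs.posDef_shellWeight hpos.ne' h.left).smul hend))
    (by
      rw [hright, kernelMatrix_smul, mul_neg, neg_mul, neg_neg]
      exact hs.posDef_gramT_mul ((hs.posDef_shellWeight (hpos.trans hlt).ne' h.right).smul hend))
    (by fun_prop) (by simp) (by simp)
    (fun t ht => (mul_pos (sub_pos.2 ht.1) (sub_pos.2 ht.2)).ne')
  have hp : ((μ - m) * (m' - μ)) ≠ 0 := (mul_pos (sub_pos.2 hμ.1) (sub_pos.2 hμ.2)).ne'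
  have hp' : (((μ - m) * (m' - μ) : ℝ) : ℂ) ≠ 0 := by exact_mod_cast hp
  have hreg : regularizedWeight m m' μ
      = (((μ - m) * (m' - μ) : ℝ) : ℂ) • resolventWeight μ := by
    funext ξ
    rw [regularizedWeight, regularizedTerm_eq hμ, Pi.smul_apply, resolventWeight, smul_eq_mul,
      ← Complex.ofReal_mul]
  refine ⟨μ, hμ, hs.mem_newEigenvalues (fun ξ hξ => h.gap ξ (hξ ▸ hμ)) ?_ hw ?_⟩
  · have h1 : Summable fun ξ => ‖regularizedWeight m m' μ ξ‖ :=
      Summable.of_nonneg_of_le (fun ξ => norm_nonneg _)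
        (fun ξ => h.norm_regularizedWeight_le ξ ⟨hμ.1.le, hμ.2.le⟩)
        (summable_gramWeight.mul_left _)
    simp only [hreg, Pi.smul_apply, norm_smul] at h1
    exact (summable_mul_left_iff (norm_ne_zero_iff.2 hp')).1 h1
  · rw [hreg, kernelMatrix_smul, ← smul_neg, mul_smul_comm, smul_mul_assoc, mul_smul_comm,
      mul_comm Complex.I, ← smul_smul, ← smul_add, Matrix.vecMul_smul] at hw0
    exact (smul_eq_zero.1 hw0).resolve_left hp'

theorem exists_neighbours {m n : ℝ} (hm0 : 0 < m) (hmn : m < n) (hm : ∃ ξ, normSq ξ = m)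
    (hn : ∃ ξ, normSq ξ = n) : ∃ m' ≤ n, Neighbours m m' := by
  obtain ⟨η, rfl⟩ := hn
  have hfin : {ξ | m < normSq ξ ∧ normSq ξ ≤ normSq η}.Finite :=
    (finite_normSq_le (normSq η)).subset fun ξ h => h.2
  obtain ⟨ζ, ⟨h1, h2⟩, h3⟩ := Set.exists_min_image _ normSq hfin ⟨η, hmn, le_rfl⟩
  refine ⟨normSq ζ, h2, hm0, h1, hm, ⟨ζ, rfl⟩, fun ξ hξ => ?_⟩
  exact absurd (h3 ξ ⟨hξ.1, hξ.2.le.trans h2⟩) (not_le.2 hξ.2)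

/-- Between two positive old eigenvalues lies a new one. The eigenvalue 0 must be set aside, since
its circle is a single point and gives only a rank-one form, hence the bound 2. -/
theorem Separates.encard_eigenvalues_le {x₁ x₂ : Torus} (hs : Separates x₁ x₂)
    {U : Matrix.unitaryGroup (Fin 2) ℂ} (hU : (U : Matrix (Fin 2) (Fin 2) ℂ) ≠ -1) {s t : ℝ}
    (hd : Disjoint (Set.Ioo s t) (newEigenvalues x₁ x₂ U)) :
    (Set.Ioo s t ∩ eigenvalues negLaplace).encard ≤ 2 := by
  refine encard_le_two_of_forall fun ν hν hmem => ?_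
  have key : ∀ i j, ν i ≠ 0 → ν i < ν j → False := by
    intro i j hi hij
    obtain ⟨ξ, hξ⟩ := mem_eigenvalues_negLaplace.1 (hmem i).2
    have hpos : 0 < ν i := lt_of_le_of_ne (hξ ▸ normSq_nonneg ξ) hi.symm
    obtain ⟨m', hm', hnb⟩ := exists_neighbours hpos hij ⟨ξ, hξ⟩
      (mem_eigenvalues_negLaplace.1 (hmem j).2)
    obtain ⟨μ, hμ, hnew⟩ := hs.exists_newEigenvalue hU hnb
    exact Set.disjoint_left.1 hd ⟨(hmem i).1.1.trans hμ.1, hμ.2.trans_le (hm'.trans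
      (hmem j).1.2.le)⟩ hnew
  have key2 : ∀ i j, i ≠ j → ν i ≠ 0 → ν j ≠ 0 → False := fun i j hij hi hj =>
    (hν.ne hij).lt_or_gt.elim (key i j hi) (key j i hj)
  -- At most one of the three values is 0, so two nonzero ones remain.
  by_cases h0 : ν 0 = 0
  · exact key2 1 2 (by decide) (fun h => absurd (hν (h.trans h0.symm)) (by decide))
      (fun h => absurd (hν (h.trans h0.symm)) (by decide))
  · by_cases h1 : ν 1 = 0
    · exact key2 0 2 (by decide) h0 (fun h => absurd (hν (h.trans h1.symm)) (by decide))
    · exact key2 0 1 (by decide) h0 h1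

end

end TwoScatterers

/-! ### The multiplicity formula and weak interlacing -/

open TwoScatterers
theorem corollaryA5 (x₁ x₂ : Torus) (α : Fin 2 → ℝ)
    (hα : ∀ j, ((α j : ℝ) : AddCircle (2 * Real.pi)) = x₂ j - x₁ j)
    (hdio : IsDiophantine fun j => α j / Real.pi)
    (U : Matrix.unitaryGroup (Fin 2) ℂ) :
    (∀ μ : ℝ, μ ≠ 0 → μ ∈ eigenvalues negLaplace →
      eigenspace (negLaplaceExt x₁ x₂ U) μ ≤ eigenspace negLaplace μ ∧
      FiniteDimensional ℂ (eigenspace negLaplace μ) ∧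
      (Module.finrank ℂ (eigenspace (negLaplaceExt x₁ x₂ U) μ) : ℤ) =
        Module.finrank ℂ (eigenspace negLaplace μ) -
          (1 + (U : Matrix (Fin 2) (Fin 2) ℂ)).rank) ∧
    ((U : Matrix (Fin 2) (Fin 2) ℂ) ≠ -1 →
      WeaklyInterlaces (newEigenvalues x₁ x₂ U) (eigenvalues negLaplace)) := by
  have hs := separates_of_isDiophantine hα hdio
  -- The constant 2 serves in both directions, and disjointness is built into the definition of the
  -- new eigenvalues.
  refine ⟨fun μ hμ hN => ?_, fun hU => ⟨Set.disjoint_sdiff_left, 2, fun s t =>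
    ⟨fun hd => hs.encard_eigenvalues_le hU hd, fun hd => hs.encard_newEigenvalues_le U hd⟩⟩⟩
  have hN' := mem_eigenvalues_negLaplace.1 hN
  refine ⟨fun g hg => ((hs.mem_eigenspace_negLaplaceExt_iff hμ hN').1 hg).1,
    finiteDimensional_eigenspace_negLaplace μ, ?_⟩
  rw [← hs.finrank_eigenspace_negLaplaceExt U hμ hN']
  push_cast
  ring
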